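/- **Setting.** Let $\Pi:\mathbb R^d\to\mathbb R^d$ be of class $C^2$. Assume that there is a bounded, open, connected set $\mathcal X\subset\mathbb R^d$ with $\Pi(\mathcal X)\subset\mathcal X$, such that the $\omega$-limit set of every point of $\mathcal X$ consists of a single fixed point of $\Pi$, belonging to a finite list of fixed points in $\mathcal X$: the distinct points $x^\star_1,\dots,x^\star_N$, at which the Jacobian matrix of $\Pi$ has spectral radius smaller than $1$, and fixed points at which it has spectral radius larger than $1$. Assume moreover that there are $R_0,\varepsilon_0>0$ with $\|\Pi(x)\|^2\le\|x\|^2-\varepsilon_0$ whenever $\|x\|\ge R_0$. Let $\xi_1,\xi_2,\dots$ be i.i.d. centred Gaussian random vectors in $\mathbb R^d$ with positive definite covariance matrix $\Sigma$, and for $\sigma>0$ consider the Markov chain $X_{n+1}=\Pi(X_n)+\sigma\xi_{n+1}$, with transition density $$k_\sigma(x,y)=\frac{1}{(2\pi\sigma^2)^{d/2}(\det\Sigma)^{1/2}}\exp\Bigl(-\frac{1}{2\sigma^2}\bigl\langle y-\Pi(x),\Sigma^{-1}(y-\Pi(x))\bigr\rangle\Bigr).$$ For $1\le i\le N$ let $B_i$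 be a closed set with $x^\star_i$ in its interior and $\Pi(B_i)\subset B_i$. Put $\mathcal M=\bigcup_{j}B_j$ and $\tau^+_{\mathcal M}=\inf\{n\ge1: X_n\in\mathcal M\}$. Let $K_{\sigma,B_i}$ be the kernel of the trace process on $\mathcal M$, killed upon leaving $B_i$, that is, $K_{\sigma,B_i}(x,C)=\mathbb P^x\{\tau^+_{\mathcal M}<\infty,\ X_{\tau^+_{\mathcal M}}\in C\}$ for $x\in B_i$ and Borel sets $C\subset B_i$. Let, for $x,y\in B_i$, $$k_{\sigma,B_i}(x,y)=k_\sigma(x,y)+\sum_{n\ge1}\int_{(\mathcal M^c)^n}k_\sigma(x,z_1)k_\sigma(z_1,z_2)\cdots k_\sigma(z_n,y)\,dz_1\cdots dz_n,$$ and let $k^n_{\sigma,B_i}$ be the $n$-fold iterate of $k_{\sigma,B_i}$ on $B_i$. **Proposition.** There exist $\delta_0,\sigma_0>0$ such that, for all sets $B_1,\dots,B_N$ as above of diameter at most $\delta_0$, there are a function $n_0:(0,\sigma_0)\to\{1,2,\dots\}$ and constants $L\in(1,2)$ and $c,C>0$, independent of $\sigma$, such that the following holds. 1. For every $\sigma\in(0,\sigma_0)$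 and every $1\le i\le N$, the function $k_{\sigma,B_i}$ is a density of $K_{\sigma,B_i}$ with respect to Lebesgue measure on $B_i$, and with $n=n_0(\sigma)$, $$\sup_{x\in B_i}k^{n}_{\sigma,B_i}(x,y)\le L\inf_{x\in B_i}k^{n}_{\sigma,B_i}(x,y)<\infty\qquad\text{for all }y\in B_i.$$ 2. For every $\eta>0$ one has $n_0(\sigma)\le e^{\eta/\sigma^2}$ for all sufficiently small $\sigma>0$. 3. $c\log(\sigma^{-1})\le n_0(\sigma)\le C\log(\sigma^{-1})$ for all $\sigma\in(0,\sigma_0)$. -/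

import Mathlib

open MeasureTheory ProbabilityTheory Filter Topology
open scoped ENNReal

noncomputable section

namespace MetastableChain

/-! ### The deterministic map -/

/-- The Jacobian matrix of `F` at `x`, seen as a complex matrix. -/
def jacobian {d : ℕ} (F : EuclideanSpace ℝ (Fin d) → EuclideanSpace ℝ (Fin d))
    (x : EuclideanSpace ℝ (Fin d)) : Matrix (Fin d) (Fin d) ℂ :=
  (LinearMap.toMatrix (EuclideanSpace.basisFun (Fin d) ℝ).toBasis
    (EuclideanSpace.basisFun (Fin d) ℝ).toBasis
    (fderiv ℝ F x : EuclideanSpace ℝ (Fin d) →ₗ[ℝ] EuclideanSpace ℝ (Fin d))).map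
      (algebraMap ℝ ℂ)

/-- Linearly asymptotically stable fixed point: all (complex) eigenvalues of the Jacobian
matrix have modulus smaller than one. -/
def IsLinearlyStable {d : ℕ} (F : EuclideanSpace ℝ (Fin d) → EuclideanSpace ℝ (Fin d))
    (x : EuclideanSpace ℝ (Fin d)) : Prop :=
  F x = x ∧ spectralRadius ℂ (jacobian F x) < 1

/-- Linearly unstable fixed point: some (complex) eigenvalue of the Jacobian matrix has
modulus larger than one. -/
def IsLinearlyUnstable {d : ℕ} (F : EuclideanSpace ℝ (Fin d) → EuclideanSpace ℝ (Fin d))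
    (x : EuclideanSpace ℝ (Fin d)) : Prop :=
  F x = x ∧ 1 < spectralRadius ℂ (jacobian F x)

/-- The `ω`-limit set of `x`: the accumulation points of the forward orbit of `x`. -/
def limitSet {d : ℕ} (F : EuclideanSpace ℝ (Fin d) → EuclideanSpace ℝ (Fin d))
    (x : EuclideanSpace ℝ (Fin d)) : Set (EuclideanSpace ℝ (Fin d)) :=
  {z | MapClusterPt z atTop (fun n : ℕ => F^[n] x)}

/-- Assumption on the deterministic limit: `F` is of class `C²` and leaves the bounded domain
`D` invariant; the limit sets in `D` are finitely many fixed points, namely the distinct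
linearly asymptotically stable fixed points `xs i`, and linearly unstable fixed points. -/
structure DeterministicLimit {d N : ℕ}
    (F : EuclideanSpace ℝ (Fin d) → EuclideanSpace ℝ (Fin d))
    (D : Set (EuclideanSpace ℝ (Fin d))) (xs : Fin N → EuclideanSpace ℝ (Fin d)) : Prop where
  contDiff : ContDiff ℝ 2 F
  isOpen : IsOpen D
  isConnected : IsConnected D
  isBounded : Bornology.IsBounded D
  mapsTo : Set.MapsTo F D D
  injective : Function.Injective xs
  stable_mem : ∀ i, xs i ∈ D
  stable : ∀ i, IsLinearlyStable F (xs i)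
  limit_sets : ∃ U : Set (EuclideanSpace ℝ (Fin d)), U.Finite ∧ U ⊆ D ∧
    (∀ u ∈ U, IsLinearlyUnstable F u) ∧
    ∀ x ∈ D, (∃ i, limitSet F x = {xs i}) ∨ ∃ u ∈ U, limitSet F x = {u}

/-- Closed, forward invariant neighbourhoods `B i` of the points `xs i`, of diameter at most
`δ`. -/
structure IsMetastableFamily {d N : ℕ}
    (F : EuclideanSpace ℝ (Fin d) → EuclideanSpace ℝ (Fin d))
    (xs : Fin N → EuclideanSpace ℝ (Fin d)) (B : Fin N → Set (EuclideanSpace ℝ (Fin d)))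
    (δ : ℝ) : Prop where
  isClosed : ∀ i, IsClosed (B i)
  mem_interior : ∀ i, xs i ∈ interior (B i)
  mapsTo : ∀ i, Set.MapsTo F (B i) (B i)
  diam_le : ∀ i, ∀ x ∈ B i, ∀ y ∈ B i, dist x y ≤ δ

/-! ### The Markov chain and its trace on a set -/

/-- The chain `X₀ = x`, `X_{n+1} = F(X_n) + σ ξ_{n+1}`. -/
def chain {d : ℕ} {Ω : Type*} (F : EuclideanSpace ℝ (Fin d) → EuclideanSpace ℝ (Fin d))
    (ξ : ℕ → Ω → EuclideanSpace ℝ (Fin d)) (σ : ℝ) (x : EuclideanSpace ℝ (Fin d)) :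
    ℕ → Ω → EuclideanSpace ℝ (Fin d)
  | 0 => fun _ => x
  | n + 1 => fun ω => F (chain F ξ σ x n ω) + σ • ξ (n + 1) ω

/-- `n` is the return time `τ⁺_M = inf {n ≥ 1 : X_n ∈ M}` of the path `X`. -/
def IsReturnTime {E : Type*} (X : ℕ → E) (M : Set E) (n : ℕ) : Prop :=
  1 ≤ n ∧ X n ∈ M ∧ ∀ m, 1 ≤ m → m < n → X m ∉ M

/-- The kernel of the trace process on `M` killed upon leaving `A ⊆ M`:
`(x, C) ↦ P {τ⁺_M < ∞, X_{τ⁺_M} ∈ C ∩ A}` for the chain started in `x`. -/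
def killedTraceKernel {E Ω : Type*} [MeasurableSpace Ω] (P : Measure Ω)
    (X : E → ℕ → Ω → E) (M A : Set E) (x : E) (C : Set E) : ℝ≥0∞ :=
  P {ω | ∃ n, IsReturnTime (fun m => X x m ω) M n ∧ X x n ω ∈ C ∩ A}

/-! ### Densities -/

/-- The continuous density of the law of `F(x) + σ ξ`, where `ξ` is centred normal with
covariance matrix `S`. -/
def gaussianStepDensity {d : ℕ} (F : EuclideanSpace ℝ (Fin d) → EuclideanSpace ℝ (Fin d))
    (S : Matrix (Fin d) (Fin d) ℝ) (σ : ℝ) (x y : EuclideanSpace ℝ (Fin d)) : ℝ≥0∞ :=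
  ENNReal.ofReal
    (((2 * Real.pi * σ ^ 2) ^ ((d : ℝ) / 2) * Real.sqrt S.det)⁻¹ *
      Real.exp (-((1 / 2) * ((y - F x).ofLp ⬝ᵥ S⁻¹.mulVec (y - F x).ofLp)) / σ ^ 2))

/-- For a chain with transition density `k`, the density in `y` of the event
`τ⁺_M = n + 1, X_{n+1} ∈ dy` for the chain started in `x`, for `y ∈ M`. -/
def firstReturnDensity {d : ℕ}
    (k : EuclideanSpace ℝ (Fin d) → EuclideanSpace ℝ (Fin d) → ℝ≥0∞)
    (M : Set (EuclideanSpace ℝ (Fin d))) :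
    ℕ → EuclideanSpace ℝ (Fin d) → EuclideanSpace ℝ (Fin d) → ℝ≥0∞
  | 0 => k
  | n + 1 => fun x y => ∫⁻ z in Mᶜ, k x z * firstReturnDensity k M n z y

/-- The density on `M` of the kernel of the trace process on `M`: the sum over all `n ≥ 1` of
the densities of the events `τ⁺_M = n, X_n ∈ dy`. -/
def traceDensity {d : ℕ}
    (k : EuclideanSpace ℝ (Fin d) → EuclideanSpace ℝ (Fin d) → ℝ≥0∞)
    (M : Set (EuclideanSpace ℝ (Fin d))) (x y : EuclideanSpace ℝ (Fin d)) : ℝ≥0∞ :=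
  ∑' n, firstReturnDensity k M n x y

/-- The density of the `n`-th power, `n ≥ 1`, of the kernel on `A` with density `k`
(the value at `n = 0` is a dummy). -/
def iterDensity {d : ℕ}
    (k : EuclideanSpace ℝ (Fin d) → EuclideanSpace ℝ (Fin d) → ℝ≥0∞)
    (A : Set (EuclideanSpace ℝ (Fin d))) :
    ℕ → EuclideanSpace ℝ (Fin d) → EuclideanSpace ℝ (Fin d) → ℝ≥0∞
  | 0 => fun _ _ => 0
  | 1 => k
  | n + 2 => fun x y => ∫⁻ z in A, k x z * iterDensity k A (n + 1) z y

/-! ### Uniform positivity -/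

/-- The kernel `κ` on `A` has density `k` with respect to Lebesgue measure, and satisfies
the uniform positivity condition
`sup_{x ∈ A} kⁿ(x, y) ≤ L inf_{x ∈ A} kⁿ(x, y) < ∞` for all `y ∈ A`,
with parameters `n ≥ 1` and `L > 1`. -/
structure UniformPositivityCondition {d : ℕ} (A : Set (EuclideanSpace ℝ (Fin d)))
    (κ : EuclideanSpace ℝ (Fin d) → Set (EuclideanSpace ℝ (Fin d)) → ℝ≥0∞)
    (k : EuclideanSpace ℝ (Fin d) → EuclideanSpace ℝ (Fin d) → ℝ≥0∞)
    (n : ℕ) (L : ℝ) : Prop where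
  density : ∀ x ∈ A, ∀ C, MeasurableSet C → C ⊆ A → κ x C = ∫⁻ y in C, k x y
  one_le : 1 ≤ n
  one_lt : 1 < L
  finite : ∀ y ∈ A, (⨆ x ∈ A, iterDensity k A n x y) < ∞
  sup_le_inf : ∀ y ∈ A,
    (⨆ x ∈ A, iterDensity k A n x y) ≤ ENNReal.ofReal L * ⨅ x ∈ A, iterDensity k A n x y

/-- The uniform positivity assumption for `0 < σ < σ₀` and the function `n₀`: there is a
constant `L ∈ (1, 2)`, independent of `σ`, such that for every `i` the kernel `κ σ i` on `B i`,
of density `k σ i`, satisfies a uniform positivity condition with parameters `n₀ σ` and `L`;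
and for every `η > 0`, one has `n₀ σ ≤ exp(η / σ²)` for all small enough `σ > 0`. -/
def UniformPositivity {d N : ℕ} (B : Fin N → Set (EuclideanSpace ℝ (Fin d)))
    (κ : ℝ → Fin N → EuclideanSpace ℝ (Fin d) → Set (EuclideanSpace ℝ (Fin d)) → ℝ≥0∞)
    (k : ℝ → Fin N → EuclideanSpace ℝ (Fin d) → EuclideanSpace ℝ (Fin d) → ℝ≥0∞)
    (σ₀ : ℝ) (n₀ : ℝ → ℕ) : Prop :=
  (∃ L : ℝ, 1 < L ∧ L < 2 ∧ ∀ σ, 0 < σ → σ < σ₀ → ∀ i,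
      UniformPositivityCondition (B i) (κ σ i) (k σ i) (n₀ σ) L) ∧
    ∀ η : ℝ, 0 < η → ∃ σ₁ : ℝ, 0 < σ₁ ∧ ∀ σ, 0 < σ → σ ≤ σ₁ →
      (n₀ σ : ℝ) ≤ Real.exp (η / σ ^ 2)

end MetastableChain

end

noncomputable section

namespace MetastableChain

/-! ### The Gaussian transition density -/

/-! The claim reduces to a Harnack inequality on each `B i`: the `n`-fold density at `y` changes by
a factor of at most 3/2 when the starting point varies, for every `n ≥ c log σ⁻¹`. Such an
inequality survives composition with further steps (`iterDensity_harnack_mono`), so one `n₀` of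
order `log σ⁻¹` serves all `i`, and the subexponential bound on `n₀` follows. That the series of
first-return densities represents the killed trace kernel is the Markov property
(`killedTraceKernel_eq`).

The logarithm comes from a coupling. Near a stable fixed point `F` contracts an adapted norm, so two
copies of the chain driven by the same noise approach each other geometrically. After order `log
σ⁻¹` steps their distance is so small compared with `σ ^ 2` that comparing two Gaussian densities
merges them at the cost of a factor 1.01 (`coupling_bound`, `coupling_le`). Leaving the
neighbourhood has probability of order `exp (-P / σ ^ 2)`. The work lies in showing that this error
is negligible relative to the quantity estimated. A Lyapunov function provides an a priori bound
`exp (J / σ ^ 2)` for the trace density (`KernelBounds.exists_traceDensity_le_exp`), so all suprema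
are finite and can be absorbed.

The threshold `σ₀` may not depend on the sets `B i`, which can be arbitrarily small, whereas the
constants in front of `log σ⁻¹` may. Hence two regimes, separated by a level `σB` depending on `B`.

For `σ < σB` the set contains a ball that is large compared with the noise. In it every step of the
chain is a step of the trace, and the coupling applies to the iterated densities. Each block of
steps multiplies the error by an exponentially small factor, and a bounded number of blocks beats
the a priori bounds (`iterDensity_harnack_of_ball`).

For `σB ≤ σ < σ₀` the volume of `B` decides (`exists_local_dichotomy`). If it is exponentially
small, the chain wanders near the fixed point long before hitting `B` and forgets its start, so the
trace density itself is nearly constant in the starting point (`traceDensity_harnack_of_small`).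
Otherwise the chain returns to `B` long before it leaves the neighbourhood, so the probabilities
that the trace stays in `B` for `n` steps are comparable (`trace_iterate_one_comparison`). The trace
density on `B` then has bounds depending only on `B` through `σB`, and a Hopf contraction makes the
ratio of the iterated density to these probabilities nearly constant after a number of steps
depending only on these bounds (`exists_hopf`). Since `log σ⁻¹ ≥ 1/2`, that number is also absorbed
by a multiple of `log σ⁻¹`. -/

lemma integrable_exp_neg_half_norm_sq (d : ℕ) :
    Integrable (fun z : EuclideanSpace ℝ (Fin d) => Real.exp (-(‖z‖ ^ 2 / 2))) := by
  have h := GaussianFourier.integrable_cexp_neg_mul_sq_norm_add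
    (V := EuclideanSpace ℝ (Fin d)) (b := (1 / 2 : ℂ)) (by norm_num) 0 0
  have h' := h.re
  refine h'.congr (ae_of_all _ fun z => ?_)
  have : (-(1 / 2 : ℂ) * (‖z‖ : ℂ) ^ 2 + 0 * (inner ℝ (0 : EuclideanSpace ℝ (Fin d)) z : ℝ))
      = ((-(‖z‖ ^ 2 / 2) : ℝ) : ℂ) := by
    push_cast; ring
  simp only [this]
  rw [← Complex.ofReal_exp]
  rfl

/-- Both are finite measures with the same characteristic function, by the Gaussian Fourier
integral. -/
lemma stdGaussian_eq_withDensity (d : ℕ) :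
    stdGaussian (EuclideanSpace ℝ (Fin d)) =
      (volume : Measure (EuclideanSpace ℝ (Fin d))).withDensity
        (fun z => ENNReal.ofReal (((2 * Real.pi) ^ ((d : ℝ) / 2))⁻¹ *
          Real.exp (-(‖z‖ ^ 2 / 2)))) := by
  have hint : Integrable (fun z : EuclideanSpace ℝ (Fin d) =>
      ((2 * Real.pi) ^ ((d : ℝ) / 2))⁻¹ * Real.exp (-(‖z‖ ^ 2 / 2))) :=
    (integrable_exp_neg_half_norm_sq d).const_mul _
  have hpos : 0 < (2 * Real.pi) ^ ((d : ℝ) / 2) := by positivity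
  have : IsFiniteMeasure ((volume : Measure (EuclideanSpace ℝ (Fin d))).withDensity
        (fun z => ENNReal.ofReal (((2 * Real.pi) ^ ((d : ℝ) / 2))⁻¹ *
          Real.exp (-(‖z‖ ^ 2 / 2))))) := isFiniteMeasure_withDensity_ofReal hint.2
  apply Measure.ext_of_charFun
  ext t
  rw [charFun_stdGaussian, charFun_apply]
  rw [integral_withDensity_eq_integral_toReal_smul (by fun_prop) (by simp)]
  have h := GaussianFourier.integral_cexp_neg_mul_sq_norm_add
    (V := EuclideanSpace ℝ (Fin d)) (b := (1 / 2 : ℂ)) (by norm_num) Complex.I t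
  have e1 : ∀ z : EuclideanSpace ℝ (Fin d),
      (ENNReal.ofReal (((2 * Real.pi) ^ ((d : ℝ) / 2))⁻¹ *
          Real.exp (-(‖z‖ ^ 2 / 2)))).toReal • Complex.exp ((inner ℝ z t : ℝ) * Complex.I)
      = ((((2 * Real.pi) ^ ((d : ℝ) / 2))⁻¹ : ℝ) : ℂ) *
        Complex.exp (-(1 / 2 : ℂ) * (‖z‖ : ℂ) ^ 2 + Complex.I * (inner ℝ t z : ℝ)) := by
    intro z
    rw [ENNReal.toReal_ofReal (by positivity), Complex.real_smul, Complex.ofReal_mul,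
      Complex.ofReal_exp, mul_assoc, ← Complex.exp_add, real_inner_comm]
    congr 2
    push_cast; ring
  simp_rw [e1]
  rw [integral_const_mul, h]
  simp only [finrank_euclideanSpace, Fintype.card_fin]
  have e2 : ((Real.pi : ℂ) / (1 / 2)) ^ ((d : ℂ) / 2)
      = (((2 * Real.pi) ^ ((d : ℝ) / 2) : ℝ) : ℂ) := by
    rw [Complex.ofReal_cpow (by positivity)]
    push_cast
    congr 1
    ring
  rw [e2, ← mul_assoc, ← Complex.ofReal_mul, inv_mul_cancel₀ hpos.ne']
  simp only [Complex.ofReal_one, one_mul, Complex.I_sq]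
  congr 1
  ring

/-- The quadratic form of the inverse covariance matrix. -/
def precisionForm {d : ℕ} (S : Matrix (Fin d) (Fin d) ℝ) (v : EuclideanSpace ℝ (Fin d)) : ℝ :=
  v.ofLp ⬝ᵥ S⁻¹.mulVec v.ofLp

open scoped MatrixOrder in
-- The symmetric root satisfies `√S * S⁻¹ * √S = 1`. This is the change of variables that turns a
-- standard Gaussian into one with covariance `S`.
lemma precisionForm_sqrt {d : ℕ} {S : Matrix (Fin d) (Fin d) ℝ} (hS : S.PosDef)
    (z : EuclideanSpace ℝ (Fin d)) :
    precisionForm S (Matrix.toEuclideanCLM (𝕜 := ℝ) (CFC.sqrt S) z) = ‖z‖ ^ 2 := by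
  have hA : (CFC.sqrt S).IsHermitian := (CFC.sqrt_nonneg S).isSelfAdjoint
  have hAA : CFC.sqrt S * CFC.sqrt S = S := CFC.sqrt_mul_sqrt_self _ hS.posSemidef.nonneg
  have hT : (CFC.sqrt S).transpose = CFC.sqrt S := by
    have := hA.eq; rwa [Matrix.conjTranspose_eq_transpose_of_trivial] at this
  have hu : IsUnit S.det := hS.det_pos.ne'.isUnit
  have hid : CFC.sqrt S * S⁻¹ * CFC.sqrt S = 1 := by
    have hdet : (CFC.sqrt S).det * (CFC.sqrt S).det = S.det := by rw [← Matrix.det_mul, hAA]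
    have hu' : IsUnit (CFC.sqrt S).det := by
      rw [isUnit_iff_ne_zero]; intro h0; rw [h0] at hdet; simp at hdet
      exact hS.det_pos.ne' hdet.symm
    have hinv : S⁻¹ = (CFC.sqrt S)⁻¹ * (CFC.sqrt S)⁻¹ := by
      rw [← Matrix.mul_inv_rev, hAA]
    rw [hinv, ← mul_assoc, Matrix.mul_nonsing_inv _ hu', one_mul, Matrix.nonsing_inv_mul _ hu']
  unfold precisionForm
  rw [Matrix.ofLp_toEuclideanCLM, Matrix.dotProduct_mulVec, ← Matrix.mulVec_transpose,
    Matrix.transpose_nonsing_inv]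
  have hST : S.transpose = S := by
    have := hS.1.eq; rwa [Matrix.conjTranspose_eq_transpose_of_trivial] at this
  rw [hST, Matrix.dotProduct_mulVec, ← Matrix.mulVec_transpose, hT, Matrix.mulVec_mulVec,
    Matrix.mulVec_mulVec, hid, Matrix.one_mulVec, EuclideanSpace.norm_sq_eq]
  simp [dotProduct, sq]

lemma precisionForm_smul {d : ℕ} (S : Matrix (Fin d) (Fin d) ℝ) (c : ℝ)
    (v : EuclideanSpace ℝ (Fin d)) : precisionForm S (c • v) = c ^ 2 * precisionForm S v := by
  simp [precisionForm, Matrix.mulVec_smul, sq, mul_assoc]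

lemma continuous_precisionForm {d : ℕ} (S : Matrix (Fin d) (Fin d) ℝ) :
    Continuous (precisionForm S) := by
  unfold precisionForm
  fun_prop

lemma gaussianStepDensity_eq {d : ℕ} (F : EuclideanSpace ℝ (Fin d) → EuclideanSpace ℝ (Fin d))
    (S : Matrix (Fin d) (Fin d) ℝ) (σ : ℝ) (x y : EuclideanSpace ℝ (Fin d)) :
    gaussianStepDensity F S σ x y = ENNReal.ofReal
      (((2 * Real.pi * σ ^ 2) ^ ((d : ℝ) / 2) * Real.sqrt S.det)⁻¹ *
        Real.exp (-(precisionForm S (y - F x) / (2 * σ ^ 2)))) := by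
  unfold gaussianStepDensity precisionForm
  congr 3
  ring

open scoped MatrixOrder in
/-- Integrals against the transition density are Gaussian expectations. -/
lemma lintegral_gaussianStepDensity {d : ℕ}
    (F : EuclideanSpace ℝ (Fin d) → EuclideanSpace ℝ (Fin d))
    {S : Matrix (Fin d) (Fin d) ℝ} (hS : S.PosDef) {σ : ℝ} (hσ : 0 < σ)
    (x : EuclideanSpace ℝ (Fin d)) {f : EuclideanSpace ℝ (Fin d) → ℝ≥0∞} (hf : Measurable f) :
    ∫⁻ y, gaussianStepDensity F S σ x y * f y =
      ∫⁻ w, f (F x + σ • w) ∂(multivariateGaussian 0 S) := by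
  set A := Matrix.toEuclideanCLM (𝕜 := ℝ) (CFC.sqrt S) with hA
  set L : EuclideanSpace ℝ (Fin d) →ₗ[ℝ] EuclideanSpace ℝ (Fin d) :=
    σ • (A : EuclideanSpace ℝ (Fin d) →ₗ[ℝ] EuclideanSpace ℝ (Fin d)) with hL
  have hdetA : LinearMap.det (A : EuclideanSpace ℝ (Fin d) →ₗ[ℝ] EuclideanSpace ℝ (Fin d))
      = Real.sqrt S.det := by
    rw [hA, Matrix.coe_toEuclideanCLM_eq_toEuclideanLin]
    rw [Matrix.toEuclideanLin_eq_toLin_orthonormal, LinearMap.det_toLin]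
    have := Matrix.PosSemidef.det_sqrt hS.posSemidef
    simpa using this
  have hdetL : LinearMap.det L = σ ^ d * Real.sqrt S.det := by
    rw [hL, LinearMap.det_smul, hdetA, finrank_euclideanSpace, Fintype.card_fin]
  have hpos : 0 < σ ^ d * Real.sqrt S.det := by
    have := Real.sqrt_pos.2 hS.det_pos
    positivity
  have hLm : Measurable L := (LinearMap.continuous_of_finiteDimensional L).measurable
  rw [multivariateGaussian, lintegral_map (by fun_prop) (by fun_prop), stdGaussian_eq_withDensity,
    lintegral_withDensity_eq_lintegral_mul _ (by fun_prop) (by fun_prop)]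
  set c := ((2 * Real.pi) ^ ((d : ℝ) / 2))⁻¹ with hc
  set G : EuclideanSpace ℝ (Fin d) → ℝ≥0∞ := fun y =>
    ENNReal.ofReal (c * Real.exp (-(precisionForm S y / (2 * σ ^ 2)))) * f (F x + y) with hG
  have hGm : Measurable G := by
    have := (continuous_precisionForm S).measurable
    rw [hG]
    fun_prop
  have e1 : ∀ z, ((fun z : EuclideanSpace ℝ (Fin d) =>
      ENNReal.ofReal (c * Real.exp (-(‖z‖ ^ 2 / 2)))) *
      fun z => f (F x + σ • (0 + A z))) z = G (L z) := by
    intro z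
    simp only [Pi.mul_apply, hG, hL, LinearMap.smul_apply, zero_add,
      ContinuousLinearMap.coe_coe, precisionForm_smul]
    rw [hA, precisionForm_sqrt hS]
    congr 4
    field_simp
  rw [lintegral_congr e1, ← lintegral_map hGm hLm,
    Measure.map_linearMap_addHaar_eq_smul_addHaar _ (by rw [hdetL]; exact hpos.ne'),
    lintegral_smul_measure, ← lintegral_sub_right_eq_self G (F x), smul_eq_mul,
    ← lintegral_const_mul _ (by fun_prop)]
  refine lintegral_congr fun y => ?_
  simp only [hG]
  rw [← mul_assoc, ← ENNReal.ofReal_mul (by positivity), gaussianStepDensity_eq,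
    add_sub_cancel]
  congr 2
  rw [hdetL, abs_of_pos (by positivity), ← mul_assoc]
  congr 1
  rw [hc, Real.mul_rpow (by positivity) (by positivity), ← Real.rpow_natCast_mul hσ.le]
  have : ((2 : ℕ) : ℝ) * ((d : ℝ) / 2) = d := by push_cast; ring
  rw [this, Real.rpow_natCast]
  field_simp

/-! ### Quantitative bounds on the transition density -/

section QuadraticForm

variable {d : ℕ} (S : Matrix (Fin d) (Fin d) ℝ)

lemma precisionForm_eq_inner (v : EuclideanSpace ℝ (Fin d)) :
    precisionForm S v = inner ℝ v (Matrix.toEuclideanCLM (𝕜 := ℝ) S⁻¹ v) := by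
  rw [Matrix.inner_toEuclideanCLM]; rfl

lemma precisionForm_sub_le (v w : EuclideanSpace ℝ (Fin d)) :
    precisionForm S v - precisionForm S w ≤
      ‖Matrix.toEuclideanCLM (𝕜 := ℝ) S⁻¹‖ * (‖v - w‖ * (‖v‖ + ‖w‖)) := by
  set T := Matrix.toEuclideanCLM (𝕜 := ℝ) S⁻¹ with hT
  have e : precisionForm S v - precisionForm S w
      = inner ℝ (v - w) (T v) + inner ℝ w (T (v - w)) := by
    rw [precisionForm_eq_inner, precisionForm_eq_inner, ← hT, map_sub, inner_sub_left,
      inner_sub_right]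
    ring
  have h1 : inner ℝ (v - w) (T v) ≤ ‖v - w‖ * (‖T‖ * ‖v‖) :=
    (real_inner_le_norm _ _).trans (by gcongr; exact T.le_opNorm v)
  have h2 : inner ℝ w (T (v - w)) ≤ ‖w‖ * (‖T‖ * ‖v - w‖) :=
    (real_inner_le_norm _ _).trans (by gcongr; exact T.le_opNorm _)
  rw [e]
  linarith

lemma precisionForm_le (v : EuclideanSpace ℝ (Fin d)) :
    precisionForm S v ≤ ‖Matrix.toEuclideanCLM (𝕜 := ℝ) S⁻¹‖ * ‖v‖ ^ 2 := by
  have := precisionForm_sub_le S v 0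
  have h0 : precisionForm S (0 : EuclideanSpace ℝ (Fin d)) = 0 := by simp [precisionForm]
  rw [h0] at this
  simp only [sub_zero, norm_zero, add_zero] at this
  linarith [sq ‖v‖]

lemma precisionForm_add_add_sub (v w : EuclideanSpace ℝ (Fin d)) :
    precisionForm S (v + w) + precisionForm S (v - w)
      = 2 * precisionForm S v + 2 * precisionForm S w := by
  simp only [precisionForm_eq_inner, map_add, map_sub, inner_add_left, inner_sub_left,
    inner_add_right, inner_sub_right]
  ring

open scoped MatrixOrder in
lemma exists_norm_sq_le_precisionForm {S : Matrix (Fin d) (Fin d) ℝ} (hS : S.PosDef) :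
    ∃ A : ℝ, 0 < A ∧ ∀ v : EuclideanSpace ℝ (Fin d),
      0 ≤ precisionForm S v ∧ ‖v‖ ^ 2 ≤ A * precisionForm S v := by
  have hAA : CFC.sqrt S * CFC.sqrt S = S := CFC.sqrt_mul_sqrt_self _ hS.posSemidef.nonneg
  have hdet : (CFC.sqrt S).det * (CFC.sqrt S).det = S.det := by rw [← Matrix.det_mul, hAA]
  have hu' : IsUnit (CFC.sqrt S).det := by
    rw [isUnit_iff_ne_zero]; intro h0; rw [h0] at hdet; simp at hdet
    exact hS.det_pos.ne' hdet.symm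
  set A := Matrix.toEuclideanCLM (𝕜 := ℝ) (CFC.sqrt S) with hA
  refine ⟨‖A‖ ^ 2 + 1, by positivity, fun v => ?_⟩
  obtain ⟨z, rfl⟩ : ∃ z, A z = v := by
    refine ⟨Matrix.toEuclideanCLM (𝕜 := ℝ) (CFC.sqrt S)⁻¹ v, ?_⟩
    rw [hA, ← mul_apply_eq_comp, ← map_mul, Matrix.mul_nonsing_inv _ hu', map_one]
    rfl
  rw [hA, precisionForm_sqrt hS, ← hA]
  refine ⟨by positivity, ?_⟩
  have h1 : ‖A z‖ ^ 2 ≤ (‖A‖ * ‖z‖) ^ 2 := by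
    gcongr
    exact A.le_opNorm z
  nlinarith [sq_nonneg ‖z‖]

end QuadraticForm

/-- Quantitative bounds on a family of transition densities `k σ`, `0 < σ < 1`, of chains
`x ↦ F x + noise`. -/
structure KernelBounds {d : ℕ} (F : EuclideanSpace ℝ (Fin d) → EuclideanSpace ℝ (Fin d))
    (k : ℝ → EuclideanSpace ℝ (Fin d) → EuclideanSpace ℝ (Fin d) → ℝ≥0∞) (K : ℝ) : Prop where
  one_le : 1 ≤ K
  measurable : ∀ σ, Measurable (Function.uncurry (k σ))
  noise : ∀ σ, 0 < σ → ∃ γ : Measure (EuclideanSpace ℝ (Fin d)), IsProbabilityMeasure γ ∧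
    ∀ x (f : EuclideanSpace ℝ (Fin d) → ℝ≥0∞), Measurable f →
      ∫⁻ y, k σ x y * f y = ∫⁻ w, f (F x + w) ∂γ
  upper : ∀ σ, 0 < σ → ∀ x y, k σ x y ≤ ENNReal.ofReal (K * (σ⁻¹) ^ d)
  lower : ∀ σ, 0 < σ → σ < 1 → ∀ x y,
    ENNReal.ofReal (K⁻¹ * Real.exp (-(K * ‖y - F x‖ ^ 2 / σ ^ 2))) ≤ k σ x y
  tail : ∀ σ, 0 < σ → ∀ x a, 0 ≤ a → ∫⁻ y in {y | a ≤ ‖y - F x‖}, k σ x y ≤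
    ENNReal.ofReal (K * Real.exp (-(a ^ 2 / (K * σ ^ 2))))
  harnack : ∀ σ, 0 < σ → ∀ x x' y, k σ x y ≤
    ENNReal.ofReal (Real.exp (K * (‖F x - F x'‖ * (‖y - F x‖ + ‖y - F x'‖)) / σ ^ 2)) * k σ x' y
  meanValue : ∀ σ, 0 < σ → ∀ x y, k σ x y ≤
    ENNReal.ofReal (K * (σ⁻¹) ^ d) * ∫⁻ z in Metric.ball y σ, k σ x z
  moment : ∀ σ, 0 < σ → ∀ x, ∫⁻ y, k σ x y * ENNReal.ofReal (‖y‖ ^ 2) ≤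
    ENNReal.ofReal (‖F x‖ ^ 2 + K * σ ^ 2)

section Bounds

variable {d : ℕ} (F : EuclideanSpace ℝ (Fin d) → EuclideanSpace ℝ (Fin d))
  {S : Matrix (Fin d) (Fin d) ℝ}

lemma rpow_normalization (hS : S.PosDef) {σ : ℝ} (hσ : 0 < σ) :
    ((2 * Real.pi * σ ^ 2) ^ ((d : ℝ) / 2) * Real.sqrt S.det)⁻¹ =
      ((2 * Real.pi) ^ ((d : ℝ) / 2) * Real.sqrt S.det)⁻¹ * (σ⁻¹) ^ d := by
  rw [Real.mul_rpow (by positivity) (by positivity), ← Real.rpow_natCast_mul hσ.le]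
  have : ((2 : ℕ) : ℝ) * ((d : ℝ) / 2) = d := by push_cast; ring
  rw [this, Real.rpow_natCast, inv_pow]
  have := Real.sqrt_pos.2 hS.det_pos
  field_simp

lemma gaussian_upper (hS : S.PosDef) {σ : ℝ} (hσ : 0 < σ) (x y : EuclideanSpace ℝ (Fin d)) :
    gaussianStepDensity F S σ x y ≤
      ENNReal.ofReal (((2 * Real.pi) ^ ((d : ℝ) / 2) * Real.sqrt S.det)⁻¹ * (σ⁻¹) ^ d) := by
  rw [gaussianStepDensity_eq, rpow_normalization hS hσ]
  apply ENNReal.ofReal_le_ofReal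
  refine mul_le_of_le_one_right (by positivity) ?_
  rw [Real.exp_le_one_iff]
  obtain ⟨A, -, hA⟩ := exists_norm_sq_le_precisionForm hS
  have := (hA (y - F x)).1
  have : 0 ≤ precisionForm S (y - F x) / (2 * σ ^ 2) := by positivity
  linarith

lemma gaussian_lower (hS : S.PosDef) {σ : ℝ} (hσ : 0 < σ) (hσ1 : σ < 1)
    (x y : EuclideanSpace ℝ (Fin d)) :
    ENNReal.ofReal (((2 * Real.pi) ^ ((d : ℝ) / 2) * Real.sqrt S.det)⁻¹ *
      Real.exp (-(‖Matrix.toEuclideanCLM (𝕜 := ℝ) S⁻¹‖ * ‖y - F x‖ ^ 2 / σ ^ 2))) ≤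
      gaussianStepDensity F S σ x y := by
  rw [gaussianStepDensity_eq, rpow_normalization hS hσ]
  apply ENNReal.ofReal_le_ofReal
  have h1 : 1 ≤ (σ⁻¹) ^ d := one_le_pow₀ ((one_le_inv₀ hσ).2 hσ1.le)
  have h2 : Real.exp (-(‖Matrix.toEuclideanCLM (𝕜 := ℝ) S⁻¹‖ * ‖y - F x‖ ^ 2 / σ ^ 2)) ≤
      Real.exp (-(precisionForm S (y - F x) / (2 * σ ^ 2))) := by
    apply Real.exp_le_exp.2
    apply neg_le_neg
    have h3 := precisionForm_le S (y - F x)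
    have h4 : 0 ≤ ‖Matrix.toEuclideanCLM (𝕜 := ℝ) S⁻¹‖ * ‖y - F x‖ ^ 2 := by positivity
    rw [div_le_div_iff₀ (by positivity) (by positivity)]
    have : 0 < σ ^ 2 := by positivity
    nlinarith
  have h5 : 0 < ((2 * Real.pi) ^ ((d : ℝ) / 2) * Real.sqrt S.det)⁻¹ := by
    have := Real.sqrt_pos.2 hS.det_pos
    positivity
  calc _ ≤ ((2 * Real.pi) ^ ((d : ℝ) / 2) * Real.sqrt S.det)⁻¹ *
      Real.exp (-(precisionForm S (y - F x) / (2 * σ ^ 2))) := by gcongr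
    _ ≤ _ := by
      rw [mul_assoc]
      gcongr
      exact le_mul_of_one_le_left (Real.exp_pos _).le h1

/-- The normalizations agree, so only the two exponents are compared. The bound becomes useful once
`F x` and `F x'` are at distance far below `σ ^ 2`, which the coupling achieves. -/
lemma gaussian_harnack {σ : ℝ} (hσ : 0 < σ) (x x' y : EuclideanSpace ℝ (Fin d)) :
    gaussianStepDensity F S σ x y ≤
      ENNReal.ofReal (Real.exp (‖Matrix.toEuclideanCLM (𝕜 := ℝ) S⁻¹‖ *
        (‖F x - F x'‖ * (‖y - F x‖ + ‖y - F x'‖)) / σ ^ 2)) * gaussianStepDensity F S σ x' y := by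
  rw [gaussianStepDensity_eq, gaussianStepDensity_eq, ← ENNReal.ofReal_mul (by positivity)]
  apply ENNReal.ofReal_le_ofReal
  rw [mul_left_comm, ← Real.exp_add]
  gcongr
  have h := precisionForm_sub_le S (y - F x') (y - F x)
  rw [show y - F x' - (y - F x) = F x - F x' by abel] at h
  set b := ‖Matrix.toEuclideanCLM (𝕜 := ℝ) S⁻¹‖ * (‖F x - F x'‖ * (‖y - F x‖ + ‖y - F x'‖))
    with hb
  have hb0 : 0 ≤ b := by positivity
  have hb1 : precisionForm S (y - F x') - precisionForm S (y - F x) ≤ b := by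
    rw [hb, add_comm ‖y - F x‖]; exact h
  have h2 : (precisionForm S (y - F x') - precisionForm S (y - F x)) / (2 * σ ^ 2)
      ≤ b / σ ^ 2 := by
    rw [div_le_div_iff₀ (by positivity) (by positivity)]
    have : 0 < σ ^ 2 := by positivity
    nlinarith
  rw [sub_div] at h2
  linarith

lemma measurable_gaussianStepDensity (hF : Measurable F) (S : Matrix (Fin d) (Fin d) ℝ) (σ : ℝ) :
    Measurable (Function.uncurry (gaussianStepDensity F S σ)) := by
  have h : Function.uncurry (gaussianStepDensity F S σ) =
      fun p : EuclideanSpace ℝ (Fin d) × EuclideanSpace ℝ (Fin d) => ENNReal.ofReal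
      (((2 * Real.pi * σ ^ 2) ^ ((d : ℝ) / 2) * Real.sqrt S.det)⁻¹ *
        Real.exp (-(precisionForm S (p.2 - F p.1) / (2 * σ ^ 2)))) := by
    ext p; exact gaussianStepDensity_eq F S σ p.1 p.2
  rw [h]
  have := (continuous_precisionForm S).measurable
  fun_prop

lemma measurable_gaussianStepDensity_right (S : Matrix (Fin d) (Fin d) ℝ) (σ : ℝ)
    (x : EuclideanSpace ℝ (Fin d)) : Measurable (gaussianStepDensity F S σ x) := by
  have h : gaussianStepDensity F S σ x = fun y => ENNReal.ofReal
      (((2 * Real.pi * σ ^ 2) ^ ((d : ℝ) / 2) * Real.sqrt S.det)⁻¹ *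
        Real.exp (-(precisionForm S (y - F x) / (2 * σ ^ 2)))) := by
    ext y; exact gaussianStepDensity_eq F S σ x y
  rw [h]
  have := (continuous_precisionForm S).measurable
  fun_prop

lemma lintegral_gaussianStepDensity_eq_one (hS : S.PosDef) {σ : ℝ} (hσ : 0 < σ)
    (x : EuclideanSpace ℝ (Fin d)) : ∫⁻ y, gaussianStepDensity F S σ x y = 1 := by
  have := lintegral_gaussianStepDensity F hS hσ x (f := fun _ => 1) measurable_const
  simpa using this

/-- Half of the exponent is bounded below by `a ^ 2 / (4 A σ ^ 2)` on the tail. The other half is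
the density at noise level `√2 σ`, which has total mass one, and `√2 ^ d` is the quotient of the
normalizations. -/
lemma gaussian_tail (hS : S.PosDef) {σ : ℝ} (hσ : 0 < σ) (x : EuclideanSpace ℝ (Fin d)) {a : ℝ}
    (ha : 0 ≤ a) {A : ℝ} (hA0 : 0 < A)
    (hA : ∀ v : EuclideanSpace ℝ (Fin d), 0 ≤ precisionForm S v ∧ ‖v‖ ^ 2 ≤ A * precisionForm S v) :
    ∫⁻ y in {y | a ≤ ‖y - F x‖}, gaussianStepDensity F S σ x y ≤
      ENNReal.ofReal (Real.sqrt 2 ^ d * Real.exp (-(a ^ 2 / (4 * A * σ ^ 2)))) := by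
  have hs : 0 < Real.sqrt 2 * σ := by positivity
  have key : ∀ y, a ≤ ‖y - F x‖ → gaussianStepDensity F S σ x y ≤
      ENNReal.ofReal (Real.sqrt 2 ^ d * Real.exp (-(a ^ 2 / (4 * A * σ ^ 2)))) *
        gaussianStepDensity F S (Real.sqrt 2 * σ) x y := by
    intro y hy
    rw [gaussianStepDensity_eq, gaussianStepDensity_eq, ← ENNReal.ofReal_mul (by positivity),
      rpow_normalization hS hσ, rpow_normalization hS hs]
    apply ENNReal.ofReal_le_ofReal
    have h2 : (Real.sqrt 2) ^ d * ((Real.sqrt 2 * σ)⁻¹) ^ d = (σ⁻¹) ^ d := by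
      rw [← mul_pow]; congr 1; field_simp
    have h3 : Real.exp (-(precisionForm S (y - F x) / (2 * σ ^ 2))) ≤
        Real.exp (-(a ^ 2 / (4 * A * σ ^ 2))) *
        Real.exp (-(precisionForm S (y - F x) / (2 * (Real.sqrt 2 * σ) ^ 2))) := by
      rw [← Real.exp_add]
      apply Real.exp_le_exp.2
      rw [mul_pow, Real.sq_sqrt (by norm_num)]
      have h4 : a ^ 2 ≤ A * precisionForm S (y - F x) := by
        have h5 : a ^ 2 ≤ ‖y - F x‖ ^ 2 := by gcongr
        exact h5.trans (hA _).2
      have h7 : a ^ 2 / (4 * A * σ ^ 2) ≤ precisionForm S (y - F x) / (4 * σ ^ 2) := by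
        rw [div_le_div_iff₀ (by positivity) (by positivity)]
        nlinarith [pow_pos hσ 2]
      have h8 : precisionForm S (y - F x) / (2 * σ ^ 2) =
        precisionForm S (y - F x) / (4 * σ ^ 2) + precisionForm S (y - F x) / (4 * σ ^ 2) := by
        field_simp; ring
      rw [show 2 * (2 * σ ^ 2) = 4 * σ ^ 2 by ring, h8]
      linarith
    rw [← h2]
    have h9 := (Real.sqrt_pos.2 hS.det_pos)
    calc _ ≤ ((2 * Real.pi) ^ ((d : ℝ) / 2) * Real.sqrt S.det)⁻¹ *
          (Real.sqrt 2 ^ d * ((Real.sqrt 2 * σ)⁻¹) ^ d) * (Real.exp (-(a ^ 2 / (4 * A * σ ^ 2))) *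
        Real.exp (-(precisionForm S (y - F x) / (2 * (Real.sqrt 2 * σ) ^ 2)))) := by gcongr
      _ = _ := by ring
  have hm : MeasurableSet {y | a ≤ ‖y - F x‖} := measurableSet_le measurable_const (by fun_prop)
  calc _ ≤ ∫⁻ y in {y | a ≤ ‖y - F x‖},
        ENNReal.ofReal (Real.sqrt 2 ^ d * Real.exp (-(a ^ 2 / (4 * A * σ ^ 2)))) *
        gaussianStepDensity F S (Real.sqrt 2 * σ) x y := setLIntegral_mono' hm key
    _ ≤ ∫⁻ y, ENNReal.ofReal (Real.sqrt 2 ^ d * Real.exp (-(a ^ 2 / (4 * A * σ ^ 2)))) *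
        gaussianStepDensity F S (Real.sqrt 2 * σ) x y := setLIntegral_le_lintegral _ _
    _ = _ := by
      rw [lintegral_const_mul _ (measurable_gaussianStepDensity_right F S _ x),
        lintegral_gaussianStepDensity_eq_one F hS hs, mul_one]

/-- Averaging over `y + v` and `y - v` removes the linear term of the exponent, so by the
arithmetic-geometric mean inequality and the parallelogram identity only the bounded term in `v`
remains. The constant is therefore polynomial in `σ⁻¹` even when `y` is far from `F x`, unlike for a
pointwise comparison. -/
lemma gaussian_meanValue {σ : ℝ} (hσ : 0 < σ) (x y : EuclideanSpace ℝ (Fin d)) :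
    gaussianStepDensity F S σ x y ≤
      ENNReal.ofReal (Real.exp (‖Matrix.toEuclideanCLM (𝕜 := ℝ) S⁻¹‖) *
        ((volume (Metric.ball (0 : EuclideanSpace ℝ (Fin d)) 1)).toReal)⁻¹ * (σ⁻¹) ^ d) *
        ∫⁻ z in Metric.ball y σ, gaussianStepDensity F S σ x z := by
  classical
  set Λ := ‖Matrix.toEuclideanCLM (𝕜 := ℝ) S⁻¹‖ with hΛ
  set V := (volume (Metric.ball (0 : EuclideanSpace ℝ (Fin d)) 1)).toReal with hV
  have hVpos : 0 < V := ENNReal.toReal_pos (Metric.measure_ball_pos _ _ one_pos).ne'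
    measure_ball_lt_top.ne
  set D := gaussianStepDensity F S σ x with hD
  have hDm : Measurable D := measurable_gaussianStepDensity_right F S σ x
  have hpair : ∀ v ∈ Metric.ball (0 : EuclideanSpace ℝ (Fin d)) σ,
      2 * (ENNReal.ofReal (Real.exp (-Λ)) * D y) ≤ D (y + v) + D (y - v) := by
    intro v hv
    have hv' : ‖v‖ < σ := by simpa using hv
    simp only [hD, gaussianStepDensity_eq]
    have h2 : (2 : ℝ≥0∞) = ENNReal.ofReal 2 := by simp
    simp only [h2]
    rw [← ENNReal.ofReal_mul (by positivity), ← ENNReal.ofReal_add (by positivity) (by positivity),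
      ← ENNReal.ofReal_mul (by positivity)]
    apply ENNReal.ofReal_le_ofReal
    set a := y - F x
    rw [show y + v - F x = a + v by simp only [a]; abel,
      show y - v - F x = a - v by simp only [a]; abel]
    set c := ((2 * Real.pi * σ ^ 2) ^ ((d : ℝ) / 2) * Real.sqrt S.det)⁻¹
    have hc : 0 ≤ c := by positivity
    have hq := precisionForm_add_add_sub S a v
    have hqv : precisionForm S v / (2 * σ ^ 2) ≤ Λ := by
      rw [div_le_iff₀ (by positivity)]
      have h1 := precisionForm_le S v
      have h2 : ‖v‖ ^ 2 ≤ σ ^ 2 := by gcongr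
      have h3 : 0 ≤ Λ := norm_nonneg _
      nlinarith [mul_le_mul_of_nonneg_left h2 h3, mul_nonneg h3 (sq_nonneg σ)]
    set p := -(precisionForm S (a + v) / (2 * σ ^ 2)) with hp
    set m := -(precisionForm S (a - v) / (2 * σ ^ 2)) with hm
    have hsum : p + m ≥ 2 * (-Λ + -(precisionForm S a / (2 * σ ^ 2))) := by
      have : p + m = -(2 * precisionForm S a + 2 * precisionForm S v) / (2 * σ ^ 2) := by
        rw [← hq, hp, hm]; ring
      rw [this]
      have e : -(2 * precisionForm S a + 2 * precisionForm S v) / (2 * σ ^ 2) =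
        -2 * (precisionForm S a / (2 * σ ^ 2)) - 2 * (precisionForm S v / (2 * σ ^ 2)) := by ring
      rw [e]; linarith
    have hamgm : 2 * Real.exp (-Λ + -(precisionForm S a / (2 * σ ^ 2))) ≤
        Real.exp p + Real.exp m := by
      have h1 : Real.exp (-Λ + -(precisionForm S a / (2 * σ ^ 2))) ≤
          Real.exp (p / 2) * Real.exp (m / 2) := by
        rw [← Real.exp_add]; apply Real.exp_le_exp.2; linarith
      have h2 : Real.exp p = Real.exp (p / 2) ^ 2 := by
        rw [← Real.exp_nat_mul]; congr 1; push_cast; ring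
      have h3 : Real.exp m = Real.exp (m / 2) ^ 2 := by
        rw [← Real.exp_nat_mul]; congr 1; push_cast; ring
      rw [h2, h3]
      nlinarith [sq_nonneg (Real.exp (p / 2) - Real.exp (m / 2))]
    rw [Real.exp_add] at hamgm
    nlinarith [mul_le_mul_of_nonneg_left hamgm hc]
  have hball : ∫⁻ z in Metric.ball y σ, D z = ∫⁻ v in Metric.ball 0 σ, D (y + v) := by
    rw [← lintegral_indicator measurableSet_ball, ← lintegral_indicator measurableSet_ball,
      ← lintegral_add_left_eq_self _ y]
    refine lintegral_congr fun v => ?_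
    simp only [Set.indicator_apply, Metric.mem_ball, dist_self_add_left, dist_zero_right]
  have hneg : ∫⁻ v in Metric.ball (0 : EuclideanSpace ℝ (Fin d)) σ, D (y + v) =
      ∫⁻ v in Metric.ball (0 : EuclideanSpace ℝ (Fin d)) σ, D (y - v) := by
    rw [← lintegral_indicator measurableSet_ball, ← lintegral_indicator measurableSet_ball,
      ← lintegral_neg_eq_self]
    refine lintegral_congr fun v => ?_
    simp only [Set.indicator_apply, Metric.mem_ball, dist_zero_right, norm_neg, sub_eq_add_neg]
  have hvol : volume (Metric.ball (0 : EuclideanSpace ℝ (Fin d)) σ) = ENNReal.ofReal (σ ^ d * V) := by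
    rw [Measure.addHaar_ball_of_pos _ _ hσ, finrank_euclideanSpace, Fintype.card_fin,
      ENNReal.ofReal_mul (by positivity), hV, ENNReal.ofReal_toReal measure_ball_lt_top.ne]
  have hmain : 2 * (ENNReal.ofReal (Real.exp (-Λ)) * D y) * ENNReal.ofReal (σ ^ d * V) ≤
      2 * ∫⁻ z in Metric.ball y σ, D z := by
    rw [← hvol, ← setLIntegral_const]
    calc _ ≤ ∫⁻ v in Metric.ball (0 : EuclideanSpace ℝ (Fin d)) σ, (D (y + v) + D (y - v)) :=
          setLIntegral_mono' measurableSet_ball hpair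
      _ = _ := by
        rw [lintegral_add_left (by fun_prop), ← hneg, ← hball, two_mul]
  have hmain' : ENNReal.ofReal (Real.exp (-Λ)) * D y * ENNReal.ofReal (σ ^ d * V) ≤
      ∫⁻ z in Metric.ball y σ, D z := by
    rw [mul_assoc] at hmain
    exact (ENNReal.mul_le_mul_iff_right (by norm_num) (by norm_num)).1 hmain
  calc D y = ENNReal.ofReal (Real.exp Λ * V⁻¹ * (σ⁻¹) ^ d) *
        (ENNReal.ofReal (Real.exp (-Λ)) * D y * ENNReal.ofReal (σ ^ d * V)) := by
        have h1 : ENNReal.ofReal (Real.exp Λ * V⁻¹ * (σ⁻¹) ^ d) *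
            (ENNReal.ofReal (Real.exp (-Λ)) * ENNReal.ofReal (σ ^ d * V)) = 1 := by
          rw [← ENNReal.ofReal_mul (by positivity), ← ENNReal.ofReal_mul (by positivity)]
          rw [Real.exp_neg, inv_pow]
          rw [show Real.exp Λ * V⁻¹ * (σ ^ d)⁻¹ * ((Real.exp Λ)⁻¹ * (σ ^ d * V)) = 1 by
            field_simp]
          simp
        rw [mul_right_comm (ENNReal.ofReal (Real.exp (-Λ))), ← mul_assoc, h1, one_mul]
    _ ≤ _ := by gcongr

lemma gaussian_moment (hS : S.PosDef) {σ : ℝ} (hσ : 0 < σ) (x : EuclideanSpace ℝ (Fin d)) :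
    ∫⁻ y, gaussianStepDensity F S σ x y * ENNReal.ofReal (‖y‖ ^ 2) ≤
      ENNReal.ofReal (‖F x‖ ^ 2 + (∫ w, ‖w‖ ^ 2 ∂(multivariateGaussian 0 S)) * σ ^ 2) := by
  rw [lintegral_gaussianStepDensity F hS hσ x (by fun_prop)]
  have hL2 : MemLp (fun w : EuclideanSpace ℝ (Fin d) => w) 2 (multivariateGaussian 0 S) :=
    IsGaussian.memLp_two_id
  have hi2 : Integrable (fun w : EuclideanSpace ℝ (Fin d) => ‖w‖ ^ 2) (multivariateGaussian 0 S) :=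
    (memLp_two_iff_integrable_sq_norm hL2.1).1 hL2
  have hi1 : Integrable (fun w : EuclideanSpace ℝ (Fin d) => w) (multivariateGaussian 0 S) :=
    hL2.integrable (by norm_num)
  have hi3 : Integrable (fun w : EuclideanSpace ℝ (Fin d) => inner ℝ (F x) w)
      (multivariateGaussian 0 S) := hi1.const_inner (F x)
  have e : ∀ w : EuclideanSpace ℝ (Fin d), ‖F x + σ • w‖ ^ 2 =
      ‖F x‖ ^ 2 + 2 * σ * inner ℝ (F x) w + σ ^ 2 * ‖w‖ ^ 2 := by
    intro w
    rw [norm_add_sq_real, inner_smul_right, norm_smul, mul_pow, Real.norm_eq_abs, sq_abs]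
    ring
  have hi : Integrable (fun w : EuclideanSpace ℝ (Fin d) => ‖F x + σ • w‖ ^ 2)
      (multivariateGaussian 0 S) := by
    simp_rw [e]
    exact ((integrable_const _).add (hi3.const_mul _)).add (hi2.const_mul _)
  rw [← ofReal_integral_eq_lintegral_ofReal hi (ae_of_all _ fun w => by positivity)]
  apply ENNReal.ofReal_le_ofReal
  simp_rw [e]
  have h1 := integral_add ((integrable_const (‖F x‖ ^ 2)).add (hi3.const_mul (2 * σ)))
    (hi2.const_mul (σ ^ 2))
  simp only [Pi.add_apply] at h1
  rw [h1, integral_add (integrable_const _) (hi3.const_mul _), integral_const_mul,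
    integral_const_mul, integral_inner hi1]
  simp [mul_comm]

theorem exists_kernelBounds (hF : Measurable F) (hS : S.PosDef) :
    ∃ K, KernelBounds F (gaussianStepDensity F S) K := by
  set c := ((2 * Real.pi) ^ ((d : ℝ) / 2) * Real.sqrt S.det)⁻¹ with hc
  have hcpos : 0 < c := by
    have := Real.sqrt_pos.2 hS.det_pos
    positivity
  set Λ := ‖Matrix.toEuclideanCLM (𝕜 := ℝ) S⁻¹‖ with hΛ
  obtain ⟨A, hA0, hA⟩ := exists_norm_sq_le_precisionForm hS
  set b := Real.exp Λ * ((volume (Metric.ball (0 : EuclideanSpace ℝ (Fin d)) 1)).toReal)⁻¹ with hb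
  set t := ∫ w, ‖w‖ ^ 2 ∂(multivariateGaussian 0 S) with ht
  have hΛ0 : 0 ≤ Λ := norm_nonneg _
  have hb0 : 0 ≤ b := by positivity
  have ht0 : 0 ≤ t := integral_nonneg fun _ => by positivity
  have hci : 0 < c⁻¹ := inv_pos.2 hcpos
  have hs0 : 0 ≤ Real.sqrt 2 ^ d := by positivity
  -- A sum dominating every constant of the individual estimates, so that a single parameter is
  -- carried through the proof.
  set K := 1 + c + c⁻¹ + Λ + 4 * A + Real.sqrt 2 ^ d + b + t with hK
  refine ⟨K, ⟨by linarith, measurable_gaussianStepDensity F hF S, ?_, ?_, ?_, ?_, ?_, ?_, ?_⟩⟩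
  · intro σ hσ
    refine ⟨(multivariateGaussian 0 S).map (fun w => σ • w),
      Measure.isProbabilityMeasure_map (by fun_prop), fun x f hf => ?_⟩
    rw [lintegral_gaussianStepDensity F hS hσ x hf, lintegral_map (by fun_prop) (by fun_prop)]
  · intro σ hσ x y
    refine (gaussian_upper F hS hσ x y).trans (ENNReal.ofReal_le_ofReal ?_)
    gcongr
    linarith
  · intro σ hσ hσ1 x y
    refine le_trans (ENNReal.ofReal_le_ofReal ?_) (gaussian_lower F hS hσ hσ1 x y)
    have h1 : K⁻¹ ≤ c := inv_le_of_inv_le₀ hcpos (by linarith)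
    have h2 : Λ ≤ K := by linarith
    rw [← hc, ← hΛ]
    clear_value c Λ K
    gcongr
  · intro σ hσ x a ha
    refine (gaussian_tail F hS hσ x ha hA0 hA).trans (ENNReal.ofReal_le_ofReal ?_)
    have : 0 < 4 * A := by linarith
    gcongr
    · linarith
    · linarith
  · intro σ hσ x x' y
    refine (gaussian_harnack F hσ x x' y).trans ?_
    gcongr
    linarith
  · intro σ hσ x y
    refine (gaussian_meanValue F hσ x y).trans ?_
    gcongr
    linarith
  · intro σ hσ x
    refine (gaussian_moment F hS hσ x).trans (ENNReal.ofReal_le_ofReal ?_)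
    gcongr
    linarith

end Bounds

/-! ### Integral operators and the trace density -/

section StepOn

variable {d : ℕ}

/-- The integral operator with kernel `k`, restricted to the set `A`. -/
def stepOn (k : EuclideanSpace ℝ (Fin d) → EuclideanSpace ℝ (Fin d) → ℝ≥0∞)
    (A : Set (EuclideanSpace ℝ (Fin d))) (f : EuclideanSpace ℝ (Fin d) → ℝ≥0∞)
    (x : EuclideanSpace ℝ (Fin d)) : ℝ≥0∞ :=
  ∫⁻ y in A, k x y * f y

variable {k : EuclideanSpace ℝ (Fin d) → EuclideanSpace ℝ (Fin d) → ℝ≥0∞}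
  {A B : Set (EuclideanSpace ℝ (Fin d))} {f g : EuclideanSpace ℝ (Fin d) → ℝ≥0∞}
  {x y : EuclideanSpace ℝ (Fin d)}

lemma measurable_kernel_left (hk : Measurable (Function.uncurry k)) (x) :
    Measurable fun y => k x y := hk.comp measurable_prodMk_left

lemma measurable_kernel_right (hk : Measurable (Function.uncurry k)) (y) :
    Measurable fun x => k x y := hk.comp measurable_prodMk_right

lemma measurable_stepOn (hk : Measurable (Function.uncurry k)) (hf : Measurable f) :
    Measurable (stepOn k A f) := by
  have : Measurable (Function.uncurry fun x y => k x y * f y) :=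
    hk.mul (hf.comp measurable_snd)
  exact this.lintegral_prod_right

lemma measurable_stepOn_iterate (hk : Measurable (Function.uncurry k)) (hf : Measurable f) (n : ℕ) :
    Measurable ((stepOn k A)^[n] f) := by
  induction n with
  | zero => exact hf
  | succ n ih => rw [Function.iterate_succ_apply']; exact measurable_stepOn hk ih

lemma stepOn_mono_of_mem (hA : MeasurableSet A) (h : ∀ y ∈ A, f y ≤ g y) (x) :
    stepOn k A f x ≤ stepOn k A g x :=
  setLIntegral_mono' hA fun y hy => by gcongr; exact h y hy

lemma stepOn_mono (h : f ≤ g) : stepOn k A f ≤ stepOn k A g :=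
  fun _ => lintegral_mono fun y => by gcongr; exact h y

lemma stepOn_mono_set (h : A ⊆ B) : stepOn k A f x ≤ stepOn k B f x :=
  lintegral_mono_set h

lemma stepOn_iterate_mono (h : f ≤ g) (n : ℕ) : (stepOn k A)^[n] f ≤ (stepOn k A)^[n] g :=
  (Monotone.iterate (f := stepOn k A) (fun _ _ h => stepOn_mono h) n) h

lemma stepOn_add (hk : Measurable (Function.uncurry k)) (hf : Measurable f) (x) :
    stepOn k A (fun y => f y + g y) x = stepOn k A f x + stepOn k A g x := by
  simp only [stepOn, mul_add]
  exact lintegral_add_left ((hk.comp measurable_prodMk_left).mul hf) _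

lemma stepOn_const_mul (hk : Measurable (Function.uncurry k)) (hf : Measurable f) (c : ℝ≥0∞) (x) :
    stepOn k A (fun y => c * f y) x = c * stepOn k A f x := by
  simp only [stepOn, mul_left_comm _ c]
  exact lintegral_const_mul _ ((hk.comp measurable_prodMk_left).mul hf)

lemma stepOn_const (hk : Measurable (Function.uncurry k)) (c : ℝ≥0∞) (x) :
    stepOn k A (fun _ => c) x = c * stepOn k A (fun _ => 1) x := by
  simpa using stepOn_const_mul (A := A) hk (f := fun _ => 1) measurable_const c x

lemma stepOn_union (hB : MeasurableSet B) (h : Disjoint A B) (x) :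
    stepOn k (A ∪ B) f x = stepOn k A f x + stepOn k B f x :=
  lintegral_union hB h

lemma stepOn_indicator (hB : MeasurableSet B) (x) :
    stepOn k A (B.indicator f) x = stepOn k (A ∩ B) f x := by
  have : ∀ y, k x y * B.indicator f y = B.indicator (fun y => k x y * f y) y := by
    intro y; by_cases hy : y ∈ B <;> simp [hy]
  simp only [stepOn, this]
  rw [lintegral_indicator hB, Measure.restrict_restrict hB, Set.inter_comm]

lemma stepOn_le_const (hA : MeasurableSet A) (hk : Measurable (Function.uncurry k)) {c : ℝ≥0∞}
    (h : ∀ y ∈ A, f y ≤ c) (x) : stepOn k A f x ≤ c * stepOn k A (fun _ => 1) x := by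
  rw [← stepOn_const hk]
  exact stepOn_mono_of_mem hA h x

lemma const_le_stepOn (hA : MeasurableSet A) (hk : Measurable (Function.uncurry k)) {c : ℝ≥0∞}
    (h : ∀ y ∈ A, c ≤ f y) (x) : c * stepOn k A (fun _ => 1) x ≤ stepOn k A f x := by
  rw [← stepOn_const hk]
  exact stepOn_mono_of_mem hA h x

lemma stepOn_compl_add (hk1 : ∀ x, ∫⁻ y, k x y = 1) (hA : MeasurableSet A) (x) :
    stepOn k A (fun _ => 1) x + stepOn k Aᶜ (fun _ => 1) x = 1 := by
  simp only [stepOn, mul_one]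
  rw [lintegral_add_compl _ hA, hk1]

lemma stepOn_one_le (hk1 : ∀ x, ∫⁻ y, k x y = 1) (x) : stepOn k A (fun _ => 1) x ≤ 1 := by
  simp only [stepOn, mul_one]
  exact (setLIntegral_le_lintegral _ _).trans (hk1 x).le

lemma stepOn_iterate_add (hk : Measurable (Function.uncurry k)) (hf : Measurable f)
    (n : ℕ) (x) : (stepOn k A)^[n] (fun y => f y + g y) x =
      (stepOn k A)^[n] f x + (stepOn k A)^[n] g x := by
  induction n generalizing x with
  | zero => rfl
  | succ n ih =>
    simp only [Function.iterate_succ_apply']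
    rw [← stepOn_add hk (measurable_stepOn_iterate hk hf n)]
    congr 1
    ext y; exact ih y

lemma stepOn_iterate_const_mul (hk : Measurable (Function.uncurry k)) (hf : Measurable f)
    (c : ℝ≥0∞) (n : ℕ) (x) :
    (stepOn k A)^[n] (fun y => c * f y) x = c * (stepOn k A)^[n] f x := by
  induction n generalizing x with
  | zero => rfl
  | succ n ih =>
    simp only [Function.iterate_succ_apply']
    rw [← stepOn_const_mul hk (measurable_stepOn_iterate hk hf n)]
    congr 1
    ext y; exact ih y

lemma lintegral_mul_stepOn (hk : Measurable (Function.uncurry k)) (hg : Measurable g)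
    (hf : Measurable f) :
    ∫⁻ z in A, g z * stepOn k B f z = ∫⁻ y in B, (∫⁻ z in A, g z * k z y) * f y := by
  have hm : Measurable (Function.uncurry fun z y => g z * (k z y * f y)) :=
    (hg.comp measurable_fst).mul (hk.mul (hf.comp measurable_snd))
  calc _ = ∫⁻ z in A, ∫⁻ y in B, g z * (k z y * f y) := by
        refine lintegral_congr fun z => ?_
        rw [stepOn, lintegral_const_mul]
        exact (hk.comp measurable_prodMk_left).mul hf
    _ = ∫⁻ y in B, ∫⁻ z in A, g z * (k z y * f y) := lintegral_lintegral_swap hm.aemeasurable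
    _ = _ := by
        refine lintegral_congr fun y => ?_
        have h1 : Measurable fun z => g z * k z y := hg.mul (measurable_kernel_right hk y)
        rw [← lintegral_mul_const _ h1]
        simp only [mul_assoc]

end StepOn

/-! ### Renewal equations for the trace density and its iterates. -/

section Trace

variable {d : ℕ} {k : EuclideanSpace ℝ (Fin d) → EuclideanSpace ℝ (Fin d) → ℝ≥0∞}
  {M B : Set (EuclideanSpace ℝ (Fin d))}

lemma measurable_firstReturnDensity (hk : Measurable (Function.uncurry k)) (n : ℕ) :
    Measurable (Function.uncurry (firstReturnDensity k M n)) := by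
  induction n with
  | zero => exact hk
  | succ n ih =>
    have hm : Measurable (Function.uncurry
        fun (p : EuclideanSpace ℝ (Fin d) × EuclideanSpace ℝ (Fin d)) z =>
          k p.1 z * firstReturnDensity k M n z p.2) := by
      refine Measurable.mul (hk.comp (f := fun q :
          (EuclideanSpace ℝ (Fin d) × EuclideanSpace ℝ (Fin d)) × EuclideanSpace ℝ (Fin d) =>
          (q.1.1, q.2)) (by fun_prop))
        (ih.comp (f := fun q :
          (EuclideanSpace ℝ (Fin d) × EuclideanSpace ℝ (Fin d)) × EuclideanSpace ℝ (Fin d) =>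
          (q.2, q.1.2)) (by fun_prop))
    exact hm.lintegral_prod_right (ν := volume.restrict Mᶜ)

lemma measurable_traceDensity (hk : Measurable (Function.uncurry k)) :
    Measurable (Function.uncurry (traceDensity k M)) := by
  have : Function.uncurry (traceDensity k M) =
      fun p => ∑' n, Function.uncurry (firstReturnDensity k M n) p := by
    ext p; rfl
  rw [this]
  exact Measurable.tsum fun n => measurable_firstReturnDensity hk n

lemma firstReturnDensity_eq_iterate (n : ℕ) (x y : EuclideanSpace ℝ (Fin d)) :
    firstReturnDensity k M n x y = (stepOn k Mᶜ)^[n] (fun z => k z y) x := by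
  induction n generalizing x with
  | zero => rfl
  | succ n ih =>
    rw [Function.iterate_succ_apply']
    simp only [firstReturnDensity, stepOn]
    refine lintegral_congr fun z => ?_
    rw [ih]

/-- Renewal equation: the chain returns to `M` at its first step, or moves outside `M` and starts
afresh. The estimates for tiny `B` use this form rather than the series. -/
lemma traceDensity_eq (hk : Measurable (Function.uncurry k)) (x y : EuclideanSpace ℝ (Fin d)) :
    traceDensity k M x y = k x y + stepOn k Mᶜ (fun z => traceDensity k M z y) x := by
  have h : stepOn k Mᶜ (fun z => traceDensity k M z y) x =
      ∑' n, firstReturnDensity k M (n + 1) x y := by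
    simp only [stepOn, traceDensity, firstReturnDensity, ← ENNReal.tsum_mul_left]
    rw [lintegral_tsum]
    intro n
    exact ((hk.comp measurable_prodMk_left).mul
      ((measurable_firstReturnDensity hk n).comp measurable_prodMk_right)).aemeasurable
  rw [h, traceDensity, tsum_eq_zero_add' ENNReal.summable]
  rfl

lemma le_traceDensity (x y : EuclideanSpace ℝ (Fin d)) : k x y ≤ traceDensity k M x y :=
  ENNReal.le_tsum (f := fun n => firstReturnDensity k M n x y) 0

/-- First-step analysis for expectations at the return time. It makes the trace operator accessible
to comparison with the one-step operator `stepOn k`. -/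
lemma stepOn_traceDensity (hk : Measurable (Function.uncurry k))
    {g : EuclideanSpace ℝ (Fin d) → ℝ≥0∞} (hg : Measurable g) (x : EuclideanSpace ℝ (Fin d)) :
    stepOn (traceDensity k M) B g x =
      stepOn k Mᶜ (stepOn (traceDensity k M) B g) x + stepOn k B g x := by
  have e : ∀ y, traceDensity k M x y * g y = k x y * g y +
      (∫⁻ z in Mᶜ, k x z * traceDensity k M z y) * g y := by
    intro y
    rw [traceDensity_eq hk, add_mul]
    rfl
  have hk' := measurable_traceDensity (M := M) hk
  rw [add_comm]
  change ∫⁻ y in B, _ = _ + ∫⁻ z in Mᶜ, _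
  rw [lintegral_mul_stepOn hk' (measurable_kernel_left hk x) hg]
  simp only [e]
  have h1 : Measurable fun y => k x y * g y := (measurable_kernel_left hk x).mul hg
  rw [lintegral_add_left h1]
  rfl

lemma lintegral_firstReturnDensity (hk : Measurable (Function.uncurry k))
    {g : EuclideanSpace ℝ (Fin d) → ℝ≥0∞} (hg : Measurable g) (n : ℕ)
    (x : EuclideanSpace ℝ (Fin d)) :
    stepOn (firstReturnDensity k M n) B g x = (stepOn k Mᶜ)^[n] (stepOn k B g) x := by
  induction n generalizing x with
  | zero => rfl
  | succ n ih =>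
    rw [Function.iterate_succ_apply']
    have : (stepOn k Mᶜ)^[n] (stepOn k B g) = stepOn (firstReturnDensity k M n) B g := by
      ext z; exact (ih z).symm
    rw [this]
    symm
    exact lintegral_mul_stepOn (measurable_firstReturnDensity hk n)
      (hk.comp measurable_prodMk_left) hg

lemma stepOn_traceDensity_eq_tsum (hk : Measurable (Function.uncurry k))
    {g : EuclideanSpace ℝ (Fin d) → ℝ≥0∞} (hg : Measurable g) (x : EuclideanSpace ℝ (Fin d)) :
    stepOn (traceDensity k M) B g x = ∑' n, (stepOn k Mᶜ)^[n] (stepOn k B g) x := by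
  simp only [← lintegral_firstReturnDensity hk hg, stepOn, traceDensity, ← ENNReal.tsum_mul_right]
  exact lintegral_tsum fun n =>
    (((measurable_firstReturnDensity hk n).comp measurable_prodMk_left).mul hg).aemeasurable

/-- Induction on the partial sums of the series. By the first-step decomposition, the next sum is at
most the probability of landing in the disjoint union of `Mᶜ` and `B`. No recurrence of the chain is
needed. -/
lemma stepOn_traceDensity_one_le (hk : Measurable (Function.uncurry k))
    (hk1 : ∀ x, ∫⁻ y, k x y = 1) (hB : MeasurableSet B) (hBM : B ⊆ M)
    (x : EuclideanSpace ℝ (Fin d)) :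
    stepOn (traceDensity k M) B (fun _ => 1) x ≤ 1 := by
  rw [stepOn_traceDensity_eq_tsum hk measurable_const]
  refine ENNReal.tsum_le_of_sum_range_le fun N => ?_
  induction N generalizing x with
  | zero => simp
  | succ N ih =>
    rw [Finset.sum_range_succ']
    simp only [Function.iterate_succ_apply', Function.iterate_zero, id]
    have hmeas : ∀ n, Measurable ((stepOn k Mᶜ)^[n] (stepOn k B (fun _ => 1))) := fun n =>
      measurable_stepOn_iterate hk (measurable_stepOn hk measurable_const) n
    have e : ∑ n ∈ Finset.range N, stepOn k Mᶜ ((stepOn k Mᶜ)^[n] (stepOn k B (fun _ => 1))) x =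
        stepOn k Mᶜ (fun z => ∑ n ∈ Finset.range N,
          (stepOn k Mᶜ)^[n] (stepOn k B (fun _ => 1)) z) x := by
      simp only [stepOn, Finset.mul_sum]
      rw [lintegral_finsetSum]
      intro n _
      exact (hk.comp measurable_prodMk_left).mul (hmeas n)
    rw [e]
    calc _ ≤ stepOn k Mᶜ (fun _ => 1) x + stepOn k B (fun _ => 1) x := by
          gcongr
          exact stepOn_mono (fun z => ih z) x
      _ = stepOn k (Mᶜ ∪ B) (fun _ => 1) x :=
          (stepOn_union hB (Set.disjoint_compl_left_iff_subset.2 hBM) x).symm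
      _ ≤ 1 := stepOn_one_le hk1 x

lemma iterDensity_succ (n : ℕ) (x y : EuclideanSpace ℝ (Fin d)) :
    iterDensity k B (n + 1) x y = (stepOn k B)^[n] (fun z => k z y) x := by
  induction n generalizing x with
  | zero => rfl
  | succ n ih =>
    rw [Function.iterate_succ_apply']
    simp only [iterDensity, stepOn]
    exact lintegral_congr fun z => by rw [ih]

lemma measurable_iterDensity_uncurry (hk : Measurable (Function.uncurry k)) (n : ℕ) :
    Measurable (Function.uncurry (iterDensity k B (n + 1))) := by
  have e : iterDensity k B (n + 1) = firstReturnDensity k Bᶜ n := by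
    ext x y
    rw [iterDensity_succ, firstReturnDensity_eq_iterate, compl_compl]
  rw [e]
  exact measurable_firstReturnDensity hk n

/-- The definition splits off the first step. Splitting off the last one keeps the starting point
inside the lower iterate, which is what lets a Harnack inequality in the starting point propagate.
-/
lemma iterDensity_succ_succ_right (hk : Measurable (Function.uncurry k)) (n : ℕ)
    (x y : EuclideanSpace ℝ (Fin d)) :
    iterDensity k B (n + 2) x y = ∫⁻ z in B, iterDensity k B (n + 1) x z * k z y := by
  induction n generalizing x with
  | zero => rfl
  | succ n ih =>
    have e : iterDensity k B (n + 1 + 2) x y =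
        ∫⁻ w in B, k x w * stepOn (iterDensity k B (n + 1)) B (fun z => k z y) w := by
      change ∫⁻ w in B, k x w * iterDensity k B (n + 2) w y = _
      exact lintegral_congr fun w => by rw [ih]; rfl
    rw [e, lintegral_mul_stepOn (measurable_iterDensity_uncurry hk n)
      (measurable_kernel_left hk x) (measurable_kernel_right hk y)]
    rfl

/-- A Harnack inequality for an iterated density propagates to higher iterates. -/
lemma iterDensity_harnack_mono (hk : Measurable (Function.uncurry k)) {L : ℝ≥0∞} {n m : ℕ}
    (hB : MeasurableSet B) (hnm : n ≤ m)
    (h : ∀ x ∈ B, ∀ x' ∈ B, ∀ y ∈ B,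
      iterDensity k B (n + 1) x y ≤ L * iterDensity k B (n + 1) x' y) :
    ∀ x ∈ B, ∀ x' ∈ B, ∀ y ∈ B,
      iterDensity k B (m + 1) x y ≤ L * iterDensity k B (m + 1) x' y := by
  induction m, hnm using Nat.le_induction with
  | base => exact h
  | succ m _ ih =>
    intro x hx x' hx' y hy
    have h1 : Measurable fun z => iterDensity k B (m + 1) x' z * k z y :=
      (measurable_kernel_left (measurable_iterDensity_uncurry hk m) x').mul
        (measurable_kernel_right hk y)
    rw [iterDensity_succ_succ_right hk, iterDensity_succ_succ_right hk,
      ← lintegral_const_mul _ h1]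
    refine setLIntegral_mono' hB fun z hz => ?_
    rw [← mul_assoc]
    gcongr
    exact ih x hx x' hx' z hz

end Trace

/-! ### The trace density is the density of the killed trace kernel -/

section Markov

variable {d : ℕ} {Ω : Type*} [MeasurableSpace Ω] {P : Measure Ω}
  {F : EuclideanSpace ℝ (Fin d) → EuclideanSpace ℝ (Fin d)}
  {ξ : ℕ → Ω → EuclideanSpace ℝ (Fin d)} {σ : ℝ}

/-- The σ-algebra generated by the noise up to time `n`. -/
abbrev noiseSigma (ξ : ℕ → Ω → EuclideanSpace ℝ (Fin d)) (n : ℕ) : MeasurableSpace Ω :=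
  ⨆ i ∈ Set.Iic n, MeasurableSpace.comap (ξ i) inferInstance

lemma noiseSigma_mono {m n : ℕ} (h : m ≤ n) : noiseSigma ξ m ≤ noiseSigma ξ n :=
  biSup_mono fun _ hi => le_trans hi h

lemma measurable_chain (hF : Measurable F) (x : EuclideanSpace ℝ (Fin d)) (n : ℕ) :
    Measurable[noiseSigma ξ n] (chain F ξ σ x n) := by
  induction n with
  | zero => exact measurable_const
  | succ n ih =>
    have h1 : Measurable[noiseSigma ξ (n + 1)] (chain F ξ σ x n) :=
      ih.mono (noiseSigma_mono n.le_succ) le_rfl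
    have h2 : Measurable[noiseSigma ξ (n + 1)] (ξ (n + 1)) := by
      refine Measurable.mono (comap_measurable (ξ (n + 1))) ?_ le_rfl
      exact le_iSup₂_of_le (n + 1) (Set.mem_Iic.2 le_rfl) le_rfl
    exact (hF.comp h1).add (h2.const_smul σ)

/-- The indicator of the event that the chain avoids `M` at the times `1, …, n`. -/
def avoidIndicator (F : EuclideanSpace ℝ (Fin d) → EuclideanSpace ℝ (Fin d))
    (ξ : ℕ → Ω → EuclideanSpace ℝ (Fin d)) (σ : ℝ) (M : Set (EuclideanSpace ℝ (Fin d)))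
    (x : EuclideanSpace ℝ (Fin d)) (n : ℕ) (ω : Ω) : ℝ≥0∞ :=
  ∏ m ∈ Finset.range n, (Mᶜ).indicator 1 (chain F ξ σ x (m + 1) ω)

variable {M : Set (EuclideanSpace ℝ (Fin d))}

lemma measurable_avoidIndicator (hF : Measurable F) (hM : MeasurableSet M)
    (x : EuclideanSpace ℝ (Fin d)) (n : ℕ) :
    Measurable[noiseSigma ξ n] (avoidIndicator F ξ σ M x n) := by
  refine Finset.measurable_fun_prod _ fun m hm => ?_
  have h1 : Measurable ((Mᶜ).indicator (1 : EuclideanSpace ℝ (Fin d) → ℝ≥0∞)) :=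
    measurable_const.indicator hM.compl
  refine h1.comp ((measurable_chain hF x (m + 1)).mono (noiseSigma_mono ?_) le_rfl)
  have := Finset.mem_range.1 hm
  omega

variable [IsProbabilityMeasure P]

lemma noiseSigma_le (hξ : ∀ n, Measurable (ξ n)) (n : ℕ) : noiseSigma ξ n ≤ ‹MeasurableSpace Ω› :=
  iSup₂_le fun i _ => (hξ i).comap_le

/-- The Markov property. The avoidance indicator and the position at time `n` depend on the noise up
to time `n` only, hence are jointly independent of `ξ (n + 1)`, and Fubini integrates the next step
out. -/
lemma lintegral_avoid_step (hF : Measurable F) (hM : MeasurableSet M) (hξ : ∀ n, Measurable (ξ n))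
    (hindep : iIndepFun ξ P)
    {k : EuclideanSpace ℝ (Fin d) → EuclideanSpace ℝ (Fin d) → ℝ≥0∞}
    (hstep : ∀ n x (f : EuclideanSpace ℝ (Fin d) → ℝ≥0∞), Measurable f →
      ∫⁻ ω, f (F x + σ • ξ n ω) ∂P = ∫⁻ y, k x y * f y)
    {f : EuclideanSpace ℝ (Fin d) → ℝ≥0∞} (hf : Measurable f) (x : EuclideanSpace ℝ (Fin d))
    (n : ℕ) :
    ∫⁻ ω, avoidIndicator F ξ σ M x n ω * f (chain F ξ σ x (n + 1) ω) ∂P =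
      ∫⁻ ω, avoidIndicator F ξ σ M x n ω * stepOn k Set.univ f (chain F ξ σ x n ω) ∂P := by
  set Z : Ω → ℝ≥0∞ × EuclideanSpace ℝ (Fin d) :=
    fun ω => (avoidIndicator F ξ σ M x n ω, chain F ξ σ x n ω) with hZ
  have hZm : Measurable[noiseSigma ξ n] Z :=
    (measurable_avoidIndicator hF hM x n).prodMk (measurable_chain hF x n)
  have hZm' : Measurable Z := hZm.mono (noiseSigma_le hξ n) le_rfl
  have hind : IndepFun Z (ξ (n + 1)) P := by
    have h1 := indep_iSup_of_disjoint (fun i => (hξ i).comap_le) hindep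
      (S := Set.Iic n) (T := {n + 1}) (by simp)
    have h2 : Indep (noiseSigma ξ n) (MeasurableSpace.comap (ξ (n + 1)) inferInstance) P := by
      simpa [noiseSigma] using h1
    rw [IndepFun_iff_Indep]
    exact indep_of_indep_of_le_left h2 hZm.comap_le
  have hmap := (indepFun_iff_map_prod_eq_prod_map_map hZm'.aemeasurable
    (hξ (n + 1)).aemeasurable).1 hind
  set G : (ℝ≥0∞ × EuclideanSpace ℝ (Fin d)) × EuclideanSpace ℝ (Fin d) → ℝ≥0∞ :=
    fun p => p.1.1 * f (F p.1.2 + σ • p.2) with hG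
  have hGm : Measurable G := by fun_prop
  calc _ = ∫⁻ ω, G (Z ω, ξ (n + 1) ω) ∂P := rfl
    _ = ∫⁻ p, G p ∂(P.map fun ω => (Z ω, ξ (n + 1) ω)) :=
        (lintegral_map hGm (hZm'.prodMk (hξ (n + 1)))).symm
    _ = ∫⁻ z, ∫⁻ w, G (z, w) ∂(P.map (ξ (n + 1))) ∂(P.map Z) := by
        have : SFinite (P.map (ξ (n + 1))) := inferInstance
        rw [hmap, lintegral_prod _ hGm.aemeasurable]
    _ = ∫⁻ z, z.1 * stepOn k Set.univ f z.2 ∂(P.map Z) := by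
        refine lintegral_congr fun z => ?_
        simp only [hG]
        rw [lintegral_const_mul _ (by fun_prop), lintegral_map (by fun_prop) (hξ _), hstep _ _ _ hf,
          stepOn, Measure.restrict_univ]
    _ = _ := by
        rw [lintegral_map _ hZm']
        have hT : Measurable (stepOn k Set.univ f) := by
          have e : stepOn k Set.univ f = fun x => ∫⁻ ω, f (F x + σ • ξ 0 ω) ∂P := by
            ext x; rw [hstep 0 x f hf, stepOn, Measure.restrict_univ]
          rw [e]
          have : Measurable (Function.uncurry fun x ω => f (F x + σ • ξ 0 ω)) := by
            have := hξ 0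
            unfold Function.uncurry
            fun_prop
          exact this.lintegral_prod_right
        exact measurable_fst.mul (hT.comp measurable_snd)

lemma lintegral_avoid_eq_iterate (hF : Measurable F) (hM : MeasurableSet M)
    (hξ : ∀ n, Measurable (ξ n)) (hindep : iIndepFun ξ P)
    {k : EuclideanSpace ℝ (Fin d) → EuclideanSpace ℝ (Fin d) → ℝ≥0∞}
    (hk : Measurable (Function.uncurry k))
    (hstep : ∀ n x (f : EuclideanSpace ℝ (Fin d) → ℝ≥0∞), Measurable f →
      ∫⁻ ω, f (F x + σ • ξ n ω) ∂P = ∫⁻ y, k x y * f y)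
    {f : EuclideanSpace ℝ (Fin d) → ℝ≥0∞} (hf : Measurable f) (x : EuclideanSpace ℝ (Fin d))
    (n : ℕ) :
    ∫⁻ ω, avoidIndicator F ξ σ M x n ω * f (chain F ξ σ x (n + 1) ω) ∂P =
      (stepOn k Mᶜ)^[n] (stepOn k Set.univ f) x := by
  induction n generalizing f with
  | zero =>
    rw [lintegral_avoid_step hF hM hξ hindep hstep hf]
    simp [avoidIndicator, chain]
  | succ n ih =>
    rw [lintegral_avoid_step hF hM hξ hindep hstep hf]
    have hT := measurable_stepOn (A := Set.univ) hk hf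
    have e : ∀ ω, avoidIndicator F ξ σ M x (n + 1) ω *
          stepOn k Set.univ f (chain F ξ σ x (n + 1) ω) = avoidIndicator F ξ σ M x n ω *
          (Mᶜ).indicator (stepOn k Set.univ f) (chain F ξ σ x (n + 1) ω) := by
      intro ω
      rw [avoidIndicator, Finset.prod_range_succ, mul_assoc]
      congr 1
      by_cases h : chain F ξ σ x (n + 1) ω ∈ Mᶜ <;> simp [h]
    simp_rw [e]
    rw [ih (hT.indicator hM.compl), Function.iterate_succ_apply]
    have e2 : stepOn k Set.univ ((Mᶜ).indicator (stepOn k Set.univ f)) =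
        stepOn k Mᶜ (stepOn k Set.univ f) := by
      ext z
      rw [stepOn_indicator hM.compl, Set.univ_inter]
    rw [e2]

lemma avoidIndicator_eq (x : EuclideanSpace ℝ (Fin d)) (n : ℕ) (ω : Ω) :
    avoidIndicator F ξ σ M x n ω =
      {ω | ∀ m, 1 ≤ m → m < n + 1 → chain F ξ σ x m ω ∉ M}.indicator 1 ω := by
  classical
  unfold avoidIndicator
  by_cases h : ∀ m, 1 ≤ m → m < n + 1 → chain F ξ σ x m ω ∉ M
  · rw [Set.indicator_of_mem (by exact h)]
    refine Finset.prod_eq_one fun m hm => ?_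
    rw [Set.indicator_of_mem]
    · rfl
    · exact h (m + 1) (by omega) (by have := Finset.mem_range.1 hm; omega)
  · rw [Set.indicator_of_notMem (by exact h)]
    push Not at h
    obtain ⟨m, h1, h2, h3⟩ := h
    refine Finset.prod_eq_zero (i := m - 1) (Finset.mem_range.2 (by omega)) ?_
    rw [Set.indicator_of_notMem]
    rw [Nat.sub_add_cancel h1]
    simpa using h3

lemma killedTraceKernel_eq_of_measurable (hF : Measurable F) (hM : MeasurableSet M)
    (hξ : ∀ n, Measurable (ξ n)) (hindep : iIndepFun ξ P)
    {k : EuclideanSpace ℝ (Fin d) → EuclideanSpace ℝ (Fin d) → ℝ≥0∞}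
    (hk : Measurable (Function.uncurry k))
    (hstep : ∀ n x (f : EuclideanSpace ℝ (Fin d) → ℝ≥0∞), Measurable f →
      ∫⁻ ω, f (F x + σ • ξ n ω) ∂P = ∫⁻ y, k x y * f y)
    {A C : Set (EuclideanSpace ℝ (Fin d))} (hAM : A ⊆ M) (hC : MeasurableSet C) (hCA : C ⊆ A)
    (x : EuclideanSpace ℝ (Fin d)) :
    killedTraceKernel P (chain F ξ σ) M A x C = ∫⁻ y in C, traceDensity k M x y := by
  have hchain : ∀ n, Measurable (chain F ξ σ x n) := fun n =>
    (measurable_chain hF x n).mono (noiseSigma_le hξ n) le_rfl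
  -- The event is split according to the value of the return time. The index is shifted: `V n` and
  -- `W n` belong to the return time `n + 1`, matching the `n`-th term of the series.
  set V : ℕ → Set Ω := fun n => {ω | ∀ m, 1 ≤ m → m < n + 1 → chain F ξ σ x m ω ∉ M} with hV
  have hVm : ∀ n, MeasurableSet (V n) := by
    intro n
    simp only [hV, Set.ofPred_forall]
    refine MeasurableSet.iInter fun m => MeasurableSet.iInter fun _ => MeasurableSet.iInter fun _ => ?_
    exact hchain m hM.compl
  set W : ℕ → Set Ω := fun n => V n ∩ {ω | chain F ξ σ x (n + 1) ω ∈ C} with hW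
  have hWm : ∀ n, MeasurableSet (W n) := fun n => (hVm n).inter (hchain (n + 1) hC)
  have hset : {ω | ∃ n, IsReturnTime (fun m => chain F ξ σ x m ω) M n ∧
      chain F ξ σ x n ω ∈ C ∩ A} = ⋃ n, W n := by
    ext ω
    simp only [Set.mem_ofPred_eq, Set.mem_iUnion, hW, hV, Set.mem_inter_iff, IsReturnTime]
    constructor
    · rintro ⟨n, ⟨h1, _, h3⟩, h4, _⟩
      refine ⟨n - 1, ?_, ?_⟩
      · rwa [Nat.sub_add_cancel h1]
      · rwa [Nat.sub_add_cancel h1]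
    · rintro ⟨n, h1, h2⟩
      exact ⟨n + 1, ⟨by omega, hAM (hCA h2), h1⟩, h2, hCA h2⟩
  have hdisj : Pairwise (Function.onFun Disjoint W) := by
    have key : ∀ m n, m < n → Disjoint (W m) (W n) := by
      intro m n hmn
      rw [Set.disjoint_left]
      rintro ω ⟨_, h1⟩ ⟨h2, _⟩
      exact h2 (m + 1) (by omega) (by omega) (hAM (hCA h1))
    intro m n hmn
    rcases lt_or_gt_of_ne hmn with h | h
    · exact key m n h
    · exact (key n m h).symm
  rw [killedTraceKernel, hset, measure_iUnion hdisj hWm]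
  have h1 := stepOn_traceDensity_eq_tsum (B := C) (M := M) hk (g := fun _ => 1) measurable_const x
  have h2 : stepOn (traceDensity k M) C (fun _ => 1) x = ∫⁻ y in C, traceDensity k M x y := by
    simp [stepOn]
  rw [← h2, h1]
  congr 1
  ext n
  have hf : Measurable (C.indicator (1 : EuclideanSpace ℝ (Fin d) → ℝ≥0∞)) :=
    measurable_const.indicator hC
  have h3 := lintegral_avoid_eq_iterate hF hM hξ hindep hk hstep hf x n
  have h4 : stepOn k Set.univ (C.indicator 1) = stepOn k C (fun _ => 1) := by
    ext z
    rw [stepOn_indicator hC, Set.univ_inter]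
    rfl
  rw [h4] at h3
  rw [← h3, ← lintegral_indicator_one (hWm n)]
  refine lintegral_congr fun ω => ?_
  rw [avoidIndicator_eq, hW]
  by_cases h5 : ω ∈ V n <;> by_cases h6 : chain F ξ σ x (n + 1) ω ∈ C
  · rw [Set.indicator_of_mem (by exact ⟨h5, h6⟩), Set.indicator_of_mem (by exact h5),
      Set.indicator_of_mem h6]
    simp
  · rw [Set.indicator_of_notMem (by exact fun h => h6 h.2), Set.indicator_of_notMem h6, mul_zero]
  · rw [Set.indicator_of_notMem (by exact fun h => h5 h.1), Set.indicator_of_notMem (by exact h5),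
      zero_mul]
  · rw [Set.indicator_of_notMem (by exact fun h => h5 h.1), Set.indicator_of_notMem (by exact h5),
      zero_mul]

theorem killedTraceKernel_eq (hF : Measurable F) (hM : MeasurableSet M)
    (hindep : iIndepFun ξ P) {S : Matrix (Fin d) (Fin d) ℝ} (hS : S.PosDef)
    (hlaw : ∀ n, HasLaw (ξ n) (multivariateGaussian 0 S) P) (hσ : 0 < σ)
    {A C : Set (EuclideanSpace ℝ (Fin d))} (hAM : A ⊆ M) (hC : MeasurableSet C) (hCA : C ⊆ A)
    (x : EuclideanSpace ℝ (Fin d)) :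
    killedTraceKernel P (chain F ξ σ) M A x C =
      ∫⁻ y in C, traceDensity (gaussianStepDensity F S σ) M x y := by
  -- The laws only give almost everywhere measurable noise. Measurable versions change all chains on
  -- a single null set.
  set ζ : ℕ → Ω → EuclideanSpace ℝ (Fin d) := fun n => (hlaw n).aemeasurable.mk (ξ n) with hζ
  have hζm : ∀ n, Measurable (ζ n) := fun n => (hlaw n).aemeasurable.measurable_mk
  have hae : ∀ n, ξ n =ᵐ[P] ζ n := fun n => (hlaw n).aemeasurable.ae_eq_mk
  have hζi : iIndepFun ζ P := hindep.congr hae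
  rw [← killedTraceKernel_eq_of_measurable (σ := σ) hF hM hζm hζi
    (measurable_gaussianStepDensity F hF S σ) ?_ hAM hC hCA x]
  · unfold killedTraceKernel
    apply measure_congr
    have hall : ∀ᵐ ω ∂P, ∀ n, ξ n ω = ζ n ω := ae_all_iff.2 hae
    filter_upwards [hall] with ω hω
    have hch : ∀ n, chain F ξ σ x n ω = chain F ζ σ x n ω := by
      intro n
      induction n with
      | zero => rfl
      | succ n ih => simp only [chain, ih, hω]
    apply propext
    change (∃ n, _) ↔ (∃ n, _)
    simp only [hch]
  · intro n z f hf
    rw [lintegral_gaussianStepDensity F hS hσ z hf, ← (hlaw n).map_eq,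
      lintegral_map' (by fun_prop) (hlaw n).aemeasurable]
    refine lintegral_congr_ae ?_
    filter_upwards [hae n] with ω hω
    rw [hω]

end Markov

/-! ### An adapted norm at a linearly stable fixed point -/

section AdaptedNorm

variable {d : ℕ}

attribute [local instance] Matrix.linftyOpNormedRing Matrix.linftyOpNormedAlgebra in
/-- If the complexified matrix of a real operator has spectral radius smaller than one, then some
power of the operator is small. -/
lemma exists_pow_norm_le_half (A : EuclideanSpace ℝ (Fin d) →L[ℝ] EuclideanSpace ℝ (Fin d))
    (hA : spectralRadius ℂ ((LinearMap.toMatrix (EuclideanSpace.basisFun (Fin d) ℝ).toBasis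
      (EuclideanSpace.basisFun (Fin d) ℝ).toBasis
      (A : EuclideanSpace ℝ (Fin d) →ₗ[ℝ] EuclideanSpace ℝ (Fin d))).map (algebraMap ℝ ℂ)) < 1) :
    ∃ m : ℕ, 1 ≤ m ∧ ‖A ^ m‖ ≤ 1 / 2 := by
  set b := (EuclideanSpace.basisFun (Fin d) ℝ).toBasis with hb
  set J := (LinearMap.toMatrix b b
    (A : EuclideanSpace ℝ (Fin d) →ₗ[ℝ] EuclideanSpace ℝ (Fin d))).map (algebraMap ℝ ℂ) with hJ
  have : CompleteSpace (Matrix (Fin d) (Fin d) ℂ) := FiniteDimensional.complete ℂ _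
  -- Entrywise real part, read as an operator. It inverts complexification on real matrices, so it
  -- carries the decay of the powers of the complex matrix back to those of `A`.
  let Ψ : Matrix (Fin d) (Fin d) ℂ →ₗ[ℝ]
      (EuclideanSpace ℝ (Fin d) →L[ℝ] EuclideanSpace ℝ (Fin d)) :=
    (LinearMap.toContinuousLinearMap : (EuclideanSpace ℝ (Fin d) →ₗ[ℝ] EuclideanSpace ℝ (Fin d)) ≃ₗ[ℝ]
      (EuclideanSpace ℝ (Fin d) →L[ℝ] EuclideanSpace ℝ (Fin d))).toLinearMap ∘ₗ
      (Matrix.toLin b b).toLinearMap ∘ₗ (Complex.reLm.mapMatrix)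
  have hΨ : ∀ n : ℕ, Ψ (J ^ n) = A ^ n := by
    intro n
    have h1 : J ^ n = ((LinearMap.toMatrix b b
        (A : EuclideanSpace ℝ (Fin d) →ₗ[ℝ] EuclideanSpace ℝ (Fin d))) ^ n).map
          (algebraMap ℝ ℂ) := by
      rw [hJ]
      exact (map_pow (algebraMap ℝ ℂ).mapMatrix _ n).symm
    have h2 : ∀ M : Matrix (Fin d) (Fin d) ℝ,
        Complex.reLm.mapMatrix (M.map (algebraMap ℝ ℂ)) = M := by
      intro M; ext i j; simp
    rw [h1]
    change LinearMap.toContinuousLinearMap (Matrix.toLin b b (Complex.reLm.mapMatrix _)) = _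
    have h3 := LinearMap.toMatrix_pow (v₁ := b) (A : EuclideanSpace ℝ (Fin d) →ₗ[ℝ] EuclideanSpace ℝ (Fin d)) n
    rw [h2, h3, Matrix.toLin_toMatrix]
    ext v : 1
    have h4 : ∀ (n : ℕ) (v : EuclideanSpace ℝ (Fin d)), ((A : EuclideanSpace ℝ (Fin d) →ₗ[ℝ]
        EuclideanSpace ℝ (Fin d)) ^ n) v = (A ^ n) v := by
      intro n
      induction n with
      | zero => intro v; rfl
      | succ n ih => intro v; rw [pow_succ, pow_succ]; exact ih (A v)
    exact h4 n v
  have hΨc : Continuous Ψ := Ψ.continuous_of_finiteDimensional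
  -- Gelfand's formula. With `θ` strictly between the spectral radius and one, the powers eventually
  -- lie below `θ ^ n`.
  have hlim := spectrum.pow_nnnorm_pow_one_div_tendsto_nhds_spectralRadius J
  obtain ⟨θ, hθ1, hθ2⟩ := ENNReal.lt_iff_exists_nnreal_btwn.1 hA
  have hθ : θ < 1 := by exact_mod_cast hθ2
  have hev : ∀ᶠ n : ℕ in atTop, ‖J ^ n‖ ≤ (θ : ℝ) ^ n := by
    filter_upwards [hlim.eventually (gt_mem_nhds hθ1), eventually_ge_atTop 1] with n hn hn1
    have hn0 : (n : ℝ) ≠ 0 := by positivity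
    have h3 := ENNReal.rpow_le_rpow hn.le (Nat.cast_nonneg n : (0 : ℝ) ≤ n)
    rw [← ENNReal.rpow_mul, one_div, inv_mul_cancel₀ hn0, ENNReal.rpow_one,
      ENNReal.rpow_natCast] at h3
    have h4 : ‖J ^ n‖₊ ≤ θ ^ n := by exact_mod_cast h3
    exact_mod_cast h4
  have hJ0 : Tendsto (fun n => J ^ n) atTop (𝓝 0) := by
    apply squeeze_zero_norm' hev
    exact tendsto_pow_atTop_nhds_zero_of_lt_one θ.2 (by exact_mod_cast hθ)
  have hA0 : Tendsto (fun n => ‖A ^ n‖) atTop (𝓝 0) := by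
    have := (hΨc.tendsto 0).comp hJ0
    rw [map_zero] at this
    have h5 := this.norm
    rw [norm_zero] at h5
    refine h5.congr fun n => ?_
    simp only [Function.comp, hΨ]
  obtain ⟨m, hm1, hm2⟩ := ((hA0.eventually (gt_mem_nhds (show (0 : ℝ) < 1 / 2 by norm_num))).and
    (eventually_ge_atTop 1)).exists
  exact ⟨m, hm2, hm1.le⟩

/-- If a power of `A` is small, then `A` contracts an equivalent norm. -/
lemma exists_contracted_seminorm {V : Type*} [NormedAddCommGroup V] [NormedSpace ℝ V]
    (A : V →L[ℝ] V) {m : ℕ} (hm : 1 ≤ m) (hA : ‖A ^ m‖ ≤ 1 / 2) :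
    ∃ (N : Seminorm ℝ V) (C c : ℝ), 1 ≤ C ∧ 0 < c ∧ c < 1 ∧
      (∀ v, ‖v‖ ≤ N v ∧ N v ≤ C * ‖v‖) ∧ ∀ v, N (A v) ≤ c * N v := by
  have hm0 : (0 : ℝ) < m := by exact_mod_cast hm
  have hm1 : (1 : ℝ) ≤ m := by exact_mod_cast hm
  -- Chosen so that Bernoulli's inequality gives `c ^ m ≥ 1 - m / (2 m) = 1/2`.
  set c : ℝ := 1 - 1 / (2 * m) with hc
  have h2m : 1 / (2 * (m : ℝ)) ≤ 1 / 2 := by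
    apply one_div_le_one_div_of_le <;> linarith
  have h2m' : 0 < 1 / (2 * (m : ℝ)) := by positivity
  have hc0 : 0 < c := by linarith
  have hc1 : c < 1 := by linarith
  have hcm : 1 / 2 ≤ c ^ m := by
    have := one_add_mul_le_pow (a := -(1 / (2 * (m : ℝ)))) (by linarith) m
    have e : 1 + (m : ℝ) * -(1 / (2 * m)) = 1 / 2 := by field_simp; ring
    rw [e] at this
    simpa [hc, sub_eq_add_neg] using this
  -- Applying `A` shifts the weighted sum by one index and produces the factor `c`. The new last
  -- term `c⁻¹ ^ m * ‖A ^ m v‖` is at most `2 * (1/2) * ‖v‖`, so it is covered by the lost term of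
  -- index zero.
  let N : Seminorm ℝ V := Seminorm.of
    (fun v => ∑ j ∈ Finset.range m, (c⁻¹) ^ j * ‖(A ^ j) v‖)
    (fun v w => by
      rw [← Finset.sum_add_distrib]
      refine Finset.sum_le_sum fun j _ => ?_
      rw [map_add, ← mul_add]
      gcongr
      exact norm_add_le _ _)
    (fun a v => by
      rw [Finset.mul_sum]
      refine Finset.sum_congr rfl fun j _ => ?_
      rw [map_smul, norm_smul]; ring)
  have hN : ∀ v, N v = ∑ j ∈ Finset.range m, (c⁻¹) ^ j * ‖(A ^ j) v‖ := fun _ => rfl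
  have hlow : ∀ v, ‖v‖ ≤ N v := by
    intro v
    have := Finset.single_le_sum (f := fun j => (c⁻¹) ^ j * ‖(A ^ j) v‖)
      (fun j _ => by positivity) (Finset.mem_range.2 (show 0 < m by omega))
    rw [hN]
    simpa using this
  refine ⟨N, 1 + ∑ j ∈ Finset.range m, (c⁻¹) ^ j * ‖A ^ j‖, c, ?_, hc0, hc1,
    fun v => ⟨hlow v, ?_⟩, fun v => ?_⟩
  · have : 0 ≤ ∑ j ∈ Finset.range m, (c⁻¹) ^ j * ‖A ^ j‖ :=
      Finset.sum_nonneg fun _ _ => by positivity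
    linarith
  · have : N v ≤ (∑ j ∈ Finset.range m, (c⁻¹) ^ j * ‖A ^ j‖) * ‖v‖ := by
      rw [hN, Finset.sum_mul]
      refine Finset.sum_le_sum fun j _ => ?_
      rw [mul_assoc]
      gcongr
      exact (A ^ j).le_opNorm v
    nlinarith [norm_nonneg v]
  · obtain ⟨n, rfl⟩ : ∃ n, m = n + 1 := ⟨m - 1, by omega⟩
    have e1 : N (A v) = c * (∑ j ∈ Finset.range n, (c⁻¹) ^ (j + 1) * ‖(A ^ (j + 1)) v‖
        + (c⁻¹) ^ (n + 1) * ‖(A ^ (n + 1)) v‖) := by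
      rw [← Finset.sum_range_succ (fun j => (c⁻¹) ^ (j + 1) * ‖(A ^ (j + 1)) v‖), hN,
        Finset.mul_sum]
      refine Finset.sum_congr rfl fun j _ => ?_
      rw [pow_succ (c⁻¹), pow_succ A]
      have : (A ^ j * A) v = (A ^ j) (A v) := rfl
      rw [this]
      field_simp
    rw [e1, hN, Finset.sum_range_succ']
    refine mul_le_mul_of_nonneg_left (add_le_add le_rfl ?_) hc0.le
    simp only [pow_zero, one_mul]
    have h1 : ‖(A ^ (n + 1)) v‖ ≤ 1 / 2 * ‖v‖ :=
      ((A ^ (n + 1)).le_opNorm v).trans (by gcongr)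
    have h2 : (c⁻¹) ^ (n + 1) ≤ 2 := by
      rw [inv_pow]
      exact inv_le_of_inv_le₀ (by norm_num) (by linarith)
    have h3 : ((1 : V →L[ℝ] V) v) = v := rfl
    rw [h3]
    calc _ ≤ 2 * (1 / 2 * ‖v‖) := by gcongr
      _ = ‖v‖ := by ring

/-- Near a linearly stable fixed point, the map contracts an equivalent norm. -/
theorem exists_adapted_seminorm {F : EuclideanSpace ℝ (Fin d) → EuclideanSpace ℝ (Fin d)}
    (hF : ContDiff ℝ 2 F) {p : EuclideanSpace ℝ (Fin d)} (hp : IsLinearlyStable F p) :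
    ∃ (N : Seminorm ℝ (EuclideanSpace ℝ (Fin d))) (C ρ r : ℝ), 1 ≤ C ∧ 0 < ρ ∧ ρ < 1 ∧ 0 < r ∧
      (∀ v, ‖v‖ ≤ N v ∧ N v ≤ C * ‖v‖) ∧
      ∀ x y, N (x - p) ≤ r → N (y - p) ≤ r → N (F x - F y) ≤ ρ * N (x - y) := by
  obtain ⟨m, hm, hA⟩ := exists_pow_norm_le_half (fderiv ℝ F p) hp.2
  obtain ⟨N, C, c, hC, hc0, hc1, hN, hNA⟩ := exists_contracted_seminorm _ hm hA
  have hs : HasStrictFDerivAt F (fderiv ℝ F p) p :=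
    hF.contDiffAt.hasStrictFDerivAt (by norm_num)
  -- In the norm `N` the remainder of the strict derivative costs at most `C * ε = (1 - c) / 2`, so
  -- the contraction factor becomes `(1 + c) / 2 < 1`.
  set ε : ℝ := (1 - c) / (2 * C) with hε
  have hε0 : 0 < ε := by rw [hε]; apply div_pos <;> linarith
  have hev := hs.isLittleO.def hε0
  obtain ⟨r, hr, hball⟩ := Metric.eventually_nhds_iff.1 hev
  refine ⟨N, C, (1 + c) / 2, r / 2, hC, by linarith, by linarith, by linarith, hN, ?_⟩
  intro x y hx hy
  have hd : dist (x, y) (p, p) < r := by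
    rw [Prod.dist_eq, max_lt_iff, dist_eq_norm, dist_eq_norm]
    exact ⟨by linarith [(hN (x - p)).1], by linarith [(hN (y - p)).1]⟩
  have h1 := hball hd
  simp only at h1
  have h2 : N (F x - F y) ≤ N (F x - F y - fderiv ℝ F p (x - y)) + N (fderiv ℝ F p (x - y)) := by
    have := map_add_le_add N (F x - F y - fderiv ℝ F p (x - y)) (fderiv ℝ F p (x - y))
    rwa [sub_add_cancel] at this
  have h3 := (hN (F x - F y - fderiv ℝ F p (x - y))).2
  have h4 := hNA (x - y)
  have h5 : C * ‖F x - F y - fderiv ℝ F p (x - y)‖ ≤ C * (ε * ‖x - y‖) := by gcongr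
  have h6 : C * (ε * ‖x - y‖) = (1 - c) / 2 * ‖x - y‖ := by rw [hε]; field_simp
  have h7 := (hN (x - y)).1
  nlinarith

end AdaptedNorm

/-! ### Operator inequalities -/

section Operators

variable {d : ℕ} {k : EuclideanSpace ℝ (Fin d) → EuclideanSpace ℝ (Fin d) → ℝ≥0∞}

/-- Bernoulli's inequality in additive form, valid for truncated subtraction without assuming `p ≤
1`. -/
lemma one_le_one_sub_pow_add (p : ℝ≥0∞) (j : ℕ) : 1 ≤ (1 - p) ^ j + j * p := by
  induction j with
  | zero => simp
  | succ j ih =>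
    have h1 : (1 - p) ^ j ≤ 1 := pow_le_one₀ zero_le (tsub_le_self)
    calc 1 ≤ (1 - p) ^ j * 1 + j * p := by simpa using ih
      _ ≤ (1 - p) ^ j * ((1 - p) + p) + j * p := by
          gcongr
          exact le_tsub_add
      _ = (1 - p) ^ (j + 1) + ((1 - p) ^ j * p + j * p) := by rw [pow_succ]; ring
      _ ≤ (1 - p) ^ (j + 1) + (1 * p + j * p) := by gcongr
      _ = _ := by push_cast; ring

lemma one_sub_le_stepOn (hk1 : ∀ x, ∫⁻ y, k x y = 1) {A : Set (EuclideanSpace ℝ (Fin d))}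
    (hA : MeasurableSet A) {p : ℝ≥0∞} {x : EuclideanSpace ℝ (Fin d)}
    (h : stepOn k Aᶜ (fun _ => 1) x ≤ p) : 1 - p ≤ stepOn k A (fun _ => 1) x := by
  rw [tsub_le_iff_right]
  exact (stepOn_compl_add hk1 hA x).symm.le.trans (by gcongr)

lemma stepOn_univ_le_add (hk : Measurable (Function.uncurry k))
    {A : Set (EuclideanSpace ℝ (Fin d))} (hA : MeasurableSet A) {p c : ℝ≥0∞}
    {x : EuclideanSpace ℝ (Fin d)} (hp : stepOn k Aᶜ (fun _ => 1) x ≤ p)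
    {f : EuclideanSpace ℝ (Fin d) → ℝ≥0∞} (hf : ∀ y ∈ Aᶜ, f y ≤ c) :
    stepOn k Set.univ f x ≤ stepOn k A f x + p * c := by
  rw [← Set.union_compl_self A, stepOn_union hA.compl disjoint_compl_right]
  gcongr
  calc _ ≤ c * stepOn k Aᶜ (fun _ => 1) x := stepOn_le_const hA.compl hk hf x
    _ ≤ p * c := by rw [mul_comm]; gcongr

/-- Iterating a one-step upper bound with additive errors. -/
lemma le_iterate_stepOn_add (hk : Measurable (Function.uncurry k)) (hk1 : ∀ x, ∫⁻ y, k x y = 1)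
    {A : Set (EuclideanSpace ℝ (Fin d))} (hA : MeasurableSet A)
    {u : ℕ → EuclideanSpace ℝ (Fin d) → ℝ≥0∞} (hu : ∀ j, Measurable (u j)) {e : ℝ≥0∞}
    (h : ∀ j, ∀ z ∈ A, u (j + 1) z ≤ stepOn k A (u j) z + e) (m : ℕ) :
    ∀ z ∈ A, u m z ≤ (stepOn k A)^[m] (u 0) z + m * e := by
  induction m with
  | zero => intro z _; simp
  | succ m ih =>
    intro z hz
    calc u (m + 1) z ≤ stepOn k A (u m) z + e := h m z hz
      _ ≤ stepOn k A (fun w => (stepOn k A)^[m] (u 0) w + m * e) z + e := by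
          gcongr
          exact stepOn_mono_of_mem hA ih z
      _ = stepOn k A ((stepOn k A)^[m] (u 0)) z + m * e * stepOn k A (fun _ => 1) z + e := by
          rw [stepOn_add hk (measurable_stepOn_iterate hk (hu 0) m), stepOn_const hk]
      _ ≤ stepOn k A ((stepOn k A)^[m] (u 0)) z + m * e * 1 + e := by
          gcongr
          exact stepOn_one_le hk1 z
      _ = _ := by
          rw [Function.iterate_succ_apply']; push_cast; ring

/-- Iterating a one-step lower bound with additive errors. -/
lemma iterate_stepOn_le_add (hk : Measurable (Function.uncurry k)) (hk1 : ∀ x, ∫⁻ y, k x y = 1)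
    {A : Set (EuclideanSpace ℝ (Fin d))} (hA : MeasurableSet A)
    {u : ℕ → EuclideanSpace ℝ (Fin d) → ℝ≥0∞} (hu : ∀ j, Measurable (u j)) {e : ℝ≥0∞}
    (h : ∀ j, ∀ z ∈ A, stepOn k A (u j) z ≤ u (j + 1) z + e) (m : ℕ) :
    ∀ z ∈ A, (stepOn k A)^[m] (u 0) z ≤ u m z + m * e := by
  induction m with
  | zero => intro z _; simp
  | succ m ih =>
    intro z hz
    rw [Function.iterate_succ_apply']
    calc stepOn k A ((stepOn k A)^[m] (u 0)) z
        ≤ stepOn k A (fun w => u m w + m * e) z := stepOn_mono_of_mem hA ih z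
      _ = stepOn k A (u m) z + m * e * stepOn k A (fun _ => 1) z := by
          rw [stepOn_add hk (hu m), stepOn_const hk]
      _ ≤ (u (m + 1) z + e) + m * e * 1 := by
          gcongr
          · exact h m z hz
          · exact stepOn_one_le hk1 z
      _ = _ := by push_cast; ring

lemma pow_le_iterate_stepOn_one (hk : Measurable (Function.uncurry k))
    {A : Set (EuclideanSpace ℝ (Fin d))} (hA : MeasurableSet A) {q : ℝ≥0∞}
    (h : ∀ z ∈ A, q ≤ stepOn k A (fun _ => 1) z) (m : ℕ) :
    ∀ z ∈ A, q ^ m ≤ (stepOn k A)^[m] (fun _ => 1) z := by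
  induction m with
  | zero => intro z _; simp
  | succ m ih =>
    intro z hz
    rw [Function.iterate_succ_apply', pow_succ]
    calc q ^ m * q ≤ q ^ m * stepOn k A (fun _ => 1) z := by gcongr; exact h z hz
      _ ≤ _ := const_le_stepOn hA hk ih z

/-- A lower bound for the infimum of a supersolution which gains `c` on the set `V`. -/
lemma supersolution_gain (hk : Measurable (Function.uncurry k))
    {A U V : Set (EuclideanSpace ℝ (Fin d))} (hA : MeasurableSet A) (hAU : A ⊆ U)
    (hV : MeasurableSet V) {u : EuclideanSpace ℝ (Fin d) → ℝ≥0∞} {a c p : ℝ≥0∞} (ha : a ≠ ∞)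
    (hinf : ∀ b, (∀ z ∈ U, b ≤ u z) → b ≤ a)
    (h1 : ∀ z ∈ U, stepOn k A u z ≤ u z)
    (h2 : ∀ z ∈ U, (1 - p) * a + c * V.indicator (fun _ => 1) z ≤ u z)
    (h3 : ∀ z ∈ U, 1 - p ≤ stepOn k A (fun _ => 1) z)
    {m : ℕ} (h4 : ∀ z ∈ U, 2⁻¹ ≤ (stepOn k A)^[m] (V.indicator fun _ => 1) z) :
    c ≤ 2 * ((m + 1) * p * a) := by
  have hind : Measurable (V.indicator fun _ => (1 : ℝ≥0∞)) := measurable_const.indicator hV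
  have h5 : ∀ j, ∀ z ∈ U, (stepOn k A)^[j] u z ≤ u z := by
    intro j
    induction j with
    | zero => intro z _; exact le_rfl
    | succ j ih =>
      intro z hz
      rw [Function.iterate_succ_apply']
      exact (stepOn_mono_of_mem hA (fun w hw => ih w (hAU hw)) z).trans (h1 z hz)
  have hpow : ∀ j, ∀ z ∈ U, (1 - p) ^ j ≤ (stepOn k A)^[j] (fun _ => 1) z := by
    intro j
    induction j with
    | zero => intro z _; simp
    | succ j ih =>
      intro z hz
      rw [Function.iterate_succ_apply', pow_succ]
      calc (1 - p) ^ j * (1 - p) ≤ (1 - p) ^ j * stepOn k A (fun _ => 1) z := by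
            gcongr; exact h3 z hz
        _ ≤ _ := const_le_stepOn hA hk (fun w hw => ih w (hAU hw)) z
  have hmono : ∀ j, ∀ z ∈ U, (stepOn k A)^[j]
      (fun z => (1 - p) * a + c * V.indicator (fun _ => 1) z) z ≤ (stepOn k A)^[j] u z := by
    intro j
    induction j with
    | zero => exact h2
    | succ j ih =>
      intro z hz
      simp only [Function.iterate_succ_apply']
      exact stepOn_mono_of_mem hA (fun w hw => ih w (hAU hw)) z
  -- Iterating the lower bound `m` times multiplies the level `a` by at most `m + 1` factors `1 -
  -- p`, while the gain is collected with probability at least one half. This bounds `u` from below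
  -- on all of `U`, hence also its infimum `a`. Bernoulli and cancellation of the finite `a` then
  -- bound `c`.
  have hlow : (1 - p) ^ (m + 1) * a + c * 2⁻¹ ≤ a := by
    apply hinf
    intro z hz
    refine le_trans ?_ ((hmono m z hz).trans (h5 m z hz))
    rw [stepOn_iterate_add hk measurable_const, stepOn_iterate_const_mul hk hind]
    have e1 : (stepOn k A)^[m] (fun _ => (1 - p) * a) z =
        (1 - p) * a * (stepOn k A)^[m] (fun _ => 1) z := by
      simpa using stepOn_iterate_const_mul (A := A) hk (f := fun _ => 1) measurable_const
        ((1 - p) * a) m z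
    rw [e1]
    have := hpow m z hz
    calc _ = (1 - p) * a * (1 - p) ^ m + c * 2⁻¹ := by rw [pow_succ]; ring
      _ ≤ _ := by
        gcongr
        exact h4 z hz
  have hb := one_le_one_sub_pow_add p (m + 1)
  have h6 : a + c * 2⁻¹ ≤ a + (m + 1) * p * a := by
    calc a + c * 2⁻¹ ≤ ((1 - p) ^ (m + 1) + ((m + 1 : ℕ) : ℝ≥0∞) * p) * a + c * 2⁻¹ := by
          gcongr
          exact le_mul_of_one_le_left zero_le hb
      _ = ((1 - p) ^ (m + 1) * a + c * 2⁻¹) + (m + 1) * p * a := by push_cast; ring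
      _ ≤ a + (m + 1) * p * a := by gcongr
  have h7 : c * 2⁻¹ ≤ (m + 1) * p * a := (ENNReal.add_le_add_iff_left ha).1 h6
  calc c = 2 * (c * 2⁻¹) := by
        rw [mul_left_comm, ENNReal.mul_inv_cancel (by norm_num) (by norm_num), mul_one]
    _ ≤ _ := by gcongr

end Operators

/-! ### Local dynamics near a stable fixed point -/

section Local

variable {d : ℕ} {k : EuclideanSpace ℝ (Fin d) → EuclideanSpace ℝ (Fin d) → ℝ≥0∞}
  {F : EuclideanSpace ℝ (Fin d) → EuclideanSpace ℝ (Fin d)}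
  {N : Seminorm ℝ (EuclideanSpace ℝ (Fin d))} {z₀ : EuclideanSpace ℝ (Fin d)}

lemma isClosed_seminorm_closedBall {C : ℝ} (hN : ∀ v, N v ≤ C * ‖v‖) (r : ℝ) :
    IsClosed (N.closedBall z₀ r) := by
  have hc : Continuous N := by
    apply Seminorm.continuous_of_continuousAt_zero
    rw [ContinuousAt, map_zero]
    refine squeeze_zero (fun v => apply_nonneg N v) hN ?_
    have : Continuous fun v : EuclideanSpace ℝ (Fin d) => C * ‖v‖ := by fun_prop
    simpa using this.tendsto 0
  have : N.closedBall z₀ r = {y | N (y - z₀) ≤ r} := by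
    ext y; exact Seminorm.mem_closedBall N
  rw [this]
  exact isClosed_le (hc.comp (by fun_prop)) continuous_const

lemma measurableSet_seminorm_closedBall {C : ℝ} (hN : ∀ v, N v ≤ C * ‖v‖) (r : ℝ) :
    MeasurableSet (N.closedBall z₀ r) := (isClosed_seminorm_closedBall hN r).measurableSet

/-- Coupling of two copies of the chain driven by the same noise, merged at the last step by
comparing the transition densities. -/
lemma coupling_bound {C ρ r K' : ℝ} (hN : ∀ v, N v ≤ C * ‖v‖) (hρ0 : 0 < ρ) (hρ1 : ρ < 1)
    (hr : 0 ≤ r) (hK' : 0 ≤ K')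
    (hF : ∀ x y, N (x - z₀) ≤ 3 * r → N (y - z₀) ≤ 3 * r → N (F x - F y) ≤ ρ * N (x - y))
    {γ : Measure (EuclideanSpace ℝ (Fin d))} (hk : Measurable (Function.uncurry k))
    (hγ : ∀ x (f : EuclideanSpace ℝ (Fin d) → ℝ≥0∞), Measurable f →
      ∫⁻ y, k x y * f y = ∫⁻ w, f (F x + w) ∂γ)
    (hhar : ∀ x x' y, N (x - z₀) ≤ 3 * r → N (x' - z₀) ≤ 3 * r → N (y - z₀) ≤ r →
      k x y ≤ ENNReal.ofReal (Real.exp (K' * N (x - x'))) * k x' y)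
    {f : EuclideanSpace ℝ (Fin d) → ℝ≥0∞} (hf : Measurable f) (m : ℕ) :
    ∀ x x', N (x - z₀) ≤ r → N (x' - z₀) ≤ 3 * r → N (x - x') ≤ 2 * r →
      (stepOn k (N.closedBall z₀ r))^[m + 1] f x ≤
        ENNReal.ofReal (Real.exp (K' * (ρ ^ m * N (x - x')))) *
          (stepOn k (N.closedBall z₀ (3 * r)))^[m + 1] f x' := by
  have hm1 := measurableSet_seminorm_closedBall (z₀ := z₀) hN r
  have hm3 := measurableSet_seminorm_closedBall (z₀ := z₀) hN (3 * r)
  have hsub : N.closedBall z₀ r ⊆ N.closedBall z₀ (3 * r) := by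
    intro y hy
    rw [Seminorm.mem_closedBall] at hy ⊢
    linarith
  have hrep : ∀ (A : Set (EuclideanSpace ℝ (Fin d))) (g : EuclideanSpace ℝ (Fin d) → ℝ≥0∞) (x),
      MeasurableSet A → Measurable g →
      stepOn k A g x = ∫⁻ w, A.indicator g (F x + w) ∂γ := by
    intro A g x hA hg
    rw [← hγ x _ (hg.indicator hA), ← Set.univ_inter A, ← stepOn_indicator hA, stepOn,
      Measure.restrict_univ, Set.univ_inter]
  induction m with
  -- The last step: both copies jump to the same point `y`, and the comparison of densities at that
  -- moment is the whole cost of merging.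
  | zero =>
    intro x x' hx hx' _
    simp only [zero_add, Function.iterate_one, pow_zero, one_mul]
    have hfm : Measurable fun y => k x' y * f y := (measurable_kernel_left hk x').mul hf
    calc stepOn k (N.closedBall z₀ r) f x
        ≤ ∫⁻ y in N.closedBall z₀ r,
          ENNReal.ofReal (Real.exp (K' * N (x - x'))) * (k x' y * f y) := by
          refine setLIntegral_mono' hm1 fun y hy => ?_
          rw [← mul_assoc]
          gcongr
          exact hhar x x' y (by linarith) hx' ((Seminorm.mem_closedBall N).1 hy)
      _ = ENNReal.ofReal (Real.exp (K' * N (x - x'))) * stepOn k (N.closedBall z₀ r) f x' := by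
          rw [lintegral_const_mul _ hfm]; rfl
      _ ≤ _ := by
          gcongr
          exact stepOn_mono_set hsub
  | succ m ih =>
    intro x x' hx hx' hxx'
    rw [Function.iterate_succ_apply', Function.iterate_succ_apply' (stepOn k (N.closedBall z₀ (3 * r))),
      hrep _ _ _ hm1 (measurable_stepOn_iterate hk hf _),
      hrep _ _ _ hm3 (measurable_stepOn_iterate hk hf _), ← lintegral_const_mul']
    swap
    · exact ENNReal.ofReal_ne_top
    refine lintegral_mono fun w => ?_
    -- Common noise cancels in the difference of the copies, which contracts by `ρ`. If the first
    -- copy stays within radius `r`, the second, at distance at most `2 r`, stays within `3 r`. This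
    -- explains the two different balls.
    by_cases hw : F x + w ∈ N.closedBall z₀ r
    · have hw' := (Seminorm.mem_closedBall N).1 hw
      have e : F x + w - (F x' + w) = F x - F x' := by abel
      have h1 : N (F x + w - (F x' + w)) ≤ ρ * N (x - x') := by
        rw [e]; exact hF x x' (by linarith) hx'
      have h0 : 0 ≤ N (x - x') := apply_nonneg N _
      have h2 : N (F x + w - (F x' + w)) ≤ 2 * r := by nlinarith
      have h3 : N (F x' + w - z₀) ≤ 3 * r := by
        have h4 : F x' + w - z₀ = (F x + w - z₀) - (F x + w - (F x' + w)) := by abel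
        rw [h4]
        have := map_sub_le_add N (F x + w - z₀) (F x + w - (F x' + w))
        linarith
      rw [Set.indicator_of_mem hw, Set.indicator_of_mem ((Seminorm.mem_closedBall N).2 h3)]
      refine (ih _ _ hw' h3 h2).trans (mul_le_mul' (ENNReal.ofReal_le_ofReal
        (Real.exp_le_exp.2 (mul_le_mul_of_nonneg_left ?_ hK'))) le_rfl)
      have : ρ ^ m * N (F x + w - (F x' + w)) ≤ ρ ^ m * (ρ * N (x - x')) := by gcongr
      rw [pow_succ, mul_assoc]
      exact this
    · rw [Set.indicator_of_notMem hw]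
      exact zero_le

/-- Radii of the balls that contain the chain started in a ball of radius `s`, as long as the noise
is bounded by `ε`. -/
def radius (ρ ε : ℝ) (j : ℕ) (s : ℝ) : ℝ := (fun t => ρ * t + ε)^[j] s

lemma radius_succ (ρ ε : ℝ) (j : ℕ) (s : ℝ) : radius ρ ε (j + 1) s = radius ρ ε j (ρ * s + ε) :=
  rfl

lemma radius_eq {ρ : ℝ} (hρ : ρ < 1) (ε : ℝ) (j : ℕ) (s : ℝ) :
    radius ρ ε j s = ρ ^ j * (s - ε / (1 - ρ)) + ε / (1 - ρ) := by
  induction j generalizing s with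
  | zero => simp [radius]
  | succ j ih =>
    have : (1 - ρ) ≠ 0 := by linarith
    rw [radius_succ, ih, pow_succ]
    field_simp
    ring

/-- The radii converge to the fixed point `ε / (1 - ρ)` of `t ↦ ρ t + ε`. -/
lemma exists_radius_le {ρ ε r : ℝ} (hρ0 : 0 < ρ) (hρ : ρ < 1) (hr : ε / (1 - ρ) < r) (s : ℝ) :
    ∃ j, radius ρ ε j s ≤ r := by
  have h : Tendsto (fun j => radius ρ ε j s) atTop (𝓝 (ε / (1 - ρ))) := by
    simp_rw [radius_eq hρ]
    have := ((tendsto_pow_atTop_nhds_zero_of_lt_one hρ0.le hρ).mul_const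
      (s - ε / (1 - ρ))).add_const (ε / (1 - ρ))
    simpa using this
  obtain ⟨j, hj⟩ := (h.eventually (gt_mem_nhds hr)).exists
  exact ⟨j, hj.le⟩

/-- The chain started in a ball reaches a smaller ball with probability close to one. -/
lemma pow_le_iterate_reach {C ρ ε R : ℝ} (hN : ∀ v, N v ≤ C * ‖v‖)
    (hR : ρ * R + ε ≤ R) (hρ0 : 0 ≤ ρ)
    (hk : Measurable (Function.uncurry k)) {A : Set (EuclideanSpace ℝ (Fin d))}
    (hA : MeasurableSet A) {q : ℝ≥0∞}
    (hq : ∀ s ≤ R, ∀ z, N (z - z₀) ≤ s →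
      q ≤ stepOn k (A ∩ N.closedBall z₀ (ρ * s + ε)) (fun _ => 1) z) (j : ℕ) :
    ∀ s ≤ R, ∀ z, N (z - z₀) ≤ s →
      q ^ j ≤ (stepOn k A)^[j] ((N.closedBall z₀ (radius ρ ε j s)).indicator fun _ => 1) z := by
  induction j with
  | zero =>
    intro s hs z hz
    simp only [pow_zero, Function.iterate_zero, id, radius]
    rw [Set.indicator_of_mem ((Seminorm.mem_closedBall N).2 hz)]
  | succ j ih =>
    intro s hs z hz
    rw [Function.iterate_succ_apply', radius_succ, pow_succ]
    have hs' : ρ * s + ε ≤ R := by nlinarith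
    have hm := measurableSet_seminorm_closedBall (z₀ := z₀) hN (ρ * s + ε)
    calc q ^ j * q ≤ q ^ j * stepOn k (A ∩ N.closedBall z₀ (ρ * s + ε)) (fun _ => 1) z := by
          gcongr; exact hq s hs z hz
      _ ≤ stepOn k (A ∩ N.closedBall z₀ (ρ * s + ε)) ((stepOn k A)^[j]
          ((N.closedBall z₀ (radius ρ ε j (ρ * s + ε))).indicator fun _ => 1)) z := by
          refine const_le_stepOn (hA.inter hm) hk (fun w hw => ?_) z
          exact ih _ hs' w ((Seminorm.mem_closedBall N).1 hw.2)
      _ ≤ _ := stepOn_mono_set Set.inter_subset_left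

end Local

/-- Used with `F` a supremum that reappears in its own error term. Finiteness of `F`, ensured by the
a priori bounds, is essential, since `∞` satisfies the hypothesis trivially. -/
lemma le_of_absorb {F G : ℝ≥0∞} (hF : F ≠ ∞) {α β e L : ℝ} (hα : 0 ≤ α) (hβ : 0 ≤ β) (he : 0 ≤ e)
    (hL : 0 ≤ L) (hαβ : β < α) (heL : e ≤ L * (α - β))
    (h : ENNReal.ofReal α * F ≤ ENNReal.ofReal e * G + ENNReal.ofReal β * F) :
    F ≤ ENNReal.ofReal L * G := by
  rcases eq_or_ne G ∞ with rfl | hG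
  · rcases hL.eq_or_lt with rfl | hL'
    · have he0 : e = 0 := by linarith
      subst he0
      simp only [ENNReal.ofReal_zero, zero_mul, zero_add] at h ⊢
      rw [nonpos_iff_eq_zero]
      by_contra hne
      have := (ENNReal.mul_le_mul_iff_left hne hF).1 h
      rw [ENNReal.ofReal_le_ofReal_iff hβ] at this
      linarith
    · rw [ENNReal.mul_top (by simpa using hL')]
      exact le_top
  · lift F to NNReal using hF
    lift G to NNReal using hG
    rw [← ENNReal.ofReal_coe_nnreal, ← ENNReal.ofReal_coe_nnreal,
      ← ENNReal.ofReal_mul hα, ← ENNReal.ofReal_mul he, ← ENNReal.ofReal_mul hβ,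
      ← ENNReal.ofReal_add (by positivity) (by positivity),
      ENNReal.ofReal_le_ofReal_iff (by positivity)] at h
    rw [← ENNReal.ofReal_coe_nnreal, ← ENNReal.ofReal_coe_nnreal, ← ENNReal.ofReal_mul hL,
      ENNReal.ofReal_le_ofReal_iff (by positivity)]
    have hG0 : (0 : ℝ) ≤ G := G.2
    have h1 : (α - β) * F ≤ e * G := by linarith
    have h2 : (α - β) * F ≤ (α - β) * (L * G) := by nlinarith
    exact le_of_mul_le_mul_left h2 (by linarith)

/-! ### Survival probabilities of the trace process in `B`. -/

section TraceMass

variable {d : ℕ} {k : EuclideanSpace ℝ (Fin d) → EuclideanSpace ℝ (Fin d) → ℝ≥0∞}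
  {M B U U' V : Set (EuclideanSpace ℝ (Fin d))}

/-- Superharmonicity of `Q g` for the chain killed outside `Mᶜ ∪ B`. -/
lemma stepOn_traceDensity_ge (hk : Measurable (Function.uncurry k)) (hB : MeasurableSet B)
    (hBM : B ⊆ M) {A : Set (EuclideanSpace ℝ (Fin d))} (hA : A ⊆ Mᶜ ∪ B)
    {f g : EuclideanSpace ℝ (Fin d) → ℝ≥0∞} (hg : Measurable g)
    (hfQ : ∀ z, f z ≤ stepOn (traceDensity k M) B g z) (hfg : ∀ z ∈ B, f z ≤ g z)
    (x : EuclideanSpace ℝ (Fin d)) :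
    stepOn k A f x ≤ stepOn (traceDensity k M) B g x := by
  rw [stepOn_traceDensity hk hg]
  calc stepOn k A f x ≤ stepOn k (Mᶜ ∪ B) f x := stepOn_mono_set hA
    _ = stepOn k Mᶜ f x + stepOn k B f x :=
        stepOn_union hB (Set.disjoint_compl_left_iff_subset.2 hBM) x
    _ ≤ _ := by
      gcongr
      · exact stepOn_mono hfQ x
      · exact stepOn_mono_of_mem hB hfg x

/-- A step of the chain outside `M` leaves the trace where it was, one into `B` completes a step of
the trace. So `f` has to dominate the value before that trace step on `Mᶜ` and the value after it on
`B`. -/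
lemma stepOn_traceDensity_le (hk : Measurable (Function.uncurry k)) (hM : MeasurableSet M)
    (hB : MeasurableSet B) (hBM : B ⊆ M)
    {f g : EuclideanSpace ℝ (Fin d) → ℝ≥0∞} (hg : Measurable g)
    (hfQ : ∀ z ∈ Mᶜ, stepOn (traceDensity k M) B g z ≤ f z) (hfg : ∀ z ∈ B, g z ≤ f z)
    (x : EuclideanSpace ℝ (Fin d)) :
    stepOn (traceDensity k M) B g x ≤ stepOn k Set.univ f x := by
  rw [stepOn_traceDensity hk hg]
  calc _ ≤ stepOn k Mᶜ f x + stepOn k B f x := by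
        gcongr
        · exact stepOn_mono_of_mem hM.compl hfQ x
        · exact stepOn_mono_of_mem hB hfg x
    _ = stepOn k (Mᶜ ∪ B) f x :=
        (stepOn_union hB (Set.disjoint_compl_left_iff_subset.2 hBM) x).symm
    _ ≤ _ := stepOn_mono_set (Set.subset_univ _)

/-- If the chain started near the fixed point hits `B` much more easily than it leaves `U`, the
trace process on `M` is very unlikely to leave `B`. -/
lemma one_sub_le_trace_mass (hk : Measurable (Function.uncurry k)) (hk1 : ∀ x, ∫⁻ y, k x y = 1)
    (hB : MeasurableSet B) (hBM : B ⊆ M) (hU : MeasurableSet U) (hV : MeasurableSet V)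
    (hBU : B ⊆ U) (hUM : U ⊆ Mᶜ ∪ B) {p b η : ℝ≥0∞} {m : ℕ}
    (hp : ∀ z ∈ U, stepOn k Uᶜ (fun _ => 1) z ≤ p)
    (hb : ∀ z ∈ V, b ≤ stepOn k B (fun _ => 1) z) (hb0 : b ≠ 0) (hbt : b ≠ ∞)
    (hreach : ∀ z ∈ U, 2⁻¹ ≤ (stepOn k U)^[m] (V.indicator fun _ => 1) z)
    (hη : 2 * ((m + 1) * p) ≤ η * b) :
    ∀ z ∈ U, 1 - η ≤ stepOn (traceDensity k M) B (fun _ => 1) z := by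
  intro z₁ hz₁
  set u := stepOn (traceDensity k M) B (fun _ => 1) with hu
  have hu1 : ∀ z, u z ≤ 1 := stepOn_traceDensity_one_le hk hk1 hB hBM
  set a := ⨅ z ∈ U, u z with ha
  have ha1 : a ≤ 1 := (iInf₂_le z₁ hz₁).trans (hu1 z₁)
  have hau : ∀ z ∈ U, a ≤ u z := fun z hz => iInf₂_le z hz
  have hsup : ∀ z ∈ U, 1 - p ≤ stepOn k U (fun _ => 1) z := fun z hz =>
    one_sub_le_stepOn hk1 hU (hp z hz)
  -- Here `u` is the probability that the first return to `M` is in `B`. A direct hit of `B`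
  -- replaces the level `a` by the value one, which on `V` happens with probability at least `b`, so
  -- the gain is `b * (1 - a)`. The resulting bound on it shows that `1 - a` is at most `η`.
  have key := supersolution_gain hk hU le_rfl hV (u := u) (a := a) (c := b * (1 - a)) (p := p)
    (m := m) (ha1.trans_lt ENNReal.one_lt_top).ne (fun b hb => le_iInf₂ hb)
    (fun z _ => stepOn_traceDensity_ge hk hB hBM hUM measurable_const (fun _ => le_rfl)
      (fun z _ => hu1 z) z)
    (fun z hz => by
      have h1 : stepOn k U (fun _ => 1) z =
          stepOn k B (fun _ => 1) z + stepOn k (U \ B) (fun _ => 1) z := by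
        rw [← stepOn_union (hU.diff hB) Set.disjoint_sdiff_right, Set.union_sdiff_cancel hBU]
      have h2 : stepOn k B (fun _ => 1) z + a * stepOn k (U \ B) (fun _ => 1) z ≤ u z := by
        rw [hu, stepOn_traceDensity hk measurable_const, ← hu, add_comm]
        gcongr
        refine (const_le_stepOn (hU.diff hB) hk (fun w hw => hau w hw.1) z).trans
          (stepOn_mono_set ?_)
        intro w hw
        exact (hUM hw.1).resolve_right hw.2
      refine le_trans ?_ h2
      have h3 : b * (1 - a) * V.indicator (fun _ => 1) z ≤
          stepOn k B (fun _ => 1) z * (1 - a) := by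
        by_cases hzV : z ∈ V
        · rw [Set.indicator_of_mem hzV, mul_one]
          gcongr
          exact hb z hzV
        · rw [Set.indicator_of_notMem hzV, mul_zero]
          exact zero_le
      calc (1 - p) * a + b * (1 - a) * V.indicator (fun _ => 1) z
          ≤ (stepOn k B (fun _ => 1) z + stepOn k (U \ B) (fun _ => 1) z) * a +
            stepOn k B (fun _ => 1) z * (1 - a) := by
            gcongr
            rw [← h1]
            exact hsup z hz
        _ = stepOn k B (fun _ => 1) z * (a + (1 - a)) +
            a * stepOn k (U \ B) (fun _ => 1) z := by ring
        _ = _ := by rw [add_tsub_cancel_of_le ha1, mul_one])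
    hsup hreach
  have h4 : (1 - a) * b ≤ η * b := by
    calc (1 - a) * b = b * (1 - a) := mul_comm _ _
      _ ≤ 2 * ((m + 1) * p * a) := key
      _ ≤ 2 * ((m + 1) * p * 1) := by gcongr
      _ = 2 * ((m + 1) * p) := by rw [mul_one]
      _ ≤ _ := hη
  have h5 : 1 - a ≤ η := (ENNReal.mul_le_mul_iff_left hb0 hbt).1 h4
  have h6 : 1 - η ≤ a := by
    rw [tsub_le_iff_right] at h5 ⊢
    rwa [add_comm]
  exact h6.trans (hau z₁ hz₁)

lemma trace_iterate_one_antitone (hk : Measurable (Function.uncurry k))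
    (hk1 : ∀ x, ∫⁻ y, k x y = 1) (hB : MeasurableSet B) (hBM : B ⊆ M) :
    Antitone fun n => (stepOn (traceDensity k M) B)^[n] (fun _ => 1) := by
  refine antitone_nat_of_succ_le fun n => ?_
  rw [Function.iterate_succ_apply]
  exact stepOn_iterate_mono (fun z => stepOn_traceDensity_one_le hk hk1 hB hBM z) n

/-- The probabilities that the trace process stays in `B` for a long time are comparable. -/
lemma trace_iterate_one_comparison (hk : Measurable (Function.uncurry k))
    (hk1 : ∀ x, ∫⁻ y, k x y = 1) (hM : MeasurableSet M)
    (hB : MeasurableSet B) (hBM : B ⊆ M) (hU : MeasurableSet U) (hU' : MeasurableSet U')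
    (hBU : B ⊆ U) (hUM : U' ⊆ Mᶜ ∪ B) (hUU' : U ⊆ U') {p η e : ℝ≥0∞} {m : ℕ}
    (hp : ∀ z ∈ U, stepOn k Uᶜ (fun _ => 1) z ≤ p)
    (hη : ∀ z ∈ B, 1 - η ≤ stepOn (traceDensity k M) B (fun _ => 1) z)
    (hcoup : ∀ f : EuclideanSpace ℝ (Fin d) → ℝ≥0∞, Measurable f → ∀ x ∈ U, ∀ x' ∈ U,
      (stepOn k U)^[m] f x ≤ e * (stepOn k U')^[m] f x')
    (he : e ≤ ENNReal.ofReal (101 / 100)) (hmp : m * p ≤ ENNReal.ofReal (1 / 100))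
    (hmη : (m + 1) * η ≤ ENNReal.ofReal (1 / 100)) {n : ℕ} (hn : m + 1 ≤ n) :
    ∀ x ∈ B, ∀ x' ∈ B, (stepOn (traceDensity k M) B)^[n] (fun _ => 1) x ≤
      ENNReal.ofReal (11 / 10) * (stepOn (traceDensity k M) B)^[n] (fun _ => 1) x' := by
  set Q := stepOn (traceDensity k M) B with hQ
  set q : ℕ → EuclideanSpace ℝ (Fin d) → ℝ≥0∞ := fun n => Q^[n] (fun _ => 1) with hq
  have hkt := measurable_traceDensity (M := M) hk
  have hqm : ∀ n, Measurable (q n) := fun n => measurable_stepOn_iterate hkt measurable_const n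
  have hanti : Antitone q := trace_iterate_one_antitone hk hk1 hB hBM
  have hq0 : ∀ z, q 0 z = 1 := fun z => rfl
  have hq1 : ∀ n z, q n z ≤ 1 := fun n z => (hanti (Nat.zero_le n) z).trans (hq0 z).le
  have hsucc : ∀ n, q (n + 1) = Q (q n) := fun n => Function.iterate_succ_apply' _ _ _
  set Fs : ℕ → ℝ≥0∞ := fun n => ⨆ z ∈ B, q n z with hFs
  have hFle : ∀ n, ∀ z ∈ B, q n z ≤ Fs n := fun n z hz => le_iSup₂ (f := fun z _ => q n z) z hz
  have hF1 : ∀ n, Fs n ≤ 1 := fun n => iSup₂_le fun z _ => hq1 n z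
  have hglob : ∀ n z, q (n + 1) z ≤ Fs n := by
    intro n z
    rw [hsucc]
    calc Q (q n) z ≤ Fs n * stepOn (traceDensity k M) B (fun _ => 1) z :=
          stepOn_le_const hB hkt (hFle n) z
      _ ≤ Fs n * 1 := by gcongr; exact stepOn_traceDensity_one_le hk hk1 hB hBM z
      _ = _ := mul_one _
  -- For `n = 0` the start has to lie in `B`: from elsewhere the return to `B` is not known to be
  -- likely. For `n ≥ 1` the surviving trace is in `B` after its first step.
  have hlow : ∀ j n z, (1 ≤ n ∨ z ∈ B) → (1 - η) ^ j * q n z ≤ q (n + j) z := by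
    have hBj : ∀ j, ∀ z ∈ B, (1 - η) ^ j ≤ q j z := pow_le_iterate_stepOn_one hkt hB hη
    intro j n
    induction n with
    | zero =>
      intro z hz
      rcases hz with hz | hz
      · omega
      · rw [hq0, mul_one, zero_add]; exact hBj j z hz
    | succ n ih =>
      intro z _
      have e1 : n + 1 + j = (n + j) + 1 := by ring
      rw [e1, hsucc, hsucc, ← stepOn_const_mul hkt (hqm n)]
      exact stepOn_mono_of_mem hB (fun w hw => ih w (Or.inr hw)) z
  -- The extra trace step makes `q (n₁ + 1)` bounded everywhere by a supremum over `B`.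
  obtain ⟨n₁, hn₁⟩ : ∃ n₁, n = (n₁ + 1) + m := ⟨n - m - 1, by omega⟩
  -- Each step of the chain completes at most one step of the trace. As `q` decreases in the number
  -- of steps left, counting every chain step as a trace step bounds from above, and counting none
  -- bounds from below in `hdown`. The discrepancy of at most `m` trace steps costs only `(1 - η) ^
  -- m`, through `hlow`.
  have hup : ∀ z ∈ U, q (n₁ + 1 + m) z ≤ (stepOn k U)^[m] (q (n₁ + 1)) z + m * (p * Fs n₁) := by
    refine le_iterate_stepOn_add hk hk1 hU (u := fun j => q (n₁ + 1 + j))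
      (fun j => hqm _) (e := p * Fs n₁) (fun j z hz => ?_) m
    have h1 : q (n₁ + 1 + (j + 1)) z ≤ stepOn k Set.univ (q (n₁ + 1 + j)) z := by
      rw [← add_assoc, hsucc]
      refine stepOn_traceDensity_le hk hM hB hBM (hqm _) (fun w _ => ?_) (fun w _ => le_rfl) z
      rw [← hQ, ← hsucc]
      exact hanti (Nat.le_succ _) w
    refine h1.trans (stepOn_univ_le_add hk hU (hp z hz) fun w _ => ?_)
    exact (hanti (by omega : n₁ + 1 ≤ n₁ + 1 + j) w).trans (hglob n₁ w)
  have hdown : ∀ z ∈ U', (stepOn k U')^[m] (q (n₁ + 1 + m)) z ≤ q (n₁ + 1 + m) z := by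
    intro z hz
    have := iterate_stepOn_le_add hk hk1 hU' (u := fun _ => q (n₁ + 1 + m)) (fun _ => hqm _)
      (e := 0) (fun j w _ => ?_) m z hz
    · simpa using this
    · rw [add_zero]
      have e1 : n₁ + 1 + m = (n₁ + m) + 1 := by ring
      rw [e1]
      nth_rewrite 2 [hsucc]
      exact stepOn_traceDensity_ge hk hB hBM hUM (hqm _) (fun z => by rw [← hQ, ← hsucc])
        (fun z _ => hanti (Nat.le_succ _) z) w
  set α := (1 - η) ^ (m + 1) with hα
  have hα' : ENNReal.ofReal (99 / 100) ≤ α := by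
    have h1 := one_le_one_sub_pow_add η (m + 1)
    have h2 : (1 : ℝ≥0∞) ≤ α + ENNReal.ofReal (1 / 100) := by
      refine h1.trans ?_
      push_cast
      gcongr
    have h3 : (1 : ℝ≥0∞) = ENNReal.ofReal (99 / 100) + ENNReal.ofReal (1 / 100) := by
      rw [← ENNReal.ofReal_add (by norm_num) (by norm_num)]; norm_num
    rw [h3] at h2
    exact (ENNReal.add_le_add_iff_right ENNReal.ofReal_ne_top).1 h2
  intro x hx x' hx'
  have hFn : ENNReal.ofReal (99 / 100) * Fs n ≤
      ENNReal.ofReal (101 / 100) * q n x' + ENNReal.ofReal (1 / 100) * Fs n := by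
    have eF : ENNReal.ofReal (99 / 100) * Fs n =
        ⨆ z ∈ B, ENNReal.ofReal (99 / 100) * q n z := by
      simp only [hFs, ENNReal.mul_iSup]
    rw [eF]
    refine iSup₂_le fun w hw => ?_
    have hFn₁ : α * Fs n₁ ≤ Fs n := by
      rw [hFs]
      simp only [ENNReal.mul_iSup]
      refine iSup₂_le fun v hv => ?_
      refine (hlow (m + 1) n₁ v (Or.inr hv)).trans ?_
      have : n₁ + (m + 1) = n := by omega
      rw [this]
      exact hFle n v hv
    have hαm : α ≤ (1 - η) ^ m := by
      rw [hα, pow_succ]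
      exact mul_le_of_le_one_right zero_le tsub_le_self
    calc ENNReal.ofReal (99 / 100) * q n w ≤ α * q n w := by gcongr
      _ ≤ α * ((stepOn k U)^[m] (q (n₁ + 1)) w + m * (p * Fs n₁)) := by
          gcongr
          rw [hn₁]
          exact hup w (hBU hw)
      _ ≤ α * (e * (stepOn k U')^[m] (q (n₁ + 1)) x' + m * (p * Fs n₁)) := by
          gcongr
          exact hcoup _ (hqm _) w (hBU hw) x' (hBU hx')
      _ = e * (α * (stepOn k U')^[m] (q (n₁ + 1)) x') + m * p * (α * Fs n₁) := by ring
      _ ≤ ENNReal.ofReal (101 / 100) * q n x' + ENNReal.ofReal (1 / 100) * Fs n := by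
          gcongr
          · rw [← stepOn_iterate_const_mul hk (hqm _)]
            rw [hn₁]
            refine le_trans (stepOn_iterate_mono (fun z => ?_) m x') (hdown x' (hUU' (hBU hx')))
            refine le_trans ?_ (hlow m (n₁ + 1) z (Or.inl (by omega)))
            gcongr
  have hfin : Fs n ≠ ∞ := ((hF1 n).trans_lt ENNReal.one_lt_top).ne
  exact (hFle n x hx).trans (le_of_absorb hfin (by norm_num) (by norm_num) (by norm_num)
    (by norm_num) (by norm_num) (by norm_num) hFn)

end TraceMass

/-! ### Contraction of ratios by positive kernels -/

section Hopf

variable {d : ℕ} {k : EuclideanSpace ℝ (Fin d) → EuclideanSpace ℝ (Fin d) → ℝ≥0∞}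
  {B : Set (EuclideanSpace ℝ (Fin d))}

lemma mul_add_mul_le_of_le {a b u v : ℝ≥0∞} (hab : a ≤ b) (huv : u ≤ v) :
    b * u + a * v ≤ b * v + a * u := by
  obtain ⟨s, rfl⟩ := exists_add_of_le hab
  obtain ⟨t, rfl⟩ := exists_add_of_le huv
  calc (a + s) * u + a * (u + t) ≤ ((a + s) * u + a * (u + t)) + s * t := le_self_add
    _ = _ := by ring

/-- The integral of `(k x y - c) * (g y - f y)` is nonnegative. It is expanded to avoid subtraction
of possibly infinite values. -/
lemma stepOn_rearrangement (hk : Measurable (Function.uncurry k)) (hB : MeasurableSet B)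
    {c : ℝ≥0∞} {f g : EuclideanSpace ℝ (Fin d) → ℝ≥0∞} (hf : Measurable f) (hg : Measurable g)
    {x : EuclideanSpace ℝ (Fin d)} (hc : ∀ y ∈ B, c ≤ k x y) (hfg : ∀ y ∈ B, f y ≤ g y) :
    stepOn k B f x + c * ∫⁻ y in B, g y ≤ stepOn k B g x + c * ∫⁻ y in B, f y := by
  have hkx := measurable_kernel_left hk x
  have m1 : Measurable fun y => k x y * f y := hkx.mul hf
  have m2 : Measurable fun y => k x y * g y := hkx.mul hg
  rw [← lintegral_const_mul _ hf, ← lintegral_const_mul _ hg, stepOn, stepOn,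
    ← lintegral_add_left m1, ← lintegral_add_left m2]
  exact setLIntegral_mono' hB fun y hy => mul_add_mul_le_of_le (hc y hy) (hfg y hy)

/-- One step of the contraction of the ratio of two functions under a positive kernel. -/
lemma hopf_step (hk : Measurable (Function.uncurry k)) (hB : MeasurableSet B) {c₁ c₂ : ℝ}
    (hc₁ : 0 < c₁) (hc₂ : c₁ ≤ c₂) (hk₁ : ∀ x ∈ B, ∀ y ∈ B, ENNReal.ofReal c₁ ≤ k x y)
    (hk₂ : ∀ x ∈ B, ∀ y ∈ B, k x y ≤ ENNReal.ofReal c₂)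
    {h q : EuclideanSpace ℝ (Fin d) → ℝ≥0∞} (hh : Measurable h) (hq : Measurable q)
    (hG0 : ∫⁻ y in B, q y ≠ 0) (hGt : ∫⁻ y in B, q y ≠ ∞) {m M : ℝ} (hm : 0 ≤ m) (hM : 0 ≤ M)
    (hl : ∀ y ∈ B, ENNReal.ofReal m * q y ≤ h y) (hu : ∀ y ∈ B, h y ≤ ENNReal.ofReal M * q y) :
    ∃ m' M' : ℝ, m ≤ m' ∧ 0 ≤ M' ∧ M' - m' = (1 - c₁ / c₂) * (M - m) ∧
      (∀ x ∈ B, ENNReal.ofReal m' * stepOn k B q x ≤ stepOn k B h x) ∧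
      ∀ x ∈ B, stepOn k B h x ≤ ENNReal.ofReal M' * stepOn k B q x := by
  have hc₂' : 0 < c₂ := hc₁.trans_le hc₂
  set G := (∫⁻ y in B, q y).toReal with hG
  set H := (∫⁻ y in B, h y).toReal with hH
  have hHt : ∫⁻ y in B, h y ≠ ∞ := by
    refine ne_top_of_le_ne_top (ENNReal.mul_ne_top ENNReal.ofReal_ne_top hGt)
      (b := ENNReal.ofReal M * ∫⁻ y in B, q y) ?_
    rw [← lintegral_const_mul _ hq]
    exact setLIntegral_mono' hB hu
  have hGpos : 0 < G := ENNReal.toReal_pos hG0 hGt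
  have hGe : ∫⁻ y in B, q y = ENNReal.ofReal G := (ENNReal.ofReal_toReal hGt).symm
  have hHe : ∫⁻ y in B, h y = ENNReal.ofReal H := (ENNReal.ofReal_toReal hHt).symm
  have hH0 : 0 ≤ H := ENNReal.toReal_nonneg
  have hmG : m * G ≤ H := by
    have : ENNReal.ofReal m * ∫⁻ y in B, q y ≤ ∫⁻ y in B, h y := by
      rw [← lintegral_const_mul _ hq]
      exact setLIntegral_mono' hB hl
    rwa [hGe, hHe, ← ENNReal.ofReal_mul hm, ENNReal.ofReal_le_ofReal_iff hH0] at this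
  have hMG : H ≤ M * G := by
    have : ∫⁻ y in B, h y ≤ ENNReal.ofReal M * ∫⁻ y in B, q y := by
      rw [← lintegral_const_mul _ hq]
      exact setLIntegral_mono' hB hu
    rwa [hGe, hHe, ← ENNReal.ofReal_mul hM, ENNReal.ofReal_le_ofReal_iff (by positivity)] at this
  have hQle : ∀ f : EuclideanSpace ℝ (Fin d) → ℝ≥0∞, Measurable f → ∀ x ∈ B,
      stepOn k B f x ≤ ENNReal.ofReal c₂ * ∫⁻ y in B, f y := by
    intro f hf x hx
    rw [← lintegral_const_mul _ hf]
    exact setLIntegral_mono' hB fun y hy => by gcongr; exact hk₂ x hx y hy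
  have key : ∀ x ∈ B, ∃ X Y : ℝ, 0 ≤ X ∧ 0 ≤ Y ∧ stepOn k B h x = ENNReal.ofReal X ∧
      stepOn k B q x = ENNReal.ofReal Y ∧ Y ≤ c₂ * G ∧ m * Y + c₁ * H ≤ X + c₁ * (m * G) ∧
      X + c₁ * (M * G) ≤ M * Y + c₁ * H := by
    intro x hx
    have hXt : stepOn k B h x ≠ ∞ := ne_top_of_le_ne_top
      (ENNReal.mul_ne_top ENNReal.ofReal_ne_top hHt) (hQle h hh x hx)
    have hYt : stepOn k B q x ≠ ∞ := ne_top_of_le_ne_top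
      (ENNReal.mul_ne_top ENNReal.ofReal_ne_top hGt) (hQle q hq x hx)
    have hXe := (ENNReal.ofReal_toReal hXt).symm
    have hYe := (ENNReal.ofReal_toReal hYt).symm
    have hX0 : 0 ≤ (stepOn k B h x).toReal := ENNReal.toReal_nonneg
    have hY0 : 0 ≤ (stepOn k B q x).toReal := ENNReal.toReal_nonneg
    refine ⟨_, _, hX0, hY0, hXe, hYe, ?_, ?_, ?_⟩
    · have := hQle q hq x hx
      rwa [hYe, hGe, ← ENNReal.ofReal_mul hc₂'.le,
        ENNReal.ofReal_le_ofReal_iff (by positivity)] at this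
    · have := stepOn_rearrangement hk hB (hq.const_mul (ENNReal.ofReal m)) hh (hk₁ x hx) hl
      rw [stepOn_const_mul hk hq, lintegral_const_mul _ hq, hXe, hYe, hGe, hHe,
        ← ENNReal.ofReal_mul hm, ← ENNReal.ofReal_mul hm, ← ENNReal.ofReal_mul hc₁.le,
        ← ENNReal.ofReal_mul hc₁.le, ← ENNReal.ofReal_add (by positivity) (by positivity),
        ← ENNReal.ofReal_add (by positivity) (by positivity),
        ENNReal.ofReal_le_ofReal_iff (by positivity)] at this
      exact this
    · have := stepOn_rearrangement hk hB hh (hq.const_mul (ENNReal.ofReal M)) (hk₁ x hx) hu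
      rw [stepOn_const_mul hk hq, lintegral_const_mul _ hq, hXe, hYe, hGe, hHe,
        ← ENNReal.ofReal_mul hM, ← ENNReal.ofReal_mul hM, ← ENNReal.ofReal_mul hc₁.le,
        ← ENNReal.ofReal_mul hc₁.le, ← ENNReal.ofReal_add (by positivity) (by positivity),
        ← ENNReal.ofReal_add (by positivity) (by positivity),
        ENNReal.ofReal_le_ofReal_iff (by positivity)] at this
      exact this
  -- The nonnegative functions `h - m q` and `M q - h` are mapped to functions of size at least `c₁`
  -- times their integrals, while the image of `q` is at most `c₂ * G`. So the lower ratio rises by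
  -- `s` and the upper one falls by `t`, and `s + t` is the fraction `c₁ / c₂` of the gap, wherever
  -- `H` lies between `m * G` and `M * G`.
  set s := c₁ * (H - m * G) / (c₂ * G) with hs
  set t := c₁ * (M * G - H) / (c₂ * G) with ht
  have hs0 : 0 ≤ s := div_nonneg (mul_nonneg hc₁.le (by linarith)) (by positivity)
  have ht0 : 0 ≤ t := div_nonneg (mul_nonneg hc₁.le (by linarith)) (by positivity)
  have hst : s + t = c₁ / c₂ * (M - m) := by
    rw [hs, ht]; field_simp; ring
  have hsG : s * (c₂ * G) = c₁ * (H - m * G) := by rw [hs]; field_simp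
  have htG : t * (c₂ * G) = c₁ * (M * G - H) := by rw [ht]; field_simp
  have hmM : m ≤ M := by
    by_contra hlt
    push Not at hlt
    nlinarith
  have hθ : c₁ / c₂ ≤ 1 := (div_le_one hc₂').2 hc₂
  refine ⟨m + s, M - t, by linarith, ?_, by linarith, ?_, ?_⟩
  · nlinarith
  · intro x hx
    obtain ⟨X, Y, hX0, hY0, hXe, hYe, hY, h1, _⟩ := key x hx
    rw [hXe, hYe, ← ENNReal.ofReal_mul (by linarith)]
    apply ENNReal.ofReal_le_ofReal
    have : s * Y ≤ s * (c₂ * G) := by gcongr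
    nlinarith
  · intro x hx
    obtain ⟨X, Y, hX0, hY0, hXe, hYe, hY, _, h2⟩ := key x hx
    rw [hXe, hYe, ← ENNReal.ofReal_mul (by nlinarith)]
    apply ENNReal.ofReal_le_ofReal
    have : t * Y ≤ t * (c₂ * G) := by gcongr
    nlinarith

/-- The ratio of two iterates of a positive kernel becomes nearly constant, after a number of steps
which only depends on the bounds on the kernel. -/
theorem exists_hopf {c₁ c₂ : ℝ} (hc₁ : 0 < c₁) (hc₂ : c₁ ≤ c₂) : ∃ n₁ : ℕ, ∀ n ≥ n₁,
    ∀ (k : EuclideanSpace ℝ (Fin d) → EuclideanSpace ℝ (Fin d) → ℝ≥0∞)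
      (B : Set (EuclideanSpace ℝ (Fin d))) (h : EuclideanSpace ℝ (Fin d) → ℝ≥0∞),
      Measurable (Function.uncurry k) → MeasurableSet B → Measurable h →
      volume B ≠ 0 → volume B ≠ ∞ → (∀ x, stepOn k B (fun _ => 1) x ≤ 1) →
      (∀ x ∈ B, ∀ y ∈ B, ENNReal.ofReal c₁ ≤ k x y) →
      (∀ x ∈ B, ∀ y ∈ B, k x y ≤ ENNReal.ofReal c₂) →
      (∀ x ∈ B, ENNReal.ofReal c₁ ≤ h x) → (∀ x ∈ B, h x ≤ ENNReal.ofReal c₂) →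
      ∀ x ∈ B, ∀ x' ∈ B, (stepOn k B)^[n] h x * (stepOn k B)^[n] (fun _ => 1) x' ≤
        ENNReal.ofReal (11 / 10) *
          ((stepOn k B)^[n] h x' * (stepOn k B)^[n] (fun _ => 1) x) := by
  have hc₂' : 0 < c₂ := hc₁.trans_le hc₂
  have hθ0 : 0 < c₁ / c₂ := by positivity
  have hθ : c₁ / c₂ ≤ 1 := (div_le_one hc₂').2 hc₂
  have hlim := (tendsto_pow_atTop_nhds_zero_of_lt_one (r := 1 - c₁ / c₂) (by linarith)
    (by linarith)).mul_const (c₂ - c₁)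
  rw [zero_mul] at hlim
  -- The lower ratio never falls below `c₁`, so a gap below `c₁ / 10` makes the two ratios agree up
  -- to the factor 11/10.
  obtain ⟨n₁, hn₁⟩ := eventually_atTop.1
    (hlim.eventually (gt_mem_nhds (show 0 < c₁ / 10 by positivity)))
  refine ⟨n₁, fun n hn k B h hk hB hh hB0 hBt hmass hk₁ hk₂ hh₁ hh₂ => ?_⟩
  set q : ℕ → EuclideanSpace ℝ (Fin d) → ℝ≥0∞ := fun n => (stepOn k B)^[n] (fun _ => 1) with hq
  have hqm : ∀ n, Measurable (q n) := fun n => measurable_stepOn_iterate hk measurable_const n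
  have hhm : ∀ n, Measurable ((stepOn k B)^[n] h) := fun n => measurable_stepOn_iterate hk hh n
  have hq1 : ∀ n x, q n x ≤ 1 := by
    intro n
    induction n with
    | zero => intro x; exact le_rfl
    | succ n ih =>
      intro x
      simp only [hq, Function.iterate_succ_apply']
      exact (stepOn_mono ih x).trans (hmass x)
  have hqpos : ∀ n, ∀ x ∈ B, (ENNReal.ofReal c₁ * volume B) ^ n ≤ q n x := by
    refine pow_le_iterate_stepOn_one hk hB fun z hz => ?_
    rw [← setLIntegral_const, stepOn]
    simp only [mul_one]
    exact setLIntegral_mono' hB (hk₁ z hz)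
  have hc0 : ENNReal.ofReal c₁ * volume B ≠ 0 := mul_ne_zero (by simpa using hc₁) hB0
  have hG0 : ∀ n, ∫⁻ y in B, q n y ≠ 0 := by
    intro n
    have h1 : (ENNReal.ofReal c₁ * volume B) ^ n * volume B ≤ ∫⁻ y in B, q n y := by
      rw [← setLIntegral_const]
      exact setLIntegral_mono' hB (hqpos n)
    exact (lt_of_lt_of_le (pos_iff_ne_zero.2 (mul_ne_zero (pow_ne_zero _ hc0) hB0)) h1).ne'
  have hGt : ∀ n, ∫⁻ y in B, q n y ≠ ∞ := by
    intro n
    have h1 : ∫⁻ y in B, q n y ≤ 1 * volume B := by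
      rw [← setLIntegral_const]
      exact lintegral_mono (hq1 n)
    exact ne_top_of_le_ne_top (by simpa using hBt) h1
  have main : ∀ n, ∃ m M : ℝ, c₁ ≤ m ∧ 0 ≤ M ∧ M - m ≤ (1 - c₁ / c₂) ^ n * (c₂ - c₁) ∧
      (∀ x ∈ B, ENNReal.ofReal m * q n x ≤ (stepOn k B)^[n] h x) ∧
      ∀ x ∈ B, (stepOn k B)^[n] h x ≤ ENNReal.ofReal M * q n x := by
    intro n
    induction n with
    | zero =>
      refine ⟨c₁, c₂, le_rfl, hc₂'.le, by simp, fun x hx => ?_, fun x hx => ?_⟩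
      · simpa [hq] using hh₁ x hx
      · simpa [hq] using hh₂ x hx
    | succ n ih =>
      obtain ⟨m, M, hm, hM, hmM, hl, hu⟩ := ih
      obtain ⟨m', M', h1, h2, h3, h4, h5⟩ := hopf_step hk hB hc₁ hc₂ hk₁ hk₂ (hhm n) (hqm n)
        (hG0 n) (hGt n) (by linarith) hM hl hu
      refine ⟨m', M', by linarith, h2, ?_, ?_, ?_⟩
      · rw [h3, pow_succ']
        rw [mul_assoc]
        exact mul_le_mul_of_nonneg_left hmM (by linarith)
      · simpa only [hq, Function.iterate_succ_apply'] using h4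
      · simpa only [hq, Function.iterate_succ_apply'] using h5
  intro x hx x' hx'
  obtain ⟨m, M, hm, hM, hmM, hl, hu⟩ := main n
  have hMm : M ≤ 11 / 10 * m := by
    have := hn₁ n hn
    linarith
  calc (stepOn k B)^[n] h x * q n x' ≤ ENNReal.ofReal M * q n x * q n x' := by
        gcongr; exact hu x hx
    _ ≤ ENNReal.ofReal (11 / 10 * m) * q n x * q n x' := by gcongr
    _ = ENNReal.ofReal (11 / 10) * ((ENNReal.ofReal m * q n x') * q n x) := by
        rw [ENNReal.ofReal_mul (by norm_num)]; ring
    _ ≤ _ := by gcongr; exact hl x' hx'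

end Hopf

/-! ### Sets `B` of tiny volume: the trace density itself is nearly constant. -/

section SmallSet

variable {d : ℕ} {k : EuclideanSpace ℝ (Fin d) → EuclideanSpace ℝ (Fin d) → ℝ≥0∞}
  {M B U U' V : Set (EuclideanSpace ℝ (Fin d))}

/-- Away from a neighbourhood `U` of `y`, the trace density at `y` is controlled by its values
in `U`. -/
lemma traceDensity_le_add (hk : Measurable (Function.uncurry k)) (hk1 : ∀ x, ∫⁻ y, k x y = 1)
    (hM : MeasurableSet M) (hU : MeasurableSet U) {y : EuclideanSpace ℝ (Fin d)} {C' H : ℝ≥0∞}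
    (hmean : ∀ w, k w y ≤ C' * stepOn k U (fun _ => 1) w)
    (hH : ∀ z ∈ U, traceDensity k M z y ≤ H) (z : EuclideanSpace ℝ (Fin d)) :
    traceDensity k M z y ≤ C' + H := by
  set s : ℕ → EuclideanSpace ℝ (Fin d) → ℝ≥0∞ :=
    fun n z => ∑ j ∈ Finset.range n, firstReturnDensity k M j z y with hs
  have hfm : ∀ n, Measurable fun z => firstReturnDensity k M n z y := fun n =>
    measurable_kernel_right (measurable_firstReturnDensity hk n) y
  have hsle : ∀ n z, s n z ≤ traceDensity k M z y := fun n z => ENNReal.sum_le_tsum _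
  have hss : ∀ n z, s (n + 1) z = k z y + stepOn k Mᶜ (s n) z := by
    intro n z
    simp only [hs]
    rw [Finset.sum_range_succ', add_comm]
    congr 1
    simp only [stepOn, Finset.mul_sum]
    rw [lintegral_finsetSum]
    · rfl
    · intro j _
      exact (measurable_kernel_left hk z).mul (hfm j)
  -- The constructed `θ` is the probability of entering `U` within `n` steps. By the mean value
  -- bound, the density of a jump to `y` is at most `C'` times the probability of jumping into `U`.
  -- Summed up to the first entrance into `U` this yields `C' * θ`, and what comes afterwards is at
  -- most `H`.
  have claim : ∀ n, ∃ θ : EuclideanSpace ℝ (Fin d) → ℝ≥0∞, Measurable θ ∧ (∀ z, θ z ≤ 1) ∧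
      ∀ z, s n z ≤ H + C' * θ z := by
    intro n
    induction n with
    | zero => exact ⟨fun _ => 0, measurable_const, fun _ => zero_le, fun z => by simp [hs]⟩
    | succ n ih =>
      obtain ⟨θ, hθm, hθ1, hθ⟩ := ih
      refine ⟨fun z => stepOn k U (fun _ => 1) z + stepOn k Uᶜ θ z,
        (measurable_stepOn hk measurable_const).add (measurable_stepOn hk hθm), fun z => ?_,
        fun z => ?_⟩
      · exact (add_le_add le_rfl (stepOn_mono hθ1 z)).trans (stepOn_compl_add hk1 hU z).le
      · rw [hss]
        have h1 : stepOn k Mᶜ (s n) z ≤ H + C' * stepOn k Uᶜ θ z := by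
          calc stepOn k Mᶜ (s n) z
              ≤ stepOn k Mᶜ (fun w => H + C' * Uᶜ.indicator θ w) z := by
                refine stepOn_mono_of_mem hM.compl (fun w _ => ?_) z
                by_cases hw : w ∈ U
                · exact ((hsle n w).trans (hH w hw)).trans le_self_add
                · rw [Set.indicator_of_mem (by exact hw)]
                  exact hθ w
            _ ≤ stepOn k Set.univ (fun w => H + C' * Uᶜ.indicator θ w) z :=
                stepOn_mono_set (Set.subset_univ _)
            _ = H * stepOn k Set.univ (fun _ => 1) z + C' * stepOn k Uᶜ θ z := by
                rw [stepOn_add hk measurable_const, stepOn_const hk,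
                  stepOn_const_mul hk (hθm.indicator hU.compl), stepOn_indicator hU.compl,
                  Set.univ_inter]
            _ ≤ H * 1 + C' * stepOn k Uᶜ θ z := by
                gcongr
                exact stepOn_one_le hk1 z
            _ = _ := by rw [mul_one]
        calc k z y + stepOn k Mᶜ (s n) z
            ≤ C' * stepOn k U (fun _ => 1) z + (H + C' * stepOn k Uᶜ θ z) := by
              gcongr
              exact hmean z
          _ = _ := by ring
  refine ENNReal.tsum_le_of_sum_range_le fun n => ?_
  obtain ⟨θ, -, hθ1, hθ⟩ := claim n
  calc s n z ≤ H + C' * θ z := hθ z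
    _ ≤ H + C' * 1 := by gcongr; exact hθ1 z
    _ = _ := by rw [mul_one, add_comm]

/-- If `B` has very small volume, then the density of the trace process at a point of `B` is
nearly independent of the starting point. -/
theorem traceDensity_harnack_of_small (hk : Measurable (Function.uncurry k))
    (hk1 : ∀ x, ∫⁻ y, k x y = 1) (hM : MeasurableSet M) (hB : MeasurableSet B) (hBM : B ⊆ M)
    (hU : MeasurableSet U) (hU' : MeasurableSet U') (hV : MeasurableSet V)
    (hBU : B ⊆ U) (hUM : U' ⊆ Mᶜ ∪ B) (hUU' : U ⊆ U') {y : EuclideanSpace ℝ (Fin d)}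
    {p e κ κ' C' μ : ℝ≥0∞} {m m₁ : ℕ}
    (hp : ∀ z ∈ U, stepOn k Uᶜ (fun _ => 1) z ≤ p)
    (hcoup : ∀ f : EuclideanSpace ℝ (Fin d) → ℝ≥0∞, Measurable f → ∀ x ∈ U, ∀ x' ∈ U,
      (stepOn k U)^[m] f x ≤ e * (stepOn k U')^[m] f x')
    (hκ : ∀ z, k z y ≤ κ) (hμ : ∀ z, stepOn k B (fun _ => 1) z ≤ μ)
    (hmean : ∀ w, k w y ≤ C' * stepOn k U (fun _ => 1) w)
    (hκ' : ∀ z ∈ V, κ' ≤ k z y) (hκ'0 : κ' ≠ 0) (hκ't : κ' ≠ ∞)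
    (hreach : ∀ z ∈ U, 2⁻¹ ≤ (stepOn k (U \ B))^[m₁] (V.indicator fun _ => 1) z)
    {H₀ : ℝ≥0∞} (hfin : ∀ z ∈ U, traceDensity k M z y ≤ H₀) (hH₀ : H₀ ≠ ∞)
    (he : e ≤ ENNReal.ofReal (101 / 100)) (hsmall : e * (m * μ) + m * p ≤ ENNReal.ofReal (1 / 100))
    (hgain : 2 * ((m₁ + 1) * (p + μ)) * (m * (κ + p * C')) ≤ ENNReal.ofReal (1 / 100) * κ') :
    ∀ x ∈ U, ∀ x' ∈ U,
      traceDensity k M x y ≤ ENNReal.ofReal (11 / 10) * traceDensity k M x' y := by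
  set h : EuclideanSpace ℝ (Fin d) → ℝ≥0∞ := fun z => traceDensity k M z y with hh
  have hhm : Measurable h := measurable_kernel_right (measurable_traceDensity hk) y
  have heq : ∀ z, h z = k z y + stepOn k Mᶜ h z := fun z => traceDensity_eq hk z y
  set H := ⨆ z ∈ U, h z with hH
  have hHle : ∀ z ∈ U, h z ≤ H := fun z hz => le_iSup₂ (f := fun z _ => h z) z hz
  have hHt : H ≠ ∞ := ne_top_of_le_ne_top hH₀ (iSup₂_le hfin)
  have hglob : ∀ z, h z ≤ C' + H := fun z => traceDensity_le_add hk hk1 hM hU hmean hHle z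
  have hUB : U \ B ⊆ Mᶜ := fun w hw => (hUM (hUU' hw.1)).resolve_right hw.2
  -- Per step, `κ` accounts for jumping directly to `y` and `p * (C' + H)` for leaving `U`. In the
  -- converse bound `hdown` the only loss is landing in `B`, of probability at most `μ`.
  have hup : ∀ z ∈ U, h z ≤ (stepOn k U)^[m] h z + m * (κ + p * (C' + H)) := by
    refine le_iterate_stepOn_add hk hk1 hU (u := fun _ => h) (fun _ => hhm)
      (e := κ + p * (C' + H)) (fun j z hz => ?_) m
    calc h z = k z y + stepOn k Mᶜ h z := heq z
      _ ≤ κ + stepOn k Set.univ h z := by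
          gcongr
          · exact hκ z
          · exact stepOn_mono_set (Set.subset_univ _)
      _ ≤ κ + (stepOn k U h z + p * (C' + H)) := by
          gcongr
          exact stepOn_univ_le_add hk hU (hp z hz) fun w _ => hglob w
      _ = _ := by ring
  have hdown : ∀ z ∈ U', (stepOn k U')^[m] h z ≤ h z + m * (μ * H) := by
    refine iterate_stepOn_le_add hk hk1 hU' (u := fun _ => h) (fun _ => hhm)
      (e := μ * H) (fun j z _ => ?_) m
    calc stepOn k U' h z ≤ stepOn k (Mᶜ ∪ B) h z := stepOn_mono_set hUM
      _ = stepOn k Mᶜ h z + stepOn k B h z :=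
          stepOn_union hB (Set.disjoint_compl_left_iff_subset.2 hBM) z
      _ ≤ h z + H * stepOn k B (fun _ => 1) z := by
          gcongr
          · rw [heq z]; exact le_add_self
          · exact stepOn_le_const hB hk (fun w hw => hHle w (hBU hw)) z
      _ ≤ h z + μ * H := by
          rw [mul_comm]
          gcongr
          exact hμ z
  intro x hx x' hx'
  set a := ⨅ z ∈ U, h z with ha
  have hau : ∀ z ∈ U, a ≤ h z := fun z hz => iInf₂_le z hz
  have hat : a ≠ ∞ := ne_top_of_le_ne_top hHt ((hau x hx).trans (hHle x hx))
  have hUB1 : ∀ z ∈ U, 1 - (p + μ) ≤ stepOn k (U \ B) (fun _ => 1) z := by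
    intro z hz
    rw [tsub_le_iff_right]
    calc (1 : ℝ≥0∞) = stepOn k U (fun _ => 1) z + stepOn k Uᶜ (fun _ => 1) z :=
          (stepOn_compl_add hk1 hU z).symm
      _ = stepOn k B (fun _ => 1) z + stepOn k (U \ B) (fun _ => 1) z +
          stepOn k Uᶜ (fun _ => 1) z := by
          rw [← stepOn_union (hU.diff hB) Set.disjoint_sdiff_right, Set.union_sdiff_cancel hBU]
      _ ≤ μ + stepOn k (U \ B) (fun _ => 1) z + p := by
          gcongr
          · exact hμ z
          · exact hp z hz
      _ = _ := by ring
  -- Visits to `V` add at least `κ'` to the density, and the chain is killed in a step from `U` only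
  -- with probability `p + μ`. So the infimum `a` is at least of order `κ' / (p + μ)`, and the
  -- errors not proportional to `H` are negligible relative to it.
  have key := supersolution_gain hk (hU.diff hB) Set.sdiff_subset hV (u := h) (a := a) (c := κ')
    (p := p + μ) (m := m₁) hat (fun b hb => le_iInf₂ hb)
    (fun z _ => by
      rw [heq z]
      exact (stepOn_mono_set hUB).trans le_add_self)
    (fun z hz => by
      rw [heq z, add_comm]
      gcongr
      · by_cases hzV : z ∈ V
        · rw [Set.indicator_of_mem hzV, mul_one]; exact hκ' z hzV
        · rw [Set.indicator_of_notMem hzV, mul_zero]; exact zero_le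
      · calc (1 - (p + μ)) * a ≤ a * stepOn k (U \ B) (fun _ => 1) z := by
              rw [mul_comm]
              gcongr
              exact hUB1 z hz
          _ ≤ stepOn k (U \ B) h z :=
              const_le_stepOn (hU.diff hB) hk (fun w hw => hau w hw.1) z
          _ ≤ _ := stepOn_mono_set hUB)
    hUB1 hreach
  have hsm : m * (κ + p * C') ≤ ENNReal.ofReal (1 / 100) * a := by
    refine (ENNReal.mul_le_mul_iff_right hκ'0 hκ't).1 ?_
    calc κ' * (m * (κ + p * C')) ≤ 2 * ((m₁ + 1) * (p + μ) * a) * (m * (κ + p * C')) := by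
          gcongr
      _ = 2 * ((m₁ + 1) * (p + μ)) * (m * (κ + p * C')) * a := by ring
      _ ≤ ENNReal.ofReal (1 / 100) * κ' * a := by gcongr
      _ = _ := by ring
  have habs : ENNReal.ofReal 1 * H ≤ ENNReal.ofReal (102 / 100) * h x' +
      ENNReal.ofReal (1 / 100) * H := by
    rw [ENNReal.ofReal_one, one_mul]
    refine iSup₂_le fun w hw => ?_
    calc h w ≤ (stepOn k U)^[m] h w + m * (κ + p * (C' + H)) := hup w hw
      _ ≤ e * (h x' + m * (μ * H)) + m * (κ + p * (C' + H)) := by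
          gcongr
          refine (hcoup h hhm w hw x' hx').trans ?_
          gcongr
          exact hdown x' (hUU' hx')
      _ = e * h x' + m * (κ + p * C') + (e * (m * μ) + m * p) * H := by ring
      _ ≤ ENNReal.ofReal (101 / 100) * h x' + ENNReal.ofReal (1 / 100) * h x' +
          ENNReal.ofReal (1 / 100) * H := by
          exact add_le_add (add_le_add (mul_le_mul' he le_rfl)
            (hsm.trans (mul_le_mul' le_rfl (hau x' hx')))) (mul_le_mul' hsmall le_rfl)
      _ = _ := by
          rw [← add_mul, ← ENNReal.ofReal_add (by norm_num) (by norm_num)]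
          norm_num
  exact (hHle x hx).trans (le_of_absorb hHt (by norm_num) (by norm_num) (by norm_num)
    (by norm_num) (by norm_num) (by norm_num) habs)

end SmallSet

/-! ### Noise that is small compared with a ball contained in `B`. -/

section SmallNoise

variable {d : ℕ} {k : EuclideanSpace ℝ (Fin d) → EuclideanSpace ℝ (Fin d) → ℝ≥0∞}
  {M B U : Set (EuclideanSpace ℝ (Fin d))}
  {N : Seminorm ℝ (EuclideanSpace ℝ (Fin d))} {z₀ : EuclideanSpace ℝ (Fin d)}

lemma ofReal_le_one_sub_pow {p : ℝ≥0∞} {T t : ℕ} (ht : t ≤ T)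
    (h : T * p ≤ ENNReal.ofReal (1 / 100)) : ENNReal.ofReal (99 / 100) ≤ (1 - p) ^ t := by
  have h1 := one_le_one_sub_pow_add p t
  have h2 : (1 : ℝ≥0∞) ≤ (1 - p) ^ t + ENNReal.ofReal (1 / 100) := by
    refine h1.trans ?_
    gcongr
    refine le_trans ?_ h
    gcongr
  have h3 : (1 : ℝ≥0∞) = ENNReal.ofReal (99 / 100) + ENNReal.ofReal (1 / 100) := by
    rw [← ENNReal.ofReal_add (by norm_num) (by norm_num)]; norm_num
  exact (ENNReal.add_le_add_iff_right ENNReal.ofReal_ne_top).1 (h3.symm.le.trans h2)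

/-- Harnack inequality for the iterated trace density when the noise is small compared to the size
of the ball `U` around the fixed point which is contained in `B`. -/
theorem iterDensity_harnack_of_ball {C ρ ε R r : ℝ} (hN : ∀ v, N v ≤ C * ‖v‖)
    (hR : ρ * R + ε ≤ R) (hρ0 : 0 ≤ ρ) (hk : Measurable (Function.uncurry k))
    (hk1 : ∀ x, ∫⁻ y, k x y = 1) (hM : MeasurableSet M) (hB : MeasurableSet B) (hBM : B ⊆ M)
    (hU : MeasurableSet U) (hUB : U ⊆ B) (hrU : N.closedBall z₀ r ⊆ U)
    (hBR : B ⊆ N.closedBall z₀ R) (hRM : N.closedBall z₀ R ⊆ Mᶜ ∪ B)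
    {p p' e : ℝ≥0∞} {m m₂ j₀ T : ℕ} (hm : 1 ≤ m) (hr : radius ρ ε m₂ R ≤ r)
    (hp : ∀ z ∈ N.closedBall z₀ r, stepOn k (N.closedBall z₀ r)ᶜ (fun _ => 1) z ≤ p)
    (hp' : ∀ s ≤ R, ∀ z, N (z - z₀) ≤ s →
      stepOn k (N.closedBall z₀ (ρ * s + ε))ᶜ (fun _ => 1) z ≤ p')
    (hcoup : ∀ f : EuclideanSpace ℝ (Fin d) → ℝ≥0∞, Measurable f →
      ∀ x ∈ N.closedBall z₀ r, ∀ x' ∈ N.closedBall z₀ r,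
      (stepOn k (N.closedBall z₀ r))^[m] f x ≤ e * (stepOn k U)^[m] f x')
    (he : e ≤ ENNReal.ofReal (101 / 100)) (hT : T = j₀ * (m + m₂) + m₂)
    (hTp : T * p ≤ ENNReal.ofReal (1 / 100)) (hm₂p' : m₂ * p' ≤ ENNReal.ofReal (1 / 100))
    (hq : m * p + m₂ * p' ≤ ENNReal.ofReal (1 / 100)) {y : EuclideanSpace ℝ (Fin d)}
    {F₀ a₀ : ℝ≥0∞} (hF₀ : ∀ x ∈ B, traceDensity k M x y ≤ F₀)
    (ha₀ : ∀ x ∈ N.closedBall z₀ r, a₀ ≤ traceDensity k M x y)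
    (hqF : (m * p + m₂ * p') ^ j₀ * F₀ ≤ ENNReal.ofReal (1 / 100) * a₀) :
    ∀ x ∈ B, ∀ x' ∈ B, iterDensity (traceDensity k M) B (T + 1) x y ≤
      ENNReal.ofReal (3 / 2) * iterDensity (traceDensity k M) B (T + 1) x' y := by
  classical
  set Ur := N.closedBall z₀ r with hUr
  have hUrm : MeasurableSet Ur := measurableSet_seminorm_closedBall hN r
  have hkt := measurable_traceDensity (M := M) hk
  set Q := stepOn (traceDensity k M) B with hQ
  -- Index shift: `h n` is the density of the power `n + 1`, so `h 0` is the trace density.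
  set h : ℕ → EuclideanSpace ℝ (Fin d) → ℝ≥0∞ :=
    fun n => Q^[n] (fun z => traceDensity k M z y) with hh
  have hit : ∀ n x, iterDensity (traceDensity k M) B (n + 1) x y = h n x := fun n x =>
    iterDensity_succ n x y
  have hhm : ∀ n, Measurable (h n) := fun n =>
    measurable_stepOn_iterate hkt (measurable_kernel_right hkt y) n
  have hsucc : ∀ n, h (n + 1) = Q (h n) := fun n => Function.iterate_succ_apply' _ _ _
  have hrec : ∀ n z, h (n + 1) z = stepOn k Mᶜ (h (n + 1)) z + stepOn k B (h n) z := by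
    intro n z
    conv_lhs => rw [hsucc, hQ, stepOn_traceDensity hk (hhm n)]
    rw [← hQ, ← hsucc]
  set Fs : ℕ → ℝ≥0∞ := fun n => ⨆ z ∈ B, h n z with hFs
  set as : ℕ → ℝ≥0∞ := fun n => ⨅ z ∈ Ur, h n z with has
  have hFle : ∀ n, ∀ z ∈ B, h n z ≤ Fs n := fun n z hz => le_iSup₂ (f := fun z _ => h n z) z hz
  have hale : ∀ n, ∀ z ∈ Ur, as n ≤ h n z := fun n z hz => iInf₂_le z hz
  have hglob : ∀ n z, h (n + 1) z ≤ Fs n := by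
    intro n z
    rw [hsucc]
    calc Q (h n) z ≤ Fs n * stepOn (traceDensity k M) B (fun _ => 1) z :=
          stepOn_le_const hB hkt (hFle n) z
      _ ≤ Fs n * 1 := by gcongr; exact stepOn_traceDensity_one_le hk hk1 hB hBM z
      _ = _ := mul_one _
  have hFanti : Antitone Fs := antitone_nat_of_succ_le fun n => iSup₂_le fun z _ => hglob n z
  have hlower : ∀ A ⊆ B, ∀ n z, stepOn k A (h n) z ≤ h (n + 1) z := by
    intro A hA n z
    rw [hrec]
    exact (stepOn_mono_set hA).trans le_add_self
  have ha1 : ∀ n, (1 - p) * as n ≤ as (n + 1) := by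
    intro n
    refine le_iInf₂ fun z hz => ?_
    calc (1 - p) * as n ≤ as n * stepOn k Ur (fun _ => 1) z := by
          rw [mul_comm]; gcongr; exact one_sub_le_stepOn hk1 hUrm (hp z hz)
      _ ≤ stepOn k Ur (h n) z := const_le_stepOn hUrm hk (hale n) z
      _ ≤ _ := hlower Ur (hrU.trans hUB) n z
  have hat : ∀ t n, (1 - p) ^ t * as n ≤ as (n + t) := by
    intro t
    induction t with
    | zero => intro n; simp
    | succ t ih =>
      intro n
      calc (1 - p) ^ (t + 1) * as n = (1 - p) * ((1 - p) ^ t * as n) := by rw [pow_succ]; ring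
        _ ≤ (1 - p) * as (n + t) := by gcongr; exact ih n
        _ ≤ _ := ha1 _
  have ha99 : ∀ n t, t ≤ T → ENNReal.ofReal (99 / 100) * as n ≤ as (n + t) := fun n t ht =>
    (mul_le_mul' (ofReal_le_one_sub_pow ht hTp) le_rfl).trans (hat t n)
  have hacmp : ∀ n t, t ≤ T → as n ≤ ENNReal.ofReal (100 / 99) * as (n + t) := by
    intro n t ht
    calc as n = ENNReal.ofReal (100 / 99) * (ENNReal.ofReal (99 / 100) * as n) := by
          rw [← mul_assoc, ← ENNReal.ofReal_mul (by norm_num)]; norm_num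
      _ ≤ _ := by gcongr; exact ha99 n t ht
  -- While the chain stays in `U ⊆ B`, each of its steps is a step of the trace. So `m` coupled
  -- steps compare the values in `Ur` at equal trace times, up to an error controlled by the
  -- supremum `m` steps earlier.
  have hball : ∀ n, ∀ x ∈ Ur, h (n + m) x ≤
      ENNReal.ofReal (101 / 100) * as (n + m) + m * p * Fs n := by
    intro n x hx
    have hup : ∀ z ∈ Ur, h (n + m) z ≤ (stepOn k Ur)^[m] (h n) z + m * (p * Fs n) := by
      refine le_iterate_stepOn_add hk hk1 hUrm (u := fun j => h (n + j)) (fun j => hhm _)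
        (e := p * Fs n) (fun j z hz => ?_) m
      have h1 : h (n + j + 1) z ≤
          stepOn k Set.univ (fun w => if w ∈ B then h (n + j) w else h (n + j + 1) w) z := by
        rw [hsucc]
        refine stepOn_traceDensity_le hk hM hB hBM (hhm _) (fun w hw => ?_) (fun w hw => ?_) z
        · rw [if_neg (fun hwB => hw (hBM hwB)), ← hQ, ← hsucc]
        · rw [if_pos hw]
      refine h1.trans ((stepOn_univ_le_add hk hUrm (hp z hz) (c := Fs n) fun w _ => ?_).trans ?_)
      · split_ifs with hw
        · exact (hFle _ w hw).trans (hFanti (by omega))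
        · exact (hglob _ w).trans (hFanti (by omega))
      · gcongr
        refine stepOn_mono_of_mem hUrm (fun w hw => ?_) z
        rw [if_pos (hUB (hrU hw))]
    have hdown : ∀ z ∈ U, (stepOn k U)^[m] (h n) z ≤ h (n + m) z := by
      intro z hz
      have := iterate_stepOn_le_add hk hk1 hU (u := fun j => h (n + j)) (fun j => hhm _)
        (e := 0) (fun j w _ => by rw [add_zero]; exact hlower U hUB (n + j) w) m z hz
      simpa using this
    calc h (n + m) x ≤ (stepOn k Ur)^[m] (h n) x + m * (p * Fs n) := hup x hx
      _ ≤ ENNReal.ofReal (101 / 100) * as (n + m) + m * p * Fs n := by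
          rw [mul_assoc]
          gcongr
          simp only [has]
          rw [ENNReal.mul_iInf_of_ne (by simp) ENNReal.ofReal_ne_top]
          refine le_iInf fun w => ?_
          rw [ENNReal.mul_iInf_of_ne (by simp) ENNReal.ofReal_ne_top]
          refine le_iInf fun hw => ?_
          exact (hcoup _ (hhm n) x hx w hw).trans (mul_le_mul' he (hdown w (hrU hw)))
  -- From elsewhere in `B` the chain enters `Ur` after at most `m₂` steps, each completing zero or
  -- one trace step. The number of trace steps left is then only known to lie in a window, hence the
  -- quantifier over `t` and `n'`. The offset `n + 1` allows the values outside `B` to be bounded by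
  -- `Fs n`.
  have hreach : ∀ n β, (∀ t, n + 1 ≤ t → t ≤ n + 1 + m₂ → ∀ w ∈ Ur, h t w ≤ β) →
      ∀ j, ∀ s ≤ R, radius ρ ε j s ≤ r → ∀ z, N (z - z₀) ≤ s →
      ∀ n', n + 1 + j ≤ n' → n' ≤ n + 1 + m₂ → h n' z ≤ β + j * p' * Fs n := by
    intro n β hβ j
    induction j with
    | zero =>
      intro s _ hsr z hz n' h1 h2
      refine (hβ n' (by omega) h2 z ?_).trans le_self_add
      exact (Seminorm.mem_closedBall N).2 (hz.trans hsr)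
    | succ j ih =>
      intro s hs hsr z hz n' h1 h2
      obtain ⟨n'', rfl⟩ : ∃ n'', n' = n'' + 1 := ⟨n' - 1, by omega⟩
      set A := N.closedBall z₀ (ρ * s + ε) with hA
      have hAm : MeasurableSet A := measurableSet_seminorm_closedBall hN _
      have hs' : ρ * s + ε ≤ R := by nlinarith
      have h3 : h (n'' + 1) z ≤
          stepOn k Set.univ (fun w => if w ∈ B then h n'' w else h (n'' + 1) w) z := by
        rw [hsucc]
        refine stepOn_traceDensity_le hk hM hB hBM (hhm _) (fun w hw => ?_) (fun w hw => ?_) z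
        · rw [if_neg (fun hwB => hw (hBM hwB)), ← hQ, ← hsucc]
        · rw [if_pos hw]
      refine h3.trans ((stepOn_univ_le_add hk hAm (hp' s hs z hz) (c := Fs n) fun w _ => ?_).trans ?_)
      · split_ifs with hw
        · exact (hFle _ w hw).trans (hFanti (by omega))
        · exact (hglob _ w).trans (hFanti (by omega))
      · have h4 : stepOn k A (fun w => if w ∈ B then h n'' w else h (n'' + 1) w) z ≤
            (β + j * p' * Fs n) * 1 := by
          refine (stepOn_le_const hAm hk (c := β + j * p' * Fs n) (fun w hw => ?_) z).trans ?_
          · have hw' := (Seminorm.mem_closedBall N).1 hw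
            split_ifs
            · exact ih _ hs' hsr w hw' n'' (by omega) (by omega)
            · exact ih _ hs' hsr w hw' (n'' + 1) (by omega) (by omega)
          · gcongr
            exact stepOn_one_le hk1 z
        calc _ ≤ (β + j * p' * Fs n) * 1 + p' * Fs n := by gcongr
          _ = _ := by push_cast; ring
  set W := m + m₂ with hW
  have hstep : ∀ n, W ≤ T → Fs (n + W) ≤
      ENNReal.ofReal (11 / 10) * as (n + W) + (m * p + m₂ * p') * Fs n := by
    intro n hWT
    obtain ⟨m', rfl⟩ : ∃ m', m = m' + 1 := ⟨m - 1, by omega⟩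
    refine iSup₂_le fun x hx => ?_
    have h1 := hreach (n + m') (ENNReal.ofReal (11 / 10) * as (n + W) + (m' + 1 : ℕ) * p * Fs n)
      (fun t ht1 ht2 w hw => ?_) m₂ R le_rfl hr x ((Seminorm.mem_closedBall N).1 (hBR hx))
      (n + W) (by omega) (by omega)
    · refine h1.trans ?_
      calc _ ≤ ENNReal.ofReal (11 / 10) * as (n + W) + (m' + 1 : ℕ) * p * Fs n + m₂ * p' * Fs n := by
            gcongr
            exact hFanti (by omega)
        _ = _ := by ring
    · obtain ⟨t', rfl⟩ : ∃ t', t = t' + (m' + 1) := ⟨t - (m' + 1), by omega⟩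
      refine (hball t' w hw).trans ?_
      refine add_le_add ?_ (mul_le_mul' le_rfl (hFanti (by omega)))
      · calc ENNReal.ofReal (101 / 100) * as (t' + (m' + 1)) ≤
              ENNReal.ofReal (101 / 100) * (ENNReal.ofReal (100 / 99) *
              as (t' + (m' + 1) + (n + W - (t' + (m' + 1))))) := by
              gcongr
              exact hacmp _ _ (by omega)
          _ ≤ _ := by
              rw [← mul_assoc, ← ENNReal.ofReal_mul (by norm_num),
                show t' + (m' + 1) + (n + W - (t' + (m' + 1))) = n + W by omega]
              gcongr
              norm_num
  -- Each block multiplies the part of the supremum not yet controlled by the infimum on `Ur` by the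
  -- small factor `m * p + m₂ * p'`. After `j₀` blocks even the crude bound `F₀` is below one
  -- hundredth of `a₀`.
  have hiter : ∀ j ≤ j₀, Fs (j * W) ≤
      ENNReal.ofReal (12 / 10) * as (j * W) + (m * p + m₂ * p') ^ j * Fs 0 := by
    intro j
    induction j with
    | zero => intro _; simp
    | succ j ih =>
      intro hj
      have hWT : W ≤ T := by
        rw [hT]
        calc W ≤ j₀ * W := Nat.le_mul_of_pos_left _ (by omega)
          _ ≤ _ := Nat.le_add_right _ _
      have e1 : (j + 1) * W = j * W + W := by ring
      rw [e1]
      calc Fs (j * W + W) ≤ ENNReal.ofReal (11 / 10) * as (j * W + W) +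
            (m * p + m₂ * p') * Fs (j * W) := hstep _ hWT
        _ ≤ ENNReal.ofReal (11 / 10) * as (j * W + W) + (m * p + m₂ * p') *
            (ENNReal.ofReal (12 / 10) * as (j * W) + (m * p + m₂ * p') ^ j * Fs 0) := by
            gcongr
            exact ih (by omega)
        _ = ENNReal.ofReal (11 / 10) * as (j * W + W) + (m * p + m₂ * p') *
            (ENNReal.ofReal (12 / 10) * as (j * W)) + (m * p + m₂ * p') ^ (j + 1) * Fs 0 := by
            rw [pow_succ]; ring
        _ ≤ ENNReal.ofReal (11 / 10) * as (j * W + W) + ENNReal.ofReal (1 / 100) *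
            (ENNReal.ofReal (12 / 10) * (ENNReal.ofReal (100 / 99) * as (j * W + W))) +
            (m * p + m₂ * p') ^ (j + 1) * Fs 0 := by
            gcongr
            exact hacmp _ _ hWT
        _ ≤ _ := by
            gcongr
            rw [← mul_assoc, ← mul_assoc, ← ENNReal.ofReal_mul (by norm_num),
              ← ENNReal.ofReal_mul (by norm_num), ← add_mul,
              ← ENNReal.ofReal_add (by norm_num) (by norm_num)]
            gcongr
            norm_num
  set n := j₀ * W with hn
  have hFn : Fs n ≤ ENNReal.ofReal (125 / 100) * as n := by
    calc Fs n ≤ ENNReal.ofReal (12 / 10) * as n + (m * p + m₂ * p') ^ j₀ * Fs 0 := hiter j₀ le_rfl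
      _ ≤ ENNReal.ofReal (12 / 10) * as n + (m * p + m₂ * p') ^ j₀ * F₀ := by
          gcongr
          exact iSup₂_le hF₀
      _ ≤ ENNReal.ofReal (12 / 10) * as n + ENNReal.ofReal (1 / 100) * a₀ := by gcongr
      _ ≤ ENNReal.ofReal (12 / 10) * as n + ENNReal.ofReal (1 / 100) *
          (ENNReal.ofReal (100 / 99) * as n) := by
          gcongr
          have h1 := hacmp 0 n (by omega)
          rw [zero_add] at h1
          refine le_trans ?_ h1
          exact le_iInf₂ ha₀
      _ ≤ _ := by
          rw [← mul_assoc, ← ENNReal.ofReal_mul (by norm_num), ← add_mul,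
            ← ENNReal.ofReal_add (by norm_num) (by norm_num)]
          gcongr
          norm_num
  -- The lower bound on `Ur` is carried to all of `B` by the approach to `Ur`, with the same
  -- uncertainty in the trace time. The minimum of the two possible values takes care of both cases
  -- in a step.
  have hfinal : ∀ j, ∀ s ≤ R, radius ρ ε j s ≤ r → ∀ z, N (z - z₀) ≤ s →
      ∀ n', n + j ≤ n' → n' ≤ n + m₂ →
      (1 - p') ^ j * (ENNReal.ofReal (99 / 100) * as n) ≤ h n' z := by
    intro j
    induction j with
    | zero =>
      intro s _ hsr z hz n' h1 h2
      rw [pow_zero, one_mul]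
      have h3 := ha99 n (n' - n) (by omega)
      rw [show n + (n' - n) = n' by omega] at h3
      exact h3.trans (hale n' z ((Seminorm.mem_closedBall N).2 (hz.trans hsr)))
    | succ j ih =>
      intro s hs hsr z hz n' h1 h2
      obtain ⟨n'', rfl⟩ : ∃ n'', n' = n'' + 1 := ⟨n' - 1, by omega⟩
      set A := N.closedBall z₀ (ρ * s + ε) with hA
      have hAm : MeasurableSet A := measurableSet_seminorm_closedBall hN _
      have hs' : ρ * s + ε ≤ R := by nlinarith
      have hAM : A ⊆ Mᶜ ∪ B := fun w hw => hRM ((Seminorm.mem_closedBall N).2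
        (((Seminorm.mem_closedBall N).1 hw).trans hs'))
      set c := (1 - p') ^ j * (ENNReal.ofReal (99 / 100) * as n) with hc
      calc (1 - p') ^ (j + 1) * (ENNReal.ofReal (99 / 100) * as n) = c * (1 - p') := by
            rw [pow_succ, hc]; ring
        _ ≤ c * stepOn k A (fun _ => 1) z := by
            gcongr; exact one_sub_le_stepOn hk1 hAm (hp' s hs z hz)
        _ ≤ stepOn k A (fun w => min (h (n'' + 1) w) (h n'' w)) z := by
            refine const_le_stepOn hAm hk (fun w hw => le_min ?_ ?_) z
            · exact ih _ hs' hsr w ((Seminorm.mem_closedBall N).1 hw) _ (by omega) (by omega)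
            · exact ih _ hs' hsr w ((Seminorm.mem_closedBall N).1 hw) _ (by omega) (by omega)
        _ ≤ _ := by
            rw [hsucc]
            exact stepOn_traceDensity_ge hk hB hBM hAM (hhm _) (fun w => min_le_left _ _)
              (fun w _ => min_le_right _ _) z
  intro x hx x' hx'
  rw [hit, hit]
  have e2 : T = n + m₂ := hT
  have h1 := hfinal m₂ R le_rfl hr x' ((Seminorm.mem_closedBall N).1 (hBR hx')) (n + m₂) le_rfl le_rfl
  have h2 : ENNReal.ofReal (99 / 100) ≤ (1 - p') ^ m₂ := ofReal_le_one_sub_pow le_rfl hm₂p'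
  rw [e2]
  calc h (n + m₂) x ≤ Fs (n + m₂) := hFle _ x hx
    _ ≤ Fs n := hFanti (by omega)
    _ ≤ ENNReal.ofReal (125 / 100) * as n := hFn
    _ ≤ ENNReal.ofReal (3 / 2) * (ENNReal.ofReal (99 / 100) * (ENNReal.ofReal (99 / 100) * as n)) := by
        rw [← mul_assoc, ← mul_assoc, ← ENNReal.ofReal_mul (by norm_num),
          ← ENNReal.ofReal_mul (by norm_num)]
        gcongr
        norm_num
    _ ≤ ENNReal.ofReal (3 / 2) * h (n + m₂) x' := by
        gcongr
        refine le_trans ?_ h1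
        gcongr

end SmallNoise

/-! ### Exponential bounds on the trace density -/

section Lyapunov

variable {d : ℕ}

/-- A Lyapunov function for the chain killed in `M` bounds the trace density. -/
lemma traceDensity_le_of_lyapunov
    {k : EuclideanSpace ℝ (Fin d) → EuclideanSpace ℝ (Fin d) → ℝ≥0∞}
    {M : Set (EuclideanSpace ℝ (Fin d))} (hk : Measurable (Function.uncurry k)) {κ : ℝ≥0∞}
    (hκ : ∀ x y, k x y ≤ κ) {v : EuclideanSpace ℝ (Fin d) → ℝ≥0∞}
    (hv : ∀ x, stepOn k Mᶜ v x + 1 ≤ v x) (x y : EuclideanSpace ℝ (Fin d)) :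
    traceDensity k M x y ≤ κ * v x := by
  have hs : ∀ n x, ∑ j ∈ Finset.range n, (stepOn k Mᶜ)^[j] (fun _ => 1) x ≤ v x := by
    intro n
    induction n with
    | zero => intro x; simp
    | succ n ih =>
      intro x
      rw [Finset.sum_range_succ']
      refine le_trans ?_ (hv x)
      refine add_le_add ?_ le_rfl
      simp only [Function.iterate_succ_apply']
      calc ∑ j ∈ Finset.range n, stepOn k Mᶜ ((stepOn k Mᶜ)^[j] fun _ => 1) x
          = stepOn k Mᶜ (fun z => ∑ j ∈ Finset.range n, (stepOn k Mᶜ)^[j] (fun _ => 1) z) x := by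
            simp only [stepOn, Finset.mul_sum]
            rw [lintegral_finsetSum]
            intro j _
            exact (measurable_kernel_left hk x).mul
              (measurable_stepOn_iterate hk measurable_const j)
        _ ≤ _ := stepOn_mono ih x
  refine ENNReal.tsum_le_of_sum_range_le fun n => ?_
  calc ∑ j ∈ Finset.range n, firstReturnDensity k M j x y
      ≤ ∑ j ∈ Finset.range n, κ * (stepOn k Mᶜ)^[j] (fun _ => 1) x := by
        refine Finset.sum_le_sum fun j _ => ?_
        rw [firstReturnDensity_eq_iterate, ← stepOn_iterate_const_mul hk measurable_const]
        exact stepOn_iterate_mono (fun z => by simpa using hκ z y) j x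
    _ = κ * ∑ j ∈ Finset.range n, (stepOn k Mᶜ)^[j] (fun _ => 1) x := by rw [Finset.mul_sum]
    _ ≤ _ := by gcongr; exact hs n x

lemma KernelBounds.lintegral_eq_one
    {F : EuclideanSpace ℝ (Fin d) → EuclideanSpace ℝ (Fin d)}
    {k : ℝ → EuclideanSpace ℝ (Fin d) → EuclideanSpace ℝ (Fin d) → ℝ≥0∞} {K : ℝ}
    (hb : KernelBounds F k K) {σ : ℝ} (hσ : 0 < σ) (x : EuclideanSpace ℝ (Fin d)) :
    ∫⁻ y, k σ x y = 1 := by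
  obtain ⟨γ, hγ, h⟩ := hb.noise σ hσ
  simpa using h x (fun _ => 1) measurable_const

lemma one_le_inv_sq {σ : ℝ} (hσ : 0 < σ) (hσ1 : σ < 1) : 1 ≤ 1 / σ ^ 2 := by
  rw [le_div_iff₀ (by positivity)]
  nlinarith

lemma le_exp_div_sq {σ a : ℝ} (hσ : 0 < σ) (hσ1 : σ < 1) (ha : 0 ≤ a) :
    a ≤ Real.exp (a / σ ^ 2) := by
  have h1 := one_le_inv_sq hσ hσ1
  have h2 : a ≤ a / σ ^ 2 := by rw [div_eq_mul_one_div]; nlinarith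
  linarith [Real.add_one_le_exp (a / σ ^ 2)]

lemma inv_pow_le_exp_div_sq {σ : ℝ} (hσ : 0 < σ) (hσ1 : σ < 1) (d : ℕ) :
    (σ⁻¹) ^ d ≤ Real.exp (d / σ ^ 2) := by
  have h0 : 1 ≤ σ⁻¹ := (one_le_inv₀ hσ).2 hσ1.le
  have h1 : σ⁻¹ ≤ Real.exp (1 / σ ^ 2) := by
    have h2 : σ⁻¹ ≤ 1 / σ ^ 2 := by
      rw [one_div, ← inv_pow]
      nlinarith
    linarith [Real.add_one_le_exp (1 / σ ^ 2)]
  calc (σ⁻¹) ^ d ≤ Real.exp (1 / σ ^ 2) ^ d := by gcongr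
    _ = _ := by rw [← Real.exp_nat_mul]; congr 1; ring

/-- The prefactor `K⁻¹` is absorbed in the exponent, since `K ≤ exp (K / σ ^ 2)` for `σ < 1`. -/
lemma KernelBounds.exp_le {F : EuclideanSpace ℝ (Fin d) → EuclideanSpace ℝ (Fin d)}
    {k : ℝ → EuclideanSpace ℝ (Fin d) → EuclideanSpace ℝ (Fin d) → ℝ≥0∞} {K : ℝ}
    (hb : KernelBounds F k K) {σ a : ℝ} (hσ : 0 < σ) (hσ1 : σ < 1)
    {x y : EuclideanSpace ℝ (Fin d)} (ha : ‖y - F x‖ ≤ a) :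
    ENNReal.ofReal (Real.exp (-((K * a ^ 2 + K) / σ ^ 2))) ≤ k σ x y := by
  have hK := hb.one_le
  refine le_trans (ENNReal.ofReal_le_ofReal ?_) (hb.lower σ hσ hσ1 x y)
  have h1 : Real.exp (-(K / σ ^ 2)) ≤ K⁻¹ := by
    rw [Real.exp_neg]
    exact inv_anti₀ (by linarith) (le_exp_div_sq hσ hσ1 (by linarith))
  calc Real.exp (-((K * a ^ 2 + K) / σ ^ 2))
      = Real.exp (-(K / σ ^ 2)) * Real.exp (-(K * a ^ 2 / σ ^ 2)) := by
        rw [← Real.exp_add]; congr 1; ring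
    _ ≤ _ := by gcongr

/-- The trace density on a set containing a fixed ball is at most exponentially large. -/
theorem KernelBounds.exists_traceDensity_le_exp
    {F : EuclideanSpace ℝ (Fin d) → EuclideanSpace ℝ (Fin d)}
    {k : ℝ → EuclideanSpace ℝ (Fin d) → EuclideanSpace ℝ (Fin d) → ℝ≥0∞} {K : ℝ}
    (hb : KernelBounds F k K) (hF : Continuous F) {R₀ ε₀ : ℝ} (hε₀ : 0 < ε₀)
    (hcontr : ∀ x, R₀ ≤ ‖x‖ → ‖F x‖ ^ 2 ≤ ‖x‖ ^ 2 - ε₀)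
    (z₀ : EuclideanSpace ℝ (Fin d)) {r : ℝ} (hr : 0 < r) (R' : ℝ) :
    ∃ J : ℝ, 0 ≤ J ∧ ∀ σ, 0 < σ → σ < 1 → K * σ ^ 2 ≤ ε₀ / 2 →
      ∀ M, MeasurableSet M → Metric.ball z₀ r ⊆ M → ∀ x, ‖x‖ ≤ R' → ∀ y,
        traceDensity (k σ) M x y ≤ ENNReal.ofReal (Real.exp (J / σ ^ 2)) := by
  have hK := hb.one_le
  obtain ⟨G, hG⟩ : ∃ G, ∀ x ∈ Metric.closedBall (0 : EuclideanSpace ℝ (Fin d)) R₀, ‖F x‖ ≤ G :=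
    (isCompact_closedBall _ _).exists_bound_of_continuousOn hF.continuousOn
  set V := (volume (Metric.ball z₀ r)).toReal with hV
  have hVtop : volume (Metric.ball z₀ r) ≠ ∞ := measure_ball_lt_top.ne
  have hVpos : 0 < V := ENNReal.toReal_pos (Metric.measure_ball_pos volume z₀ hr).ne' hVtop
  set D := ‖z₀‖ + r + |G| with hD
  have hD0 : 0 ≤ D := by positivity
  set A := K * D ^ 2 + K with hA
  have hA0 : 0 ≤ A := by positivity
  set K₀ := G ^ 2 + ε₀ / 2 with hK₀
  have hK₀0 : 0 ≤ K₀ := by positivity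
  set α := 2 / ε₀ with hα
  have hα0 : 0 < α := by positivity
  have hαε : α * (ε₀ / 2) = 1 := by rw [hα]; field_simp
  set b := (α * K₀ + 1) / V with hbdef
  have hb0 : 0 ≤ b := by positivity
  set c := K * (α * R' ^ 2 + b) with hc
  have hc0 : 0 ≤ c := by positivity
  clear_value V A K₀ α b c
  refine ⟨d + A + c, by positivity, fun σ hσ hσ1 hσε M hM hBM x hx y => ?_⟩
  have hk := hb.measurable σ
  have hk1 := hb.lintegral_eq_one hσ
  -- The Lyapunov function is `α ‖x‖ ^ 2 + β`. Outside radius `R₀` the drift `α * ε₀ / 2 = 1`, left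
  -- after half of `ε₀` pays for the noise, supplies the required decrease. Inside, `M` is hit in
  -- one step with probability at least `V exp (-A / σ ^ 2)`, and killing there loses `β` times
  -- this, which is exactly `α K₀ + 1`.
  set β := b * Real.exp (A / σ ^ 2) with hβ
  have hβ0 : 0 ≤ β := by positivity
  have hhit : ∀ x, ‖x‖ < R₀ →
      ENNReal.ofReal (V * Real.exp (-(A / σ ^ 2))) ≤ stepOn (k σ) M (fun _ => 1) x := by
    intro x hx
    have hGx : ‖F x‖ ≤ G := hG x (by simpa using hx.le)
    calc ENNReal.ofReal (V * Real.exp (-(A / σ ^ 2)))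
          = ENNReal.ofReal (Real.exp (-(A / σ ^ 2))) * volume (Metric.ball z₀ r) := by
            rw [mul_comm, ENNReal.ofReal_mul (by positivity), hV, ENNReal.ofReal_toReal hVtop]
        _ = ∫⁻ y in Metric.ball z₀ r, ENNReal.ofReal (Real.exp (-(A / σ ^ 2))) := by
            rw [setLIntegral_const]
        _ ≤ stepOn (k σ) (Metric.ball z₀ r) (fun _ => 1) x := by
            simp only [stepOn, mul_one]
            refine setLIntegral_mono' measurableSet_ball fun y hy => ?_
            rw [hA]
            refine hb.exp_le hσ hσ1 ?_
            have h2 : ‖y - z₀‖ < r := by simpa [dist_eq_norm] using hy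
            have h3 : ‖y‖ ≤ ‖y - z₀‖ + ‖z₀‖ := norm_le_norm_sub_add y z₀
            have h4 := norm_sub_le y (F x)
            have h5 := le_abs_self G
            linarith
        _ ≤ _ := stepOn_mono_set hBM
  have hmass : ∀ x, ‖x‖ < R₀ → stepOn (k σ) Mᶜ (fun _ => 1) x ≤
      ENNReal.ofReal (1 - V * Real.exp (-(A / σ ^ 2))) := by
    intro x hx
    rw [ENNReal.ofReal_sub _ (by positivity), ENNReal.ofReal_one]
    refine ENNReal.le_sub_of_add_le_left ENNReal.ofReal_ne_top ?_
    exact (add_le_add (hhit x hx) le_rfl).trans (stepOn_compl_add hk1 hM x).le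
  set v : EuclideanSpace ℝ (Fin d) → ℝ≥0∞ := fun x =>
    ENNReal.ofReal α * ENNReal.ofReal (‖x‖ ^ 2) + ENNReal.ofReal β with hv
  have hvx : ∀ x, v x = ENNReal.ofReal (α * ‖x‖ ^ 2 + β) := fun x => by
    rw [hv, ENNReal.ofReal_add (by positivity) hβ0, ENNReal.ofReal_mul hα0.le]
  have hnm : Measurable fun x : EuclideanSpace ℝ (Fin d) => ENNReal.ofReal (‖x‖ ^ 2) := by
    fun_prop
  have hstep : ∀ x, stepOn (k σ) Mᶜ v x + 1 ≤ v x := by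
    intro x
    have h1 : stepOn (k σ) Mᶜ v x ≤ ENNReal.ofReal α * ENNReal.ofReal (‖F x‖ ^ 2 + ε₀ / 2) +
        ENNReal.ofReal β * stepOn (k σ) Mᶜ (fun _ => 1) x := by
      rw [hv, stepOn_add hk (hnm.const_mul _), stepOn_const hk, stepOn_const_mul hk hnm]
      gcongr
      calc stepOn (k σ) Mᶜ (fun y => ENNReal.ofReal (‖y‖ ^ 2)) x
          ≤ ∫⁻ y, k σ x y * ENNReal.ofReal (‖y‖ ^ 2) := setLIntegral_le_lintegral _ _
        _ ≤ _ := hb.moment σ hσ x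
        _ ≤ _ := ENNReal.ofReal_le_ofReal (by linarith)
    rcases lt_or_ge ‖x‖ R₀ with hxR | hxR
    · have hGx : ‖F x‖ ≤ G := hG x (by simpa using hxR.le)
      have h2 := hmass x hxR
      have h3 : 0 ≤ 1 - V * Real.exp (-(A / σ ^ 2)) := by
        have h5 := (hhit x hxR).trans (stepOn_one_le hk1 x)
        rw [← ENNReal.ofReal_one, ENNReal.ofReal_le_ofReal_iff (by norm_num)] at h5
        linarith
      calc stepOn (k σ) Mᶜ v x + 1
          ≤ ENNReal.ofReal α * ENNReal.ofReal K₀ +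
            ENNReal.ofReal β * ENNReal.ofReal (1 - V * Real.exp (-(A / σ ^ 2))) + 1 := by
            refine add_le_add (h1.trans (add_le_add (mul_le_mul' le_rfl
              (ENNReal.ofReal_le_ofReal ?_)) (mul_le_mul' le_rfl h2))) le_rfl
            rw [hK₀]
            gcongr
        _ = ENNReal.ofReal (α * K₀ + β * (1 - V * Real.exp (-(A / σ ^ 2))) + 1) := by
            rw [ENNReal.ofReal_add (by positivity) (by norm_num),
              ENNReal.ofReal_add (by positivity) (by positivity), ENNReal.ofReal_mul hα0.le,
              ENNReal.ofReal_mul hβ0, ENNReal.ofReal_one]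
        _ ≤ v x := by
            rw [hvx]
            refine ENNReal.ofReal_le_ofReal ?_
            have h4 : β * (V * Real.exp (-(A / σ ^ 2))) = α * K₀ + 1 := by
              have h5 : Real.exp (A / σ ^ 2) * Real.exp (-(A / σ ^ 2)) = 1 := by
                rw [← Real.exp_add]; simp
              calc β * (V * Real.exp (-(A / σ ^ 2)))
                  = b * V * (Real.exp (A / σ ^ 2) * Real.exp (-(A / σ ^ 2))) := by rw [hβ]; ring
                _ = α * K₀ + 1 := by rw [h5, hbdef]; field_simp
            have h6 : 0 ≤ α * ‖x‖ ^ 2 := by positivity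
            nlinarith
    · have h2 := hcontr x hxR
      have h3 := sq_nonneg ‖F x‖
      calc stepOn (k σ) Mᶜ v x + 1
          ≤ ENNReal.ofReal α * ENNReal.ofReal (‖x‖ ^ 2 - ε₀ / 2) + ENNReal.ofReal β * 1 + 1 := by
            refine add_le_add (h1.trans (add_le_add (mul_le_mul' le_rfl
              (ENNReal.ofReal_le_ofReal ?_)) (mul_le_mul' le_rfl (stepOn_one_le hk1 x)))) le_rfl
            linarith
        _ = ENNReal.ofReal (α * (‖x‖ ^ 2 - ε₀ / 2) + β + 1) := by
            have h4 : 0 ≤ ‖x‖ ^ 2 - ε₀ / 2 := by linarith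
            rw [mul_one, ENNReal.ofReal_add (by positivity) (by norm_num),
              ENNReal.ofReal_add (by positivity) (by positivity), ENNReal.ofReal_mul hα0.le,
              ENNReal.ofReal_one]
        _ = v x := by
            rw [hvx]
            congr 1
            rw [mul_sub, hαε]
            ring
  refine (traceDensity_le_of_lyapunov hk (hb.upper σ hσ) hstep x y).trans ?_
  rw [hvx, ← ENNReal.ofReal_mul (by positivity)]
  refine ENNReal.ofReal_le_ofReal ?_
  have h1 : 1 ≤ Real.exp (A / σ ^ 2) := Real.one_le_exp (by positivity)
  have h2 : ‖x‖ ^ 2 ≤ R' ^ 2 := by gcongr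
  calc K * σ⁻¹ ^ d * (α * ‖x‖ ^ 2 + β) ≤ K * σ⁻¹ ^ d * (α * R' ^ 2 * Real.exp (A / σ ^ 2) + β) := by
        refine mul_le_mul_of_nonneg_left (add_le_add ?_ le_rfl) (by positivity)
        calc α * ‖x‖ ^ 2 ≤ α * R' ^ 2 * 1 := by rw [mul_one]; gcongr
          _ ≤ α * R' ^ 2 * Real.exp (A / σ ^ 2) := by gcongr
    _ = σ⁻¹ ^ d * Real.exp (A / σ ^ 2) * c := by rw [hc, hβ]; ring
    _ ≤ Real.exp (d / σ ^ 2) * Real.exp (A / σ ^ 2) * Real.exp (c / σ ^ 2) := by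
        gcongr
        · exact inv_pow_le_exp_div_sq hσ hσ1 d
        · exact le_exp_div_sq hσ hσ1 hc0
    _ = _ := by rw [← Real.exp_add, ← Real.exp_add]; congr 1; ring

end Lyapunov

/-! ### Asymptotics for small noise -/

section Asymptotics

lemma eventually_pow_mul_exp_le {c a ε : ℝ} (hc : 0 ≤ c) (ha : 0 < a) (hε : 0 < ε) (j : ℕ) :
    ∀ᶠ σ in 𝓝[>] (0 : ℝ), c * (σ⁻¹) ^ j * Real.exp (-(a / σ ^ 2)) ≤ ε := by
  have h1 : Tendsto (fun σ : ℝ => a * (σ⁻¹) ^ 2) (𝓝[>] 0) atTop :=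
    ((tendsto_pow_atTop two_ne_zero).comp tendsto_inv_nhdsGT_zero).const_mul_atTop ha
  have h2 := ((Real.tendsto_pow_mul_exp_neg_atTop_nhds_zero j).comp h1).const_mul (c * (a⁻¹) ^ j)
  rw [mul_zero] at h2
  filter_upwards [h2.eventually (gt_mem_nhds hε), Ioo_mem_nhdsGT (show (0 : ℝ) < 1 by norm_num)]
    with σ hσ hσ1
  refine le_trans ?_ hσ.le
  have h3 : 1 ≤ σ⁻¹ := (one_le_inv₀ hσ1.1).2 hσ1.2.le
  have h4 : (σ⁻¹) ^ j ≤ ((σ⁻¹) ^ 2) ^ j := by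
    gcongr
    nlinarith
  have h5 : a / σ ^ 2 = a * (σ⁻¹) ^ 2 := by rw [inv_pow]; rfl
  simp only [Function.comp]
  rw [h5]
  calc c * σ⁻¹ ^ j * Real.exp (-(a * σ⁻¹ ^ 2))
      ≤ c * (σ⁻¹ ^ 2) ^ j * Real.exp (-(a * σ⁻¹ ^ 2)) := by gcongr
    _ = c * (a⁻¹ * a) ^ j * (σ⁻¹ ^ 2) ^ j * Real.exp (-(a * σ⁻¹ ^ 2)) := by
        rw [inv_mul_cancel₀ ha.ne', one_pow, mul_one]
    _ = _ := by rw [mul_pow a⁻¹ a, mul_pow a]; ring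

lemma half_le_log_inv {σ : ℝ} (hσ : 0 < σ) (hσ1 : σ ≤ 1 / 2) : 1 / 2 ≤ Real.log σ⁻¹ := by
  have h1 : (2 : ℝ) ≤ σ⁻¹ := by
    rw [le_inv_comm₀ (by norm_num) hσ]; linarith
  have h2 := Real.log_le_log (by norm_num) h1
  have := Real.log_two_gt_d9
  linarith

lemma log_inv_le {σ : ℝ} (hσ : 0 < σ) : Real.log σ⁻¹ ≤ σ⁻¹ := by
  have := Real.log_le_sub_one_of_pos (inv_pos.2 hσ)
  linarith

/-- A number of steps of order `log σ⁻¹` suffices to contract beyond the scale `σ ^ 2`. -/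
lemma exists_steps {ρ : ℝ} (hρ0 : 0 < ρ) (hρ1 : ρ < 1) {A : ℝ} (hA : 0 ≤ A) :
    ∃ c : ℝ, 0 < c ∧ ∀ᶠ σ in 𝓝[>] (0 : ℝ), ∃ m : ℕ, (m : ℝ) + 1 ≤ c * Real.log σ⁻¹ ∧
      A * ρ ^ m / σ ^ 2 ≤ 1 / 200 := by
  have hl : 0 < Real.log ρ⁻¹ := Real.log_pos ((one_lt_inv₀ hρ0).2 hρ1)
  -- Yields `ρ ^ m ≤ σ ^ 3`; after division by `σ ^ 2` a factor `σ` is left to absorb `200 A`.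
  set c₀ := 3 / Real.log ρ⁻¹ with hc₀
  have hc₀0 : 0 < c₀ := by positivity
  refine ⟨c₀ + 4, by positivity, ?_⟩
  filter_upwards [Ioo_mem_nhdsGT (show (0 : ℝ) < 1 / 2 by norm_num),
    Ioo_mem_nhdsGT (show (0 : ℝ) < 1 / (200 * (A + 1)) by positivity)] with σ hσ hσA
  have hσ0 := hσ.1
  have hlog := half_le_log_inv hσ0 hσ.2.le
  refine ⟨⌈c₀ * Real.log σ⁻¹⌉₊, ?_, ?_⟩
  · have := Nat.ceil_lt_add_one (show 0 ≤ c₀ * Real.log σ⁻¹ by positivity)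
    linarith
  · set m := ⌈c₀ * Real.log σ⁻¹⌉₊ with hm
    have h1 : c₀ * Real.log σ⁻¹ ≤ m := Nat.le_ceil _
    have h2 : 3 * Real.log σ⁻¹ ≤ m * Real.log ρ⁻¹ := by
      calc 3 * Real.log σ⁻¹ = c₀ * Real.log σ⁻¹ * Real.log ρ⁻¹ := by
            rw [hc₀, div_mul_eq_mul_div, div_mul_cancel₀ _ hl.ne']
        _ ≤ _ := by gcongr
    have h3 : ρ ^ m ≤ σ ^ 3 := by
      rw [Real.log_inv, Real.log_inv] at h2
      rw [← Real.log_le_log_iff (by positivity) (by positivity), Real.log_pow, Real.log_pow]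
      push_cast
      linarith
    rw [div_le_iff₀ (by positivity)]
    have h4 : σ * (200 * (A + 1)) < 1 := by
      have := hσA.2
      rwa [lt_div_iff₀ (by positivity)] at this
    calc A * ρ ^ m ≤ A * σ ^ 3 := by gcongr
      _ = (A * σ) * σ ^ 2 := by ring
      _ ≤ 1 / 200 * σ ^ 2 := by
        gcongr
        nlinarith

end Asymptotics

/-! ### Neighbourhoods of a stable fixed point -/

section StableBall

variable {d : ℕ}

/-- The map `F` contracts the ball of radius `3 * R` around the fixed point `z₀`, in a norm `N`
equivalent to the Euclidean norm. -/
structure StableBall (F : EuclideanSpace ℝ (Fin d) → EuclideanSpace ℝ (Fin d))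
    (N : Seminorm ℝ (EuclideanSpace ℝ (Fin d))) (z₀ : EuclideanSpace ℝ (Fin d))
    (C ρ R : ℝ) : Prop where
  one_le : 1 ≤ C
  ρ_pos : 0 < ρ
  ρ_lt : ρ < 1
  R_pos : 0 < R
  norm_le : ∀ v, ‖v‖ ≤ N v
  le_norm : ∀ v, N v ≤ C * ‖v‖
  fixed : F z₀ = z₀
  contr : ∀ x y, N (x - z₀) ≤ 3 * R → N (y - z₀) ≤ 3 * R → N (F x - F y) ≤ ρ * N (x - y)

variable {F : EuclideanSpace ℝ (Fin d) → EuclideanSpace ℝ (Fin d)}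
  {N : Seminorm ℝ (EuclideanSpace ℝ (Fin d))} {z₀ : EuclideanSpace ℝ (Fin d)} {C ρ R : ℝ}
  {k : ℝ → EuclideanSpace ℝ (Fin d) → EuclideanSpace ℝ (Fin d) → ℝ≥0∞} {K : ℝ}

lemma StableBall.map_le (hs : StableBall F N z₀ C ρ R) {z : EuclideanSpace ℝ (Fin d)} {s : ℝ}
    (hsR : s ≤ 3 * R) (hz : N (z - z₀) ≤ s) : N (F z - z₀) ≤ ρ * s := by
  have h1 := hs.contr z z₀ (hz.trans hsR) (by simpa using hs.R_pos.le)
  rw [hs.fixed] at h1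
  exact h1.trans (mul_le_mul_of_nonneg_left hz hs.ρ_pos.le)

lemma StableBall.norm_sub_le (hs : StableBall F N z₀ C ρ R) {z y : EuclideanSpace ℝ (Fin d)}
    {s t : ℝ} (hsR : s ≤ 3 * R) (hs0 : 0 ≤ s) (hz : N (z - z₀) ≤ s) (hy : N (y - z₀) ≤ t) :
    ‖y - F z‖ ≤ s + t := by
  have h1 := hs.map_le hsR hz
  have h2 : ρ * s ≤ s := mul_le_of_le_one_left hs0 hs.ρ_lt.le
  have e : y - F z = (y - z₀) - (F z - z₀) := by abel
  calc ‖y - F z‖ ≤ N (y - F z) := hs.norm_le _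
    _ ≤ N (y - z₀) + N (F z - z₀) := by rw [e]; exact map_sub_le_add N _ _
    _ ≤ s + t := by linarith

/-- The exponential rate of the probability that the noise moves the chain by `ε`. -/
def exitRate (C K ε : ℝ) : ℝ := ε ^ 2 / (C ^ 2 * K)

/-- `F` maps the ball of radius `s` into the one of radius `ρ s`, so leaving radius `ρ s + ε`
requires noise of `N`-size at least `ε`, hence of Euclidean size at least `ε / C`. -/
lemma exit_le (hs : StableBall F N z₀ C ρ R) (hb : KernelBounds F k K) {σ : ℝ} (hσ : 0 < σ)
    {s ε : ℝ} (hsR : s ≤ 3 * R) (hε : 0 ≤ ε) {z : EuclideanSpace ℝ (Fin d)}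
    (hz : N (z - z₀) ≤ s) :
    stepOn (k σ) (N.closedBall z₀ (ρ * s + ε))ᶜ (fun _ => 1) z ≤
      ENNReal.ofReal (K * Real.exp (-(exitRate C K ε / σ ^ 2))) := by
  have hC := hs.one_le
  have hsub : (N.closedBall z₀ (ρ * s + ε))ᶜ ⊆ {y | ε / C ≤ ‖y - F z‖} := by
    intro y hy
    have h1 : ρ * s + ε < N (y - z₀) := by
      rw [Set.mem_compl_iff, Seminorm.mem_closedBall, not_le] at hy
      exact hy
    have h2 := hs.map_le hsR hz
    have e : y - z₀ = (y - F z) + (F z - z₀) := by abel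
    have h3 : N (y - z₀) ≤ N (y - F z) + N (F z - z₀) := by rw [e]; exact map_add_le_add N _ _
    have h4 := hs.le_norm (y - F z)
    change ε / C ≤ _
    rw [div_le_iff₀ (by linarith)]
    linarith
  calc stepOn (k σ) (N.closedBall z₀ (ρ * s + ε))ᶜ (fun _ => 1) z
      ≤ stepOn (k σ) {y | ε / C ≤ ‖y - F z‖} (fun _ => 1) z := stepOn_mono_set hsub
    _ ≤ ENNReal.ofReal (K * Real.exp (-((ε / C) ^ 2 / (K * σ ^ 2)))) := by
        simp only [stepOn, mul_one]
        exact hb.tail σ hσ z _ (by positivity)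
    _ = _ := by
        rw [exitRate]
        congr 4
        rw [div_pow, div_div, div_div, mul_assoc]

lemma exit_ball_le (hs : StableBall F N z₀ C ρ R) (hb : KernelBounds F k K) {σ : ℝ} (hσ : 0 < σ)
    {r : ℝ} (hr0 : 0 ≤ r) (hrR : r ≤ R) :
    ∀ z ∈ N.closedBall z₀ r, stepOn (k σ) (N.closedBall z₀ r)ᶜ (fun _ => 1) z ≤
      ENNReal.ofReal (K * Real.exp (-(exitRate C K ((1 - ρ) * r) / σ ^ 2))) := by
  intro z hz
  have hR := hs.R_pos
  have := exit_le hs hb hσ (s := r) (ε := (1 - ρ) * r) (by linarith)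
    (mul_nonneg (by linarith [hs.ρ_lt]) hr0) ((Seminorm.mem_closedBall N).1 hz)
  rwa [show ρ * r + (1 - ρ) * r = r by ring] at this

/-- Within radius `3 r` the Harnack exponent is at most `8 r K / σ ^ 2` times the distance of the
copies. After `m` contractions this is below 1/200, whose exponential is below 1.01. The additional
step is the merging one. -/
lemma coupling_le (hs : StableBall F N z₀ C ρ R) (hb : KernelBounds F k K) {σ : ℝ} (hσ : 0 < σ)
    {r : ℝ} (hr0 : 0 ≤ r) (hrR : r ≤ R) {m : ℕ} (hm : 16 * K * R ^ 2 * ρ ^ m / σ ^ 2 ≤ 1 / 200) :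
    ∀ f : EuclideanSpace ℝ (Fin d) → ℝ≥0∞, Measurable f →
      ∀ x ∈ N.closedBall z₀ r, ∀ x' ∈ N.closedBall z₀ r,
      (stepOn (k σ) (N.closedBall z₀ r))^[m + 1] f x ≤ ENNReal.ofReal (101 / 100) *
        (stepOn (k σ) (N.closedBall z₀ (3 * r)))^[m + 1] f x' := by
  intro f hf x hx x' hx'
  have hK := hb.one_le
  have hR := hs.R_pos
  obtain ⟨γ, -, hγ⟩ := hb.noise σ hσ
  rw [Seminorm.mem_closedBall] at hx hx'
  have hxx' : N (x - x') ≤ 2 * r := by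
    have e : x - x' = (x - z₀) - (x' - z₀) := by abel
    rw [e]
    exact (map_sub_le_add N _ _).trans (by linarith)
  refine (coupling_bound (K' := 8 * r * K / σ ^ 2) hs.le_norm hs.ρ_pos hs.ρ_lt hr0 (by positivity)
    (fun x y hx hy => hs.contr x y (by linarith) (by linarith)) (hb.measurable σ) hγ ?_ hf m x x'
    hx (by linarith) hxx').trans ?_
  · intro x x' y hx hx' hy
    refine (hb.harnack σ hσ x x' y).trans (mul_le_mul' (ENNReal.ofReal_le_ofReal
      (Real.exp_le_exp.2 ?_)) le_rfl)
    have h1 : ‖F x - F x'‖ ≤ N (x - x') := by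
      refine (hs.norm_le _).trans ((hs.contr x x' (by linarith) (by linarith)).trans ?_)
      exact mul_le_of_le_one_left (apply_nonneg N _) hs.ρ_lt.le
    have h2 := hs.norm_sub_le (s := 3 * r) (by linarith) (by linarith) hx hy
    have h3 := hs.norm_sub_le (s := 3 * r) (by linarith) (by linarith) hx' hy
    calc K * (‖F x - F x'‖ * (‖y - F x‖ + ‖y - F x'‖)) / σ ^ 2
        ≤ K * (N (x - x') * (8 * r)) / σ ^ 2 := by
          have : ‖y - F x‖ + ‖y - F x'‖ ≤ 8 * r := by linarith
          gcongr
      _ = _ := by ring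
  · refine mul_le_mul' (ENNReal.ofReal_le_ofReal ?_) le_rfl
    set t := 8 * r * K / σ ^ 2 * (ρ ^ m * N (x - x')) with ht
    have hρ := hs.ρ_pos
    have h0 : 0 ≤ N (x - x') := apply_nonneg N _
    have ht0 : 0 ≤ t := by positivity
    have ht1 : t ≤ 1 / 200 := by
      refine le_trans ?_ hm
      calc t ≤ 8 * R * K / σ ^ 2 * (ρ ^ m * (2 * R)) := by
            rw [ht]
            gcongr
            linarith
        _ = _ := by ring
    have h1 := Real.abs_exp_sub_one_le (x := t) (by rw [abs_of_nonneg ht0]; linarith)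
    rw [abs_of_nonneg ht0] at h1
    have := le_abs_self (Real.exp t - 1)
    linarith

end StableBall

/-! ### The alternative between tiny and non-tiny `B`, uniformly in `B`. -/

section Dichotomy

variable {d : ℕ} {F : EuclideanSpace ℝ (Fin d) → EuclideanSpace ℝ (Fin d)}
  {N : Seminorm ℝ (EuclideanSpace ℝ (Fin d))} {z₀ : EuclideanSpace ℝ (Fin d)} {C ρ R : ℝ}
  {k : ℝ → EuclideanSpace ℝ (Fin d) → EuclideanSpace ℝ (Fin d) → ℝ≥0∞} {K : ℝ}

/-- `B` is a measurable subset of the ball of radius `r₁`, and the other points of `M` are outside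
the ball of radius `3 * R`. -/
structure LocalTarget (N : Seminorm ℝ (EuclideanSpace ℝ (Fin d)))
    (z₀ : EuclideanSpace ℝ (Fin d)) (R r₁ : ℝ) (B M : Set (EuclideanSpace ℝ (Fin d))) : Prop where
  measurableSet_left : MeasurableSet B
  measurableSet_right : MeasurableSet M
  subset : B ⊆ M
  subset_ball : B ⊆ N.closedBall z₀ r₁
  ball_subset : N.closedBall z₀ (3 * R) ⊆ Mᶜ ∪ B

lemma seminorm_closedBall_mono {r s : ℝ} (h : r ≤ s) : N.closedBall z₀ r ⊆ N.closedBall z₀ s := by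
  intro y hy
  rw [Seminorm.mem_closedBall] at hy ⊢
  exact hy.trans h

lemma exitRate_pos {ε : ℝ} (hC : 1 ≤ C) (hK : 1 ≤ K) (hε : 0 < ε) : 0 < exitRate C K ε := by
  unfold exitRate
  positivity

/-- The chain reaches a small ball in a bounded number of steps, avoiding a set which is rarely
visited. -/
lemma half_le_iterate_reach (hs : StableBall F N z₀ C ρ R) (hb : KernelBounds F k K) {σ : ℝ}
    (hσ : 0 < σ) {ε r₁ : ℝ} (hε : 0 ≤ ε) (hεR : ρ * R + ε ≤ R) {m₁ : ℕ}
    (hm₁ : radius ρ ε m₁ R ≤ r₁) {B : Set (EuclideanSpace ℝ (Fin d))} (hB : MeasurableSet B)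
    {μ : ℝ≥0∞} (hμ : ∀ z, stepOn (k σ) B (fun _ => 1) z ≤ μ)
    (hsmall : m₁ * (ENNReal.ofReal (K * Real.exp (-(exitRate C K ε / σ ^ 2))) + μ) ≤ 2⁻¹) :
    ∀ z ∈ N.closedBall z₀ R, 2⁻¹ ≤
      (stepOn (k σ) (N.closedBall z₀ R \ B))^[m₁] ((N.closedBall z₀ r₁).indicator fun _ => 1) z := by
  have hR := hs.R_pos
  have hk := hb.measurable σ
  have hk1 := hb.lintegral_eq_one hσ
  set p := ENNReal.ofReal (K * Real.exp (-(exitRate C K ε / σ ^ 2))) with hp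
  have hU := measurableSet_seminorm_closedBall (z₀ := z₀) hs.le_norm R
  have hq : ∀ s ≤ R, ∀ z, N (z - z₀) ≤ s → 1 - (p + μ) ≤
      stepOn (k σ) ((N.closedBall z₀ R \ B) ∩ N.closedBall z₀ (ρ * s + ε)) (fun _ => 1) z := by
    intro s hsR z hz
    set A := N.closedBall z₀ (ρ * s + ε) with hA
    have hAm : MeasurableSet A := measurableSet_seminorm_closedBall hs.le_norm _
    have hAR : A ⊆ N.closedBall z₀ R :=
      seminorm_closedBall_mono (by nlinarith [hs.ρ_pos])
    have hdisj : Disjoint ((N.closedBall z₀ R \ B) ∩ A) B :=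
      Set.disjoint_left.2 fun w hw hwB => hw.1.2 hwB
    have hsub : A ⊆ ((N.closedBall z₀ R \ B) ∩ A) ∪ B := by
      intro w hw
      by_cases hwB : w ∈ B
      · exact Or.inr hwB
      · exact Or.inl ⟨⟨hAR hw, hwB⟩, hw⟩
    rw [tsub_le_iff_right]
    calc (1 : ℝ≥0∞) = stepOn (k σ) A (fun _ => 1) z + stepOn (k σ) Aᶜ (fun _ => 1) z :=
          (stepOn_compl_add hk1 hAm z).symm
      _ ≤ stepOn (k σ) (((N.closedBall z₀ R \ B) ∩ A) ∪ B) (fun _ => 1) z + p :=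
          add_le_add (stepOn_mono_set hsub) (exit_le hs hb hσ (by linarith) hε hz)
      _ = stepOn (k σ) ((N.closedBall z₀ R \ B) ∩ A) (fun _ => 1) z +
          stepOn (k σ) B (fun _ => 1) z + p := by rw [stepOn_union hB hdisj]
      _ ≤ stepOn (k σ) ((N.closedBall z₀ R \ B) ∩ A) (fun _ => 1) z + μ + p :=
          add_le_add (add_le_add le_rfl (hμ z)) le_rfl
      _ = _ := by ring
  intro z hz
  have h1 := pow_le_iterate_reach hs.le_norm hεR hs.ρ_pos.le hk (hU.diff hB) hq m₁ R le_rfl z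
    ((Seminorm.mem_closedBall N).1 hz)
  have h2 := one_le_one_sub_pow_add (p + μ) m₁
  have h3 : (2⁻¹ : ℝ≥0∞) ≤ (1 - (p + μ)) ^ m₁ := by
    have h4 : (2⁻¹ : ℝ≥0∞) + 2⁻¹ ≤ (1 - (p + μ)) ^ m₁ + 2⁻¹ := by
      rw [ENNReal.inv_two_add_inv_two]
      exact h2.trans (add_le_add le_rfl hsmall)
    exact (ENNReal.add_le_add_iff_right (by norm_num)).1 h4
  refine h3.trans (h1.trans (stepOn_iterate_mono ?_ m₁ z))
  exact Set.indicator_le_indicator_of_subset (seminorm_closedBall_mono hm₁) (fun _ => zero_le)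

/-- Bookkeeping for the dichotomy with `a = m₁ + 1`, `b = m + 1`, `w = σ⁻¹ ^ d`, and `x`
exponentially small. The exit probability is `K x ^ 8`, the probability of hitting a set of volume
`x ^ 2` is at most `K w x ^ 2`, and densities near the fixed point are at least `x / K`. These
powers of `x` are far enough apart for one condition to yield all requirements of both cases. -/
lemma smallness_bounds {a b K w x : ℝ} (ha : 1 ≤ a) (hb : 1 ≤ b) (hK : 1 ≤ K) (hw : 1 ≤ w)
    (hx : 0 < x) (h : 1000 * a * b * K ^ 4 * w ^ 2 * x ≤ 1) :
    101 / 100 * (b * (K * w * x ^ 2)) + b * (K * x ^ 8) ≤ 1 / 100 ∧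
    2 * (a * (K * x ^ 8 + K * w * x ^ 2)) * (b * (K * w + K * x ^ 8 * (K * w))) ≤
      1 / 100 * (K⁻¹ * x) ∧
    a * (K * w * x ^ 2) ≤ 1 / 4 ∧ b * (K * x ^ 8) ≤ 1 / 100 ∧
    (b + 1) * (2 * a * K ^ 2 * x ^ 5) ≤ 1 / 100 := by
  set T := a * b * K ^ 4 * w ^ 2 * x with hT
  have hT1 : T ≤ 1 / 1000 := by linarith
  have hT0 : 0 ≤ T := by positivity
  have hxT : x ≤ T := by
    calc x = 1 * 1 * 1 ^ 4 * 1 ^ 2 * x := by ring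
      _ ≤ T := by rw [hT]; gcongr
  have hx1 : x ≤ 1 / 1000 := hxT.trans hT1
  have hx82 : x ^ 8 ≤ x ^ 2 := pow_le_pow_of_le_one hx.le (by linarith) (by norm_num)
  have hx52 : x ^ 5 ≤ x ^ 2 := pow_le_pow_of_le_one hx.le (by linarith) (by norm_num)
  have hKw : K * x ^ 8 ≤ K * w * x ^ 2 := by
    calc K * x ^ 8 = K * 1 * x ^ 8 := by ring
      _ ≤ _ := by gcongr
  have hTx : T * x ≤ 1 / 1000 := by nlinarith
  have hb1 : b * (K * w * x ^ 2) ≤ 1 / 1000 := by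
    refine le_trans ?_ hTx
    calc b * (K * w * x ^ 2) = 1 * b * K ^ 1 * w ^ 1 * x * x := by ring
      _ ≤ T * x := by rw [hT]; gcongr <;> norm_num
  have ha1 : a * (K * w * x ^ 2) ≤ 1 / 1000 := by
    refine le_trans ?_ hTx
    calc a * (K * w * x ^ 2) = a * 1 * K ^ 1 * w ^ 1 * x * x := by ring
      _ ≤ T * x := by rw [hT]; gcongr <;> norm_num
  have hb2 : b * (K * x ^ 8) ≤ 1 / 1000 := by
    refine le_trans ?_ hb1
    gcongr
  refine ⟨by linarith, ?_, by linarith, by linarith, ?_⟩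
  · have h1 : K * x ^ 8 * (K * w) ≤ K * (K * w) := by
      have : K * x ^ 8 ≤ K * 1 := by
        gcongr
        exact pow_le_one₀ hx.le (by linarith)
      nlinarith [mul_le_mul_of_nonneg_right this (show 0 ≤ K * w by positivity)]
    have h2 : K * w ≤ K * (K * w) := le_mul_of_one_le_left (by positivity) hK
    calc 2 * (a * (K * x ^ 8 + K * w * x ^ 2)) * (b * (K * w + K * x ^ 8 * (K * w)))
        ≤ 2 * (a * (K * w * x ^ 2 + K * w * x ^ 2)) * (b * (K * (K * w) + K * (K * w))) := by
          gcongr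
      _ = 8 * (K⁻¹ * K) * a * b * K ^ 3 * w ^ 2 * x * x := by
          rw [inv_mul_cancel₀ (by positivity)]; ring
      _ = 8 * T * (K⁻¹ * x) := by rw [hT]; ring
      _ ≤ 1 / 100 * (K⁻¹ * x) := by
          gcongr
          linarith
  · have h1 : b + 1 ≤ 2 * b := by linarith
    have h2 : T * x * 4 ≤ 1 / 100 := by linarith
    refine le_trans ?_ h2
    calc (b + 1) * (2 * a * K ^ 2 * x ^ 5) ≤ 2 * b * (2 * a * K ^ 2 * x ^ 2) := by gcongr
      _ = a * b * K ^ 2 * 1 ^ 2 * x * x * 4 := by ring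
      _ ≤ _ := by rw [hT]; gcongr; norm_num

/-- For small noise, either the trace density is nearly independent of the starting point,
or the probabilities that the trace process stays in `B` for a long time are. The estimates are
uniform in `B`. -/
theorem exists_local_dichotomy (hs : StableBall F N z₀ C ρ R) (hb : KernelBounds F k K) :
    ∃ r₁ : ℝ, 0 < r₁ ∧ r₁ ≤ R ∧ ∃ c : ℝ, 0 < c ∧ ∀ᶠ σ in 𝓝[>] (0 : ℝ), ∃ m : ℕ,
      (m : ℝ) ≤ c * Real.log σ⁻¹ ∧ ∀ B M, LocalTarget N z₀ R r₁ B M → ∀ H₀ ≠ ∞,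
      (∀ z ∈ N.closedBall z₀ R, ∀ y, traceDensity (k σ) M z y ≤ H₀) →
      (∀ x ∈ B, ∀ x' ∈ B, ∀ y ∈ B,
        traceDensity (k σ) M x y ≤ ENNReal.ofReal (11 / 10) * traceDensity (k σ) M x' y) ∨
      ∀ n ≥ m, ∀ x ∈ B, ∀ x' ∈ B, (stepOn (traceDensity (k σ) M) B)^[n] (fun _ => 1) x ≤
        ENNReal.ofReal (11 / 10) * (stepOn (traceDensity (k σ) M) B)^[n] (fun _ => 1) x' := by
  have hK := hb.one_le
  have hR := hs.R_pos
  have hC := hs.one_le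
  have hρ0 := hs.ρ_pos
  have hρ1 := hs.ρ_lt
  have h1ρ : 0 < 1 - ρ := by linarith
  set P := exitRate C K ((1 - ρ) * R) with hPdef
  have hP : 0 < P := exitRate_pos hC hK (by positivity)
  -- Ensures `K (2 r₁) ^ 2 ≤ P / 8`: moving inside the ball of radius `r₁` costs at most an eighth
  -- of the exponential rate of leaving the ball of radius `R`. This radius does not depend on `B`.
  set r₁ := min (R / 2) (min 1 (P / (32 * K))) with hr₁def
  have hr₁ : 0 < r₁ := by positivity
  have hr₁R : r₁ ≤ R / 2 := min_le_left _ _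
  have hr₁1 : r₁ ≤ 1 := (min_le_right _ _).trans (min_le_left _ _)
  have hr₁P : r₁ * (32 * K) ≤ P := by
    rw [← le_div_iff₀ (by positivity)]
    exact (min_le_right _ _).trans (min_le_right _ _)
  set ε := (1 - ρ) * r₁ / 2 with hεdef
  have hε : 0 < ε := by positivity
  have hεR : ρ * R + ε ≤ R := by
    have : (1 - ρ) * r₁ ≤ (1 - ρ) * R := mul_le_mul_of_nonneg_left (by linarith) h1ρ.le
    linarith
  obtain ⟨m₁, hm₁⟩ := exists_radius_le (ε := ε) (r := r₁) hρ0 hρ1 (by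
    rw [hεdef, div_lt_iff₀ h1ρ]; nlinarith) R
  set P₁ := exitRate C K ε with hP₁def
  have hP₁ : 0 < P₁ := exitRate_pos hC hK hε
  obtain ⟨c, hc, hsteps⟩ := exists_steps hρ0 hρ1 (A := 16 * K * R ^ 2) (by positivity)
  refine ⟨r₁, hr₁, by linarith, 2 * c, by positivity, ?_⟩
  filter_upwards [Ioo_mem_nhdsGT (show (0 : ℝ) < 1 by norm_num),
    -- With `r₁ ≤ R / 2` this keeps the Euclidean ball of radius `σ` around a point of `B` inside
    -- the `N`-ball of radius `R`, as the mean value bound requires.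
    Ioo_mem_nhdsGT (show (0 : ℝ) < R / (2 * C) by positivity), hsteps,
    -- The power `2 * d + 1` consists of `2 * d` from `w ^ 2` and one from bounding the number of
    -- steps by a multiple of `σ⁻¹`.
    eventually_pow_mul_exp_le (c := 1000 * (m₁ + 1) * c * K ^ 4) (a := P / 8) (ε := 1)
      (by positivity) (by positivity) (by norm_num) (2 * d + 1),
    eventually_pow_mul_exp_le (c := m₁ * K) (a := P₁) (ε := 1 / 4)
      (by positivity) hP₁ (by norm_num) 0] with σ hσ1 hσR hst hZ hQ
  obtain ⟨m, hmlog, hmρ⟩ := hst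
  have hσ := hσ1.1
  have hlogσ := log_inv_le hσ
  set x := Real.exp (-(P / 8 / σ ^ 2)) with hx
  have hx0 : 0 < x := Real.exp_pos _
  set w := σ⁻¹ ^ d with hw
  have hw1 : 1 ≤ w := one_le_pow₀ ((one_le_inv₀ hσ).2 hσ1.2.le)
  have hbZ : 1000 * ((m₁ : ℝ) + 1) * ((m : ℝ) + 1) * K ^ 4 * w ^ 2 * x ≤ 1 := by
    refine le_trans ?_ hZ
    calc 1000 * ((m₁ : ℝ) + 1) * ((m : ℝ) + 1) * K ^ 4 * w ^ 2 * x
        ≤ 1000 * ((m₁ : ℝ) + 1) * (c * σ⁻¹) * K ^ 4 * w ^ 2 * x := by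
          gcongr
          exact hmlog.trans (by gcongr)
      _ = _ := by rw [hw]; ring
  obtain ⟨hn1, hn2, hn3, hn4, hn5⟩ := smallness_bounds (by simp) (by simp) hK hw1 hx0 hbZ
  have hx8 : x ^ 8 = Real.exp (-(P / σ ^ 2)) := by
    rw [hx, ← Real.exp_nat_mul]; congr 1; push_cast; ring
  set U := N.closedBall z₀ R with hU
  have hUm : MeasurableSet U := measurableSet_seminorm_closedBall hs.le_norm R
  have hU'm := measurableSet_seminorm_closedBall (z₀ := z₀) hs.le_norm (3 * R)
  have hUU' : U ⊆ N.closedBall z₀ (3 * R) := seminorm_closedBall_mono (by linarith)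
  have hVm := measurableSet_seminorm_closedBall (z₀ := z₀) hs.le_norm r₁
  have hk := hb.measurable σ
  have hk1 := hb.lintegral_eq_one hσ
  have hp : ∀ z ∈ U, stepOn (k σ) Uᶜ (fun _ => 1) z ≤ ENNReal.ofReal (K * x ^ 8) := by
    rw [hx8]
    exact exit_ball_le hs hb hσ hR.le le_rfl
  have hcoup := coupling_le hs hb hσ hR.le le_rfl hmρ
  have hm1cast : ((m₁ : ℝ≥0∞) + 1) = ENNReal.ofReal ((m₁ : ℝ) + 1) := by
    rw [ENNReal.ofReal_add (by positivity) (by norm_num), ENNReal.ofReal_natCast,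
      ENNReal.ofReal_one]
  have hm1cast' : (((m + 1 : ℕ) : ℝ≥0∞)) = ENNReal.ofReal ((m : ℝ) + 1) := by
    rw [← ENNReal.ofReal_natCast]; push_cast; rfl
  have h2cast : (2 : ℝ≥0∞) = ENNReal.ofReal 2 := by simp
  -- The coupling takes `m + 1` steps, and the comparison of survival probabilities needs one more.
  refine ⟨m + 2, by push_cast; linarith, fun B M hT H₀ hH₀ hH => ?_⟩
  have hB := hT.measurableSet_left
  have hBU : B ⊆ U := hT.subset_ball.trans (seminorm_closedBall_mono (by linarith))
  have hlow : ∀ z ∈ N.closedBall z₀ r₁, ∀ y ∈ B, ENNReal.ofReal (K⁻¹ * x) ≤ k σ z y := by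
    intro z hz y hy
    refine le_trans (ENNReal.ofReal_le_ofReal ?_) (hb.lower σ hσ hσ1.2 z y)
    gcongr
    rw [hx]
    apply Real.exp_le_exp.2
    have h1 := hs.norm_sub_le (s := r₁) (t := r₁) (by linarith) hr₁.le
      ((Seminorm.mem_closedBall N).1 hz) ((Seminorm.mem_closedBall N).1 (hT.subset_ball hy))
    have h2 : K * ‖y - F z‖ ^ 2 ≤ P / 8 := by
      calc K * ‖y - F z‖ ^ 2 ≤ K * (r₁ + r₁) ^ 2 := by gcongr
        _ = 4 * K * r₁ * r₁ := by ring
        _ ≤ 4 * K * r₁ * 1 := by gcongr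
        _ ≤ P / 8 := by linarith
    gcongr
  -- The threshold `x ^ 2` lies between the scales: below it, hitting `B` is much rarer than the
  -- gain `x / K` of a visit; above it, hitting `B` has probability at least `x ^ 3 / K` near the
  -- fixed point, far more than the exit probability `K x ^ 8`.
  rcases le_or_gt (volume B) (ENNReal.ofReal (x ^ 2)) with hBx | hBx
  · left
    have hμ : ∀ z, stepOn (k σ) B (fun _ => 1) z ≤ ENNReal.ofReal (K * w * x ^ 2) := by
      intro z
      simp only [stepOn, mul_one]
      calc ∫⁻ y in B, k σ z y ≤ ∫⁻ y in B, ENNReal.ofReal (K * w) :=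
            lintegral_mono fun y => hb.upper σ hσ z y
        _ = ENNReal.ofReal (K * w) * volume B := by rw [setLIntegral_const]
        _ ≤ ENNReal.ofReal (K * w) * ENNReal.ofReal (x ^ 2) := by gcongr
        _ = _ := by rw [← ENNReal.ofReal_mul (by positivity)]
    intro z hz z' hz' y hy
    have hreach := half_le_iterate_reach hs hb hσ hε.le hεR hm₁ hB hμ (by
      rw [← ENNReal.ofReal_add (by positivity) (by positivity), ← ENNReal.ofReal_natCast,
        ← ENNReal.ofReal_mul (by positivity),
        show (2⁻¹ : ℝ≥0∞) = ENNReal.ofReal (1 / 2) by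
          rw [one_div, ENNReal.ofReal_inv_of_pos (by norm_num)]; simp]
      apply ENNReal.ofReal_le_ofReal
      have h1 : (m₁ : ℝ) * (K * w * x ^ 2) ≤ (m₁ + 1) * (K * w * x ^ 2) := by
        gcongr; linarith
      rw [pow_zero, mul_one] at hQ
      linarith)
    refine traceDensity_harnack_of_small hk hk1 hT.measurableSet_right hB hT.subset hUm hU'm hVm
      hBU hT.ball_subset hUU' (p := ENNReal.ofReal (K * x ^ 8))
      (κ := ENNReal.ofReal (K * w)) (C' := ENNReal.ofReal (K * w))
      (κ' := ENNReal.ofReal (K⁻¹ * x)) (m := m + 1) hp hcoup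
      (fun z => hb.upper σ hσ z y) hμ (fun z => ?_) (fun z hz => hlow z hz y hy)
      (by simp only [ne_eq, ENNReal.ofReal_eq_zero, not_le]; positivity) ENNReal.ofReal_ne_top
      hreach (fun z hz => hH z hz y) hH₀ le_rfl ?_ ?_ z (hBU hz) z' (hBU hz')
    · refine (hb.meanValue σ hσ z y).trans (mul_le_mul' le_rfl ?_)
      simp only [stepOn, mul_one]
      refine lintegral_mono_set fun v hv => ?_
      rw [Seminorm.mem_closedBall]
      have h1 : N (v - y) ≤ C * σ := by
        refine (hs.le_norm _).trans (mul_le_mul_of_nonneg_left ?_ (by linarith))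
        have := Metric.mem_ball.1 hv
        rw [dist_eq_norm] at this
        exact this.le
      have h2 : N (v - z₀) ≤ N (v - y) + N (y - z₀) := by
        have e : v - z₀ = (v - y) + (y - z₀) := by abel
        rw [e]; exact map_add_le_add N _ _
      have h3 := (Seminorm.mem_closedBall N).1 (hT.subset_ball hy)
      have h4 : σ * (2 * C) < R := by
        have := hσR.2
        rwa [lt_div_iff₀ (by positivity)] at this
      linarith
    · rw [hm1cast', ← ENNReal.ofReal_mul (by positivity), ← ENNReal.ofReal_mul (by positivity),
        ← ENNReal.ofReal_mul (by positivity), ← ENNReal.ofReal_add (by positivity) (by positivity)]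
      exact ENNReal.ofReal_le_ofReal hn1
    · rw [hm1cast', hm1cast, h2cast, ← ENNReal.ofReal_add (by positivity) (by positivity),
        ← ENNReal.ofReal_mul (p := K * x ^ 8) (by positivity),
        ← ENNReal.ofReal_add (by positivity) (by positivity),
        ← ENNReal.ofReal_mul (by positivity), ← ENNReal.ofReal_mul (by positivity),
        ← ENNReal.ofReal_mul (by positivity), ← ENNReal.ofReal_mul (by positivity),
        ← ENNReal.ofReal_mul (by positivity)]
      exact ENNReal.ofReal_le_ofReal hn2
  · right
    intro n hn
    have hreach := half_le_iterate_reach hs hb hσ hε.le hεR hm₁ MeasurableSet.empty (μ := 0)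
      (fun z => by simp [stepOn]) (by
      rw [add_zero, ← ENNReal.ofReal_natCast,
        ← ENNReal.ofReal_mul (by positivity),
        show (2⁻¹ : ℝ≥0∞) = ENNReal.ofReal (1 / 2) by
          rw [one_div, ENNReal.ofReal_inv_of_pos (by norm_num)]; simp]
      apply ENNReal.ofReal_le_ofReal
      rw [pow_zero, mul_one] at hQ
      linarith)
    rw [Set.sdiff_empty] at hreach
    have hη := one_sub_le_trace_mass hk hk1 hB hT.subset hUm hVm hBU
      (hUU'.trans hT.ball_subset) (b := ENNReal.ofReal (K⁻¹ * x * x ^ 2))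
      (η := ENNReal.ofReal (2 * (m₁ + 1) * K ^ 2 * x ^ 5)) hp (fun z hz => ?_)
      (by simp only [ne_eq, ENNReal.ofReal_eq_zero, not_le]; positivity) ENNReal.ofReal_ne_top
      hreach ?_
    · refine trace_iterate_one_comparison hk hk1 hT.measurableSet_right hB hT.subset hUm hU'm
        hBU hT.ball_subset hUU' (m := m + 1) hp (fun z hz => hη z (hBU hz)) hcoup le_rfl ?_ ?_ hn
      · rw [hm1cast', ← ENNReal.ofReal_mul (by positivity)]
        exact ENNReal.ofReal_le_ofReal hn4
      · rw [hm1cast', ← ENNReal.ofReal_one, ← ENNReal.ofReal_add (by positivity) (by norm_num),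
          ← ENNReal.ofReal_mul (by positivity)]
        exact ENNReal.ofReal_le_ofReal hn5
    · calc ENNReal.ofReal (K⁻¹ * x * x ^ 2) = ENNReal.ofReal (K⁻¹ * x) * ENNReal.ofReal (x ^ 2) :=
            ENNReal.ofReal_mul (by positivity)
        _ ≤ ENNReal.ofReal (K⁻¹ * x) * volume B := by gcongr
        _ = ∫⁻ y in B, ENNReal.ofReal (K⁻¹ * x) := by rw [setLIntegral_const]
        _ ≤ _ := by
          simp only [stepOn, mul_one]
          exact setLIntegral_mono' hB (hlow z hz)
    · rw [hm1cast, h2cast, ← ENNReal.ofReal_mul (by positivity), ← ENNReal.ofReal_mul (by norm_num),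
        ← ENNReal.ofReal_mul (by positivity)]
      apply le_of_eq
      congr 1
      field_simp

end Dichotomy

/-! ### The Harnack inequality near one stable fixed point. -/

section LocalHarnack

variable {d : ℕ} {F : EuclideanSpace ℝ (Fin d) → EuclideanSpace ℝ (Fin d)}
  {N : Seminorm ℝ (EuclideanSpace ℝ (Fin d))} {z₀ : EuclideanSpace ℝ (Fin d)} {C ρ R : ℝ}
  {k : ℝ → EuclideanSpace ℝ (Fin d) → EuclideanSpace ℝ (Fin d) → ℝ≥0∞} {K : ℝ}

lemma iterDensity_le_const {k : EuclideanSpace ℝ (Fin d) → EuclideanSpace ℝ (Fin d) → ℝ≥0∞}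
    {B : Set (EuclideanSpace ℝ (Fin d))} (hk : Measurable (Function.uncurry k))
    (hB : MeasurableSet B) (hmass : ∀ x, stepOn k B (fun _ => 1) x ≤ 1)
    {y : EuclideanSpace ℝ (Fin d)} {c : ℝ≥0∞} (hc : ∀ x ∈ B, k x y ≤ c) (n : ℕ) :
    ∀ x ∈ B, iterDensity k B (n + 1) x y ≤ c := by
  simp only [iterDensity_succ]
  induction n with
  | zero => exact hc
  | succ n ih =>
    intro x _
    rw [Function.iterate_succ_apply']
    calc _ ≤ c * stepOn k B (fun _ => 1) x := stepOn_le_const hB hk ih x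
      _ ≤ c * 1 := by gcongr; exact hmass x
      _ = c := mul_one c

lemma kernel_lower_of_mem_ball (hs : StableBall F N z₀ C ρ R) (hb : KernelBounds F k K) {r₁ : ℝ}
    (hr₁R : r₁ ≤ R) {σ : ℝ} (hσ : 0 < σ) (hσ1 : σ < 1) {x y : EuclideanSpace ℝ (Fin d)}
    (hx : x ∈ N.closedBall z₀ R) (hy : y ∈ N.closedBall z₀ r₁) :
    ENNReal.ofReal (Real.exp (-((K * (2 * R) ^ 2 + K) / σ ^ 2))) ≤ k σ x y := by
  have hR := hs.R_pos
  refine hb.exp_le hσ hσ1 ?_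
  have := hs.norm_sub_le (by linarith) hR.le ((Seminorm.mem_closedBall N).1 hx)
    ((Seminorm.mem_closedBall N).1 hy)
  linarith

/-- Harnack inequality for the iterated trace density, for noise which is small compared to `B`. -/
theorem exists_harnack_of_small_noise (hs : StableBall F N z₀ C ρ R) (hb : KernelBounds F k K)
    {r₁ : ℝ} (hr₁R : r₁ ≤ R) {B M : Set (EuclideanSpace ℝ (Fin d))}
    (hT : LocalTarget N z₀ R r₁ B M) {r : ℝ} (hr : 0 < r) (hrR : r ≤ R)
    (hrB : N.closedBall z₀ (3 * r) ⊆ B) {J : ℝ} (hJ0 : 0 ≤ J)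
    (hJ : ∀ᶠ σ in 𝓝[>] (0 : ℝ), ∀ x ∈ B, ∀ y,
      traceDensity (k σ) M x y ≤ ENNReal.ofReal (Real.exp (J / σ ^ 2))) :
    ∃ c : ℝ, 0 < c ∧ ∀ᶠ σ in 𝓝[>] (0 : ℝ), ∃ T : ℕ, (T : ℝ) + 1 ≤ c * Real.log σ⁻¹ ∧
      ∀ x ∈ B, ∀ x' ∈ B, ∀ y ∈ B, iterDensity (traceDensity (k σ) M) B (T + 1) x y ≤
        ENNReal.ofReal (3 / 2) * iterDensity (traceDensity (k σ) M) B (T + 1) x' y := by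
  have hK := hb.one_le
  have hR := hs.R_pos
  have hC := hs.one_le
  have hρ0 := hs.ρ_pos
  have hρ1 := hs.ρ_lt
  have h1ρ : 0 < 1 - ρ := by linarith
  set ε := (1 - ρ) * r / 2 with hεdef
  have hε : 0 < ε := by positivity
  have hεR : ρ * R + ε ≤ R := by nlinarith
  have hεr : ρ * r + ε ≤ r := by nlinarith
  obtain ⟨m₂, hm₂⟩ := exists_radius_le (ε := ε) (r := r) hρ0 hρ1 (by
    rw [hεdef, div_lt_iff₀ h1ρ]; nlinarith) R
  set P := exitRate C K ε with hPdef
  have hP : 0 < P := exitRate_pos hC hK hε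
  set J' := K * (2 * R) ^ 2 + K with hJ'
  have hJ'0 : 0 ≤ J' := by positivity
  clear_value J'
  -- Each block gains at least `exp (-(P / 2) / σ ^ 2)`, half the rate being spent on the length of
  -- the block. The upper bound `exp (J / σ ^ 2)` and the lower bound `exp (-J' / σ ^ 2)` are thus
  -- overcome in a number of blocks independent of `σ`; the summand one leaves room for the factor
  -- 1/100.
  set j₀ := ⌈(J + J' + 1) / (P / 2)⌉₊ with hj₀
  have hj₀P : J + J' + 1 ≤ j₀ * (P / 2) := by
    rw [← div_le_iff₀ (by positivity)]
    exact Nat.le_ceil _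
  obtain ⟨c, hc, hsteps⟩ := exists_steps hρ0 hρ1 (A := 16 * K * R ^ 2) (by positivity)
  refine ⟨(j₀ + 2) * (1 + m₂) * c, by positivity, ?_⟩
  filter_upwards [Ioo_mem_nhdsGT (show (0 : ℝ) < 1 by norm_num), hJ, hsteps,
    eventually_pow_mul_exp_le (c := (j₀ + 1) * (1 + m₂) * c * K) (a := P) (ε := 1 / 100)
      (by positivity) hP (by norm_num) 1,
    eventually_pow_mul_exp_le (c := (1 + m₂) * c * K) (a := P / 2) (ε := 1)
      (by positivity) (by positivity) (by norm_num) 1,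
    eventually_pow_mul_exp_le (c := 1) (a := 1) (ε := 1 / 100)
      (by positivity) (by norm_num) (by norm_num) 0] with σ hσ1 hJσ hst hE1 hE2 hE3
  obtain ⟨m, hmlog, hmρ⟩ := hst
  have hσ := hσ1.1
  have hlogσ := log_inv_le hσ
  rw [pow_zero, one_mul, one_mul] at hE3
  rw [pow_one] at hE1 hE2
  set n : ℕ := m + 1 + m₂ with hn
  have hnlog : (n : ℝ) ≤ (1 + m₂) * c * Real.log σ⁻¹ := by
    have h1 : (1 : ℝ) ≤ c * Real.log σ⁻¹ := le_trans (by simp) hmlog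
    have h2 : (m₂ : ℝ) * 1 ≤ m₂ * (c * Real.log σ⁻¹) := by gcongr
    rw [hn]
    push_cast
    linarith
  have hnσ : (n : ℝ) ≤ (1 + m₂) * c * σ⁻¹ := hnlog.trans (by gcongr)
  have hn1 : (1 : ℝ) ≤ n := by
    rw [hn]
    push_cast
    linarith [(Nat.cast_nonneg m : (0 : ℝ) ≤ m), (Nat.cast_nonneg m₂ : (0 : ℝ) ≤ m₂)]
  have hm₂n : (m₂ : ℝ) ≤ n := by rw [hn]; push_cast; linarith [(Nat.cast_nonneg m : (0:ℝ) ≤ m)]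
  set T := j₀ * n + m₂ with hTdef
  have hTn : (T : ℝ) ≤ (j₀ + 1) * n := by
    rw [hTdef]; push_cast; linarith
  set y₀ := Real.exp (-(P / σ ^ 2)) with hy₀
  have hy₀0 : 0 < y₀ := Real.exp_pos _
  have hTq : (T : ℝ) * (K * y₀) ≤ 1 / 100 := by
    calc (T : ℝ) * (K * y₀) ≤ (j₀ + 1) * ((1 + m₂) * c * σ⁻¹) * (K * y₀) := by
          gcongr
          exact hTn.trans (by gcongr)
      _ = (j₀ + 1) * (1 + m₂) * c * K * σ⁻¹ * y₀ := by ring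
      _ ≤ _ := hE1
  have hnq : (n : ℝ) * (K * y₀) ≤ 1 / 100 := by
    calc (n : ℝ) * (K * y₀) ≤ 1 * ((1 + m₂) * c * σ⁻¹) * (K * y₀) := by
          gcongr
          rwa [one_mul]
      _ ≤ (j₀ + 1) * ((1 + m₂) * c * σ⁻¹) * (K * y₀) := by
          gcongr
          linarith [(Nat.cast_nonneg j₀ : (0:ℝ) ≤ j₀)]
      _ = (j₀ + 1) * (1 + m₂) * c * K * σ⁻¹ * y₀ := by ring
      _ ≤ _ := hE1
  have hnq2 : (n : ℝ) * (K * y₀) ≤ Real.exp (-(P / 2 / σ ^ 2)) := by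
    have e : y₀ = Real.exp (-(P / 2 / σ ^ 2)) * Real.exp (-(P / 2 / σ ^ 2)) := by
      rw [hy₀, ← Real.exp_add]; congr 1; ring
    calc (n : ℝ) * (K * y₀) ≤ ((1 + m₂) * c * σ⁻¹) * (K * y₀) := by gcongr
      _ = (1 + m₂) * c * K * σ⁻¹ * Real.exp (-(P / 2 / σ ^ 2)) * Real.exp (-(P / 2 / σ ^ 2)) := by
          rw [e]; ring
      _ ≤ 1 * Real.exp (-(P / 2 / σ ^ 2)) := by gcongr
      _ = _ := one_mul _
  have hpow : ((n : ℝ) * (K * y₀)) ^ j₀ * Real.exp (J / σ ^ 2) ≤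
      1 / 100 * Real.exp (-(J' / σ ^ 2)) := by
    calc ((n : ℝ) * (K * y₀)) ^ j₀ * Real.exp (J / σ ^ 2)
        ≤ Real.exp (-(P / 2 / σ ^ 2)) ^ j₀ * Real.exp (J / σ ^ 2) := by gcongr
      _ = Real.exp (-((j₀ * (P / 2) - J) / σ ^ 2)) := by
          rw [← Real.exp_nat_mul, ← Real.exp_add]; congr 1; ring
      _ ≤ Real.exp (-((1 + J') / σ ^ 2)) := by
          apply Real.exp_le_exp.2
          apply neg_le_neg
          gcongr
          linarith
      _ = Real.exp (-(1 / σ ^ 2)) * Real.exp (-(J' / σ ^ 2)) := by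
          rw [← Real.exp_add]; congr 1; ring
      _ ≤ _ := by gcongr
  have hk := hb.measurable σ
  have hk1 := hb.lintegral_eq_one hσ
  have hB := hT.measurableSet_left
  have hBR : B ⊆ N.closedBall z₀ R := hT.subset_ball.trans (seminorm_closedBall_mono hr₁R)
  have hp' : ∀ s ≤ R, ∀ z, N (z - z₀) ≤ s → stepOn (k σ) (N.closedBall z₀ (ρ * s + ε))ᶜ
      (fun _ => 1) z ≤ ENNReal.ofReal (K * y₀) := fun s hsR z hz =>
    exit_le hs hb hσ (by linarith) hε.le hz
  have hp : ∀ z ∈ N.closedBall z₀ r, stepOn (k σ) (N.closedBall z₀ r)ᶜ (fun _ => 1) z ≤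
      ENNReal.ofReal (K * y₀) := fun z hz =>
    (stepOn_mono_set (Set.compl_subset_compl.2 (seminorm_closedBall_mono hεr))).trans
      (hp' r hrR z ((Seminorm.mem_closedBall N).1 hz))
  have hcastmul : ∀ i : ℕ, (i : ℝ≥0∞) * ENNReal.ofReal (K * y₀) =
      ENNReal.ofReal (i * (K * y₀)) := fun i => by
    rw [ENNReal.ofReal_mul (p := i) (by positivity), ENNReal.ofReal_natCast]
  have hsum : ((m + 1 : ℕ) : ℝ≥0∞) * ENNReal.ofReal (K * y₀) + m₂ * ENNReal.ofReal (K * y₀) =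
      ENNReal.ofReal (n * (K * y₀)) := by
    rw [← add_mul, ← Nat.cast_add, hcastmul]
  refine ⟨T, ?_, fun x hx x' hx' y hy => ?_⟩
  · calc (T : ℝ) + 1 ≤ (j₀ + 2) * n := by linarith
      _ ≤ (j₀ + 2) * ((1 + m₂) * c * Real.log σ⁻¹) := by gcongr
      _ = _ := by ring
  · refine iterDensity_harnack_of_ball (j₀ := j₀) (m := m + 1) (m₂ := m₂) (r := r)
      (U := N.closedBall z₀ (3 * r)) (F₀ := ENNReal.ofReal (Real.exp (J / σ ^ 2)))
      (a₀ := ENNReal.ofReal (Real.exp (-(J' / σ ^ 2)))) hs.le_norm hεR hρ0.le hk hk1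
      hT.measurableSet_right hB hT.subset (measurableSet_seminorm_closedBall hs.le_norm _) hrB
      (seminorm_closedBall_mono (by linarith)) hBR
      ((seminorm_closedBall_mono (by linarith)).trans hT.ball_subset) (by omega) hm₂ hp hp'
      (coupling_le hs hb hσ hr.le hrR hmρ) le_rfl hTdef ?_ ?_ ?_ (fun x hx => hJσ x hx y)
      (fun x hx => ?_) ?_ x hx x' hx'
    · rw [hcastmul]
      exact ENNReal.ofReal_le_ofReal hTq
    · rw [hcastmul]
      refine ENNReal.ofReal_le_ofReal (le_trans ?_ hnq)
      gcongr
    · rw [hsum]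
      exact ENNReal.ofReal_le_ofReal hnq
    · refine le_trans ?_ (le_traceDensity x y)
      rw [hJ']
      exact kernel_lower_of_mem_ball hs hb hr₁R hσ hσ1.2 (seminorm_closedBall_mono hrR hx)
        (hT.subset_ball hy)
    · rw [hsum, ← ENNReal.ofReal_pow (by positivity), ← ENNReal.ofReal_mul (by positivity),
        ← ENNReal.ofReal_mul (by norm_num)]
      exact ENNReal.ofReal_le_ofReal hpow

/-- Combination of the nearly constant ratio of iterates with the comparison of the iterates of the
constant function one. -/
lemma le_of_ratio {A A' q q' : ℝ≥0∞} (h : A * q' ≤ ENNReal.ofReal (11 / 10) * (A' * q))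
    (hq : q ≤ ENNReal.ofReal (11 / 10) * q') (h0 : q' ≠ 0) (ht : q' ≠ ∞) :
    A ≤ ENNReal.ofReal (3 / 2) * A' := by
  refine (ENNReal.mul_le_mul_iff_left h0 ht).1 ?_
  calc A * q' ≤ ENNReal.ofReal (11 / 10) * (A' * q) := h
    _ ≤ ENNReal.ofReal (11 / 10) * (A' * (ENNReal.ofReal (11 / 10) * q')) := by gcongr
    _ = ENNReal.ofReal (11 / 10) * ENNReal.ofReal (11 / 10) * A' * q' := by ring
    _ ≤ _ := by
      rw [← ENNReal.ofReal_mul (by norm_num)]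
      gcongr
      norm_num

/-- Uniform positivity of the trace process near one stable fixed point. -/
theorem exists_local_harnack (hb : KernelBounds F k K) (hF : ContDiff ℝ 2 F)
    (hz₀ : IsLinearlyStable F z₀) {R₀ ε₀ : ℝ} (hε₀ : 0 < ε₀)
    (hcontr : ∀ x, R₀ ≤ ‖x‖ → ‖F x‖ ^ 2 ≤ ‖x‖ ^ 2 - ε₀) {Δ : ℝ} (hΔ : 0 < Δ) :
    ∃ δ₀ σ₀ : ℝ, 0 < δ₀ ∧ 0 < σ₀ ∧ σ₀ ≤ 1 / 2 ∧ ∀ B M : Set (EuclideanSpace ℝ (Fin d)),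
      MeasurableSet B → MeasurableSet M → B ⊆ M → z₀ ∈ interior B →
      B ⊆ Metric.closedBall z₀ δ₀ → Metric.ball z₀ Δ ⊆ Mᶜ ∪ B →
      ∃ c : ℝ, 0 < c ∧ ∀ σ, 0 < σ → σ < σ₀ → ∀ n : ℕ, c * Real.log σ⁻¹ ≤ n → ∀ y ∈ B,
        (∃ H ≠ ∞, ∀ x ∈ B, iterDensity (traceDensity (k σ) M) B n x y ≤ H) ∧
        ∀ x ∈ B, ∀ x' ∈ B, iterDensity (traceDensity (k σ) M) B n x y ≤
          ENNReal.ofReal (3 / 2) * iterDensity (traceDensity (k σ) M) B n x' y := by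
  have hK := hb.one_le
  obtain ⟨N, C, ρ, r₀, hC, hρ0, hρ1, hr₀, hN, hcon⟩ := exists_adapted_seminorm hF hz₀
  set R := min r₀ (Δ / 2) / 3 with hRdef
  have hR : 0 < R := by positivity
  have hRr : 3 * R ≤ r₀ := by rw [hRdef]; linarith [min_le_left r₀ (Δ / 2)]
  have hRΔ : 3 * R < Δ := by rw [hRdef]; linarith [min_le_right r₀ (Δ / 2)]
  have hs : StableBall F N z₀ C ρ R := ⟨hC, hρ0, hρ1, hR, fun v => (hN v).1, fun v => (hN v).2,
    hz₀.1, fun x y hx hy => hcon x y (hx.trans hRr) (hy.trans hRr)⟩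
  obtain ⟨r₁, hr₁, hr₁R, c₀, hc₀, hdich⟩ := exists_local_dichotomy hs hb
  obtain ⟨σ₁, hσ₁, hσ₁sub⟩ := mem_nhdsGT_iff_exists_Ioo_subset.1 hdich
  -- The diameter bound puts `B` into the `N`-ball of radius `r₁`, and `ε₀ / (2 * K)` ensures the
  -- moment condition `K σ ^ 2 ≤ ε₀ / 2` of the Lyapunov bound. Both thresholds are fixed before `B`
  -- is introduced.
  refine ⟨r₁ / C, min σ₁ (min (1 / 2) (ε₀ / (2 * K))), by positivity,
    lt_min hσ₁ (by positivity), (min_le_right _ _).trans (min_le_left _ _), ?_⟩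
  intro B M hB hM hBM hint hBδ hMΔ
  have hT : LocalTarget N z₀ R r₁ B M := by
    refine ⟨hB, hM, hBM, fun x hx => ?_, fun x hx => hMΔ ?_⟩
    · rw [Seminorm.mem_closedBall]
      have h1 : ‖x - z₀‖ ≤ r₁ / C := by simpa [dist_eq_norm] using hBδ hx
      calc N (x - z₀) ≤ C * ‖x - z₀‖ := hs.le_norm _
        _ ≤ C * (r₁ / C) := by gcongr
        _ = r₁ := by field_simp
    · rw [Metric.mem_ball, dist_eq_norm]
      exact (hs.norm_le _).trans_lt (((Seminorm.mem_closedBall N).1 hx).trans_lt hRΔ)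
  obtain ⟨r', hr', hr'B⟩ := Metric.mem_nhds_iff.1 (mem_interior_iff_mem_nhds.1 hint)
  have hBR : B ⊆ N.closedBall z₀ R := hT.subset_ball.trans (seminorm_closedBall_mono hr₁R)
  have hnormR : ∀ x ∈ N.closedBall z₀ R, ‖x‖ ≤ ‖z₀‖ + R := by
    intro x hx
    have h1 := (hs.norm_le (x - z₀)).trans ((Seminorm.mem_closedBall N).1 hx)
    have h2 := norm_le_norm_sub_add x z₀
    linarith
  obtain ⟨J, hJ0, hJ⟩ := hb.exists_traceDensity_le_exp hF.continuous hε₀ hcontr z₀ hr' (‖z₀‖ + R)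
  have hupper : ∀ σ, 0 < σ → σ < min (1 / 2) (ε₀ / (2 * K)) → ∀ x ∈ N.closedBall z₀ R, ∀ y,
      traceDensity (k σ) M x y ≤ ENNReal.ofReal (Real.exp (J / σ ^ 2)) := by
    intro σ hσ hσlt x hx y
    have h1 : σ < 1 / 2 := hσlt.trans_le (min_le_left _ _)
    have h2 : σ * (2 * K) < ε₀ := by
      rw [← lt_div_iff₀ (by positivity)]
      exact hσlt.trans_le (min_le_right _ _)
    have h3 : K * σ ^ 2 ≤ K * σ := by
      gcongr
      nlinarith
    exact hJ σ hσ (by linarith) (by linarith) M hM (hr'B.trans hBM) x (hnormR x hx) y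
  set r := min R (r' / 4) with hrdef
  have hr : 0 < r := by positivity
  have hrB : N.closedBall z₀ (3 * r) ⊆ B := by
    intro x hx
    apply hr'B
    rw [Metric.mem_ball, dist_eq_norm]
    have h1 := (hs.norm_le (x - z₀)).trans ((Seminorm.mem_closedBall N).1 hx)
    have h2 : r ≤ r' / 4 := min_le_right _ _
    linarith
  obtain ⟨c₂, hc₂, hsmall⟩ := exists_harnack_of_small_noise hs hb hr₁R hT hr (min_le_left _ _) hrB
    hJ0 (by
      filter_upwards [Ioo_mem_nhdsGT (show 0 < min (1 / 2) (ε₀ / (2 * K)) by positivity)]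
        with σ hσ x hx y
      exact hupper σ hσ.1 hσ.2 x (hBR hx) y)
  -- This level depends on `B`, so it may only enter the constant `c`. For `σ ≥ σB` the exponential
  -- bounds on the trace density become constants, and the Hopf contraction takes a number `n₁` of
  -- steps independent of `σ`.
  obtain ⟨σB, hσB, hσBsub⟩ := mem_nhdsGT_iff_exists_Ioo_subset.1 hsmall
  have hσB0 : 0 < σB := hσB
  set J' := K * (2 * R) ^ 2 + K with hJ'
  have hJ'0 : 0 ≤ J' := by positivity
  obtain ⟨n₁, hn₁⟩ := exists_hopf (d := d) (c₁ := Real.exp (-(J' / σB ^ 2)))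
    (c₂ := Real.exp (J / σB ^ 2)) (Real.exp_pos _) (by
      apply Real.exp_le_exp.2
      have h1 : 0 ≤ J' / σB ^ 2 := by positivity
      have h2 : 0 ≤ J / σB ^ 2 := by positivity
      linarith)
  -- The three terms cover the coupling for small noise, the survival comparison and the Hopf
  -- contraction. The factor 2 is there because `log σ⁻¹ ≥ 1/2`.
  refine ⟨c₂ + c₀ + 2 * (n₁ + 1), by positivity, fun σ hσ hσlt n hn => ?_⟩
  have hσ12 : σ < min (1 / 2) (ε₀ / (2 * K)) := hσlt.trans_le (min_le_right _ _)
  have hσhalf : σ < 1 / 2 := hσ12.trans_le (min_le_left _ _)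
  have hlog := half_le_log_inv hσ hσhalf.le
  have hk := hb.measurable σ
  have hk1 := hb.lintegral_eq_one hσ
  have hkt := measurable_traceDensity (M := M) hk
  have hmass := stepOn_traceDensity_one_le hk hk1 hB hBM
  have hpos1 : 0 < c₂ * Real.log σ⁻¹ := by positivity
  have hpos2 : 0 < c₀ * Real.log σ⁻¹ := by positivity
  have hpos3 : (n₁ : ℝ) + 1 ≤ 2 * (n₁ + 1) * Real.log σ⁻¹ := by
    calc (n₁ : ℝ) + 1 = 2 * (n₁ + 1) * (1 / 2) := by ring
      _ ≤ _ := by gcongr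
  have hn' : c₂ * Real.log σ⁻¹ + c₀ * Real.log σ⁻¹ + (n₁ + 1) ≤ n := by linarith
  obtain ⟨n', rfl⟩ : ∃ n', n = n' + 1 := by
    refine ⟨n - 1, ?_⟩
    have : (0 : ℝ) < n := by linarith [(Nat.cast_nonneg n₁ : (0 : ℝ) ≤ n₁)]
    have : 0 < n := by exact_mod_cast this
    omega
  have hharnack : ∀ x ∈ B, ∀ x' ∈ B, ∀ y ∈ B,
      iterDensity (traceDensity (k σ) M) B (n' + 1) x y ≤
        ENNReal.ofReal (3 / 2) * iterDensity (traceDensity (k σ) M) B (n' + 1) x' y := by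
    rcases lt_or_ge σ σB with hlt | hge
    · obtain ⟨T, hTlog, hTH⟩ := hσBsub ⟨hσ, hlt⟩
      refine iterDensity_harnack_mono hkt hB (n := T) ?_ hTH
      have : ((T + 1 : ℕ) : ℝ) ≤ ((n' + 1 : ℕ) : ℝ) := by
        rw [Nat.cast_succ]
        linarith [(Nat.cast_nonneg n₁ : (0 : ℝ) ≤ n₁)]
      have : T + 1 ≤ n' + 1 := by exact_mod_cast this
      omega
    · obtain ⟨m, hmlog, hm⟩ := hσ₁sub ⟨hσ, hσlt.trans_le (min_le_left _ _)⟩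
      rcases hm B M hT _ ENNReal.ofReal_ne_top (hupper σ hσ hσ12) with hA | hQ
      · refine iterDensity_harnack_mono hkt hB (n := 0) (Nat.zero_le _) fun x hx x' hx' y hy => ?_
        refine (hA x hx x' hx' y hy).trans (mul_le_mul' (ENNReal.ofReal_le_ofReal ?_) le_rfl)
        norm_num
      · refine iterDensity_harnack_mono hkt hB (n := n₁ + m) ?_ fun x hx x' hx' y hy => ?_
        · have : ((n₁ + m + 1 : ℕ) : ℝ) ≤ ((n' + 1 : ℕ) : ℝ) := by
            push_cast at hn' ⊢
            linarith
          have : n₁ + m + 1 ≤ n' + 1 := by exact_mod_cast this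
          omega
        have hup : ∀ x ∈ B, ∀ y, traceDensity (k σ) M x y ≤
            ENNReal.ofReal (Real.exp (J / σB ^ 2)) := fun x hx y =>
          (hupper σ hσ hσ12 x (hBR hx) y).trans (ENNReal.ofReal_le_ofReal
            (Real.exp_le_exp.2 (by gcongr)))
        have hlo : ∀ x ∈ B, ∀ y ∈ B, ENNReal.ofReal (Real.exp (-(J' / σB ^ 2))) ≤
            traceDensity (k σ) M x y := by
          intro x hx y hy
          refine le_trans (ENNReal.ofReal_le_ofReal (Real.exp_le_exp.2 (neg_le_neg (by gcongr))))
            ((kernel_lower_of_mem_ball hs hb hr₁R hσ (by linarith) (hBR hx) (hT.subset_ball hy)).trans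
              (le_traceDensity x y))
        have hB0 : volume B ≠ 0 :=
          ((Metric.measure_ball_pos volume z₀ hr').trans_le (measure_mono hr'B)).ne'
        have hBt : volume B ≠ ∞ :=
          ne_top_of_le_ne_top measure_closedBall_lt_top.ne (measure_mono hBδ)
        rw [iterDensity_succ, iterDensity_succ]
        refine le_of_ratio (hn₁ (n₁ + m) (by omega) _ B (fun z => traceDensity (k σ) M z y) hkt hB
          (measurable_kernel_right hkt y) hB0 hBt hmass hlo (fun x hx y _ => hup x hx y)
          (fun x hx => hlo x hx y hy) (fun x hx => hup x hx y) x hx x' hx')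
          (hQ (n₁ + m) (by omega) x hx x' hx') ?_ ?_
        · have h1 := pow_le_iterate_stepOn_one hkt hB
            (q := ENNReal.ofReal (Real.exp (-(J' / σB ^ 2))) * volume B) (fun z hz => by
              rw [← setLIntegral_const, stepOn]
              simp only [mul_one]
              exact setLIntegral_mono' hB (hlo z hz)) (n₁ + m) x' hx'
          refine (lt_of_lt_of_le (pos_iff_ne_zero.2 (pow_ne_zero _ (mul_ne_zero ?_ hB0))) h1).ne'
          simp [Real.exp_pos]
        · have h1 := trace_iterate_one_antitone hk hk1 hB hBM (Nat.zero_le (n₁ + m)) x'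
          exact ne_top_of_le_ne_top ENNReal.one_ne_top h1
  intro y hy
  exact ⟨⟨_, ENNReal.ofReal_ne_top, iterDensity_le_const hkt hB hmass
    (fun x hx => hupper σ hσ hσ12 x (hBR hx) y) n'⟩, fun x hx x' hx' => hharnack x hx x' hx' y hy⟩

end LocalHarnack

/-! ### Combination of the local estimates -/

lemma exists_log_le_exp {C η : ℝ} (hC : 0 < C) (hη : 0 < η) :
    ∃ σ₁ : ℝ, 0 < σ₁ ∧ ∀ σ, 0 < σ → σ < σ₁ → C * Real.log σ⁻¹ ≤ Real.exp (η / σ ^ 2) := by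
  obtain ⟨u, hu, hsub⟩ := mem_nhdsGT_iff_exists_Ioo_subset.1
    (eventually_pow_mul_exp_le hC.le hη one_pos 1)
  refine ⟨u, hu, fun σ hσ hσu => ?_⟩
  have h1 : C * σ⁻¹ ^ 1 * Real.exp (-(η / σ ^ 2)) ≤ 1 := hsub ⟨hσ, hσu⟩
  rw [pow_one, Real.exp_neg, ← div_eq_mul_inv, div_le_one (Real.exp_pos _)] at h1
  exact (mul_le_mul_of_nonneg_left (log_inv_le hσ) hC.le).trans h1

/-- The reciprocal of one plus the sum of reciprocals serves in place of the minimum, and is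
positive for an empty index type too. -/
lemma exists_pos_le {ι : Type*} [Fintype ι] {f : ι → ℝ} (hf : ∀ i, 0 < f i) :
    ∃ a, 0 < a ∧ ∀ i, a ≤ f i := by
  have h0 : 0 ≤ ∑ i, (f i)⁻¹ := Finset.sum_nonneg fun i _ => (inv_pos.2 (hf i)).le
  refine ⟨(1 + ∑ i, (f i)⁻¹)⁻¹, by positivity, fun i => ?_⟩
  rw [inv_le_comm₀ (by positivity) (hf i)]
  have := Finset.single_le_sum (f := fun i => (f i)⁻¹) (fun i _ => (inv_pos.2 (hf i)).le)
    (Finset.mem_univ i)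
  linarith

lemma exists_separation {d N : ℕ} {xs : Fin N → EuclideanSpace ℝ (Fin d)}
    (hxs : Function.Injective xs) :
    ∃ Δ : ℝ, 0 < Δ ∧ ∀ i j, i ≠ j → Δ ≤ dist (xs i) (xs j) := by
  obtain ⟨Δ, hΔ, h⟩ := exists_pos_le (f := fun p : Fin N × Fin N =>
    if p.1 = p.2 then 1 else dist (xs p.1) (xs p.2)) fun p => by
      split_ifs with hp
      · exact one_pos
      · exact dist_pos.2 fun h => hp (hxs h)
  refine ⟨Δ, hΔ, fun i j hij => ?_⟩
  simpa [hij] using h (i, j)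

/-- A point of another `B j` is within `Δ / 2` of `xs j`, hence not strictly within `Δ / 2` of `xs
i`. Near one fixed point the chain therefore sees no part of `M` other than `B i`. -/
lemma ball_subset_compl_union {d N : ℕ} {F : EuclideanSpace ℝ (Fin d) → EuclideanSpace ℝ (Fin d)}
    {xs : Fin N → EuclideanSpace ℝ (Fin d)} {B : Fin N → Set (EuclideanSpace ℝ (Fin d))} {δ Δ : ℝ}
    (hB : IsMetastableFamily F xs B δ) (hsep : ∀ i j, i ≠ j → Δ ≤ dist (xs i) (xs j))
    (hδ : δ ≤ Δ / 2) (i : Fin N) :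
    Metric.ball (xs i) (Δ / 2) ⊆ (⋃ j, B j)ᶜ ∪ B i := by
  intro y hy
  by_cases hyM : y ∈ ⋃ j, B j
  · obtain ⟨j, hj⟩ := Set.mem_iUnion.1 hyM
    rcases eq_or_ne i j with rfl | hij
    · exact Or.inr hj
    · have h1 := hsep i j hij
      have h2 := hB.diam_le j y hj (xs j) (interior_subset (hB.mem_interior j))
      have h3 := Metric.mem_ball'.1 hy
      have h4 := dist_triangle (xs i) y (xs j)
      linarith
  · exact Or.inl hyM

lemma uniformPositivityCondition_of_harnack {d : ℕ} {A : Set (EuclideanSpace ℝ (Fin d))}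
    {κ : EuclideanSpace ℝ (Fin d) → Set (EuclideanSpace ℝ (Fin d)) → ℝ≥0∞}
    {k : EuclideanSpace ℝ (Fin d) → EuclideanSpace ℝ (Fin d) → ℝ≥0∞} {n : ℕ} {L : ℝ}
    (hdens : ∀ x ∈ A, ∀ C, MeasurableSet C → C ⊆ A → κ x C = ∫⁻ y in C, k x y)
    (hn : 1 ≤ n) (hL : 1 < L)
    (h : ∀ y ∈ A, (∃ H ≠ ∞, ∀ x ∈ A, iterDensity k A n x y ≤ H) ∧
      ∀ x ∈ A, ∀ x' ∈ A, iterDensity k A n x y ≤ ENNReal.ofReal L * iterDensity k A n x' y) :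
    UniformPositivityCondition A κ k n L where
  density := hdens
  one_le := hn
  one_lt := hL
  finite y hy := by
    obtain ⟨H, hH, hle⟩ := (h y hy).1
    exact (iSup₂_le hle).trans_lt hH.lt_top
  sup_le_inf y hy := by
    have hL0 : ENNReal.ofReal L ≠ 0 := by simp; linarith
    refine iSup₂_le fun x hx => ?_
    rw [ENNReal.mul_iInf_of_ne hL0 ENNReal.ofReal_ne_top]
    refine le_iInf fun x' => ?_
    rw [ENNReal.mul_iInf_of_ne hL0 ENNReal.ofReal_ne_top]
    exact le_iInf fun hx' => (h y hy).2 x hx x' hx'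

end MetastableChain

end

/-! ### The main theorem: the local estimates combined over all fixed points. -/

open MetastableChain in
theorem proposition4p1 {d N : ℕ}
    (F : EuclideanSpace ℝ (Fin d) → EuclideanSpace ℝ (Fin d))
    (D : Set (EuclideanSpace ℝ (Fin d))) (xs : Fin N → EuclideanSpace ℝ (Fin d))
    (hdet : DeterministicLimit F D xs)
    (R₀ ε₀ : ℝ) (hR₀ : 0 < R₀) (hε₀ : 0 < ε₀)
    (hcontr : ∀ x, R₀ ≤ ‖x‖ → ‖F x‖ ^ 2 ≤ ‖x‖ ^ 2 - ε₀)
    (S : Matrix (Fin d) (Fin d) ℝ) (hS : S.PosDef)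
    {Ω : Type*} [MeasurableSpace Ω] (P : Measure Ω) [IsProbabilityMeasure P]
    (ξ : ℕ → Ω → EuclideanSpace ℝ (Fin d))
    (hindep : iIndepFun ξ P)
    (hlaw : ∀ n, HasLaw (ξ n) (multivariateGaussian 0 S) P) :
    ∃ δ₀ σ₀ : ℝ, 0 < δ₀ ∧ 0 < σ₀ ∧
      ∀ B : Fin N → Set (EuclideanSpace ℝ (Fin d)), IsMetastableFamily F xs B δ₀ →
        ∃ n₀ : ℝ → ℕ,
          UniformPositivity B
            (fun σ i => killedTraceKernel P (chain F ξ σ) (⋃ j, B j) (B i))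
            (fun σ _ => traceDensity (gaussianStepDensity F S σ) (⋃ j, B j))
            σ₀ n₀ ∧
          ∃ c C : ℝ, 0 < c ∧ 0 < C ∧ ∀ σ, 0 < σ → σ < σ₀ →
            c * Real.log σ⁻¹ ≤ n₀ σ ∧ (n₀ σ : ℝ) ≤ C * Real.log σ⁻¹ := by
  have hF : Measurable F := hdet.contDiff.continuous.measurable
  obtain ⟨K, hb⟩ := exists_kernelBounds F hF hS
  obtain ⟨Δ, hΔ, hsep⟩ := exists_separation hdet.injective
  choose δ σ' hδ hσ' hσ'half hlocal using fun i =>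
    exists_local_harnack hb hdet.contDiff (hdet.stable i) hε₀ hcontr (half_pos hΔ)
  obtain ⟨δ₁, hδ₁, hδ₁le⟩ := exists_pos_le hδ
  obtain ⟨σ₁, hσ₁, hσ₁le⟩ := exists_pos_le hσ'
  refine ⟨min δ₁ (Δ / 2), min σ₁ (1 / 2), by positivity, by positivity, fun B hB => ?_⟩
  have hMm : MeasurableSet (⋃ j, B j) :=
    MeasurableSet.iUnion fun j => (hB.isClosed j).measurableSet
  choose C hC hharnack using fun i => hlocal i (B i) (⋃ j, B j) (hB.isClosed i).measurableSet hMm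
    (Set.subset_iUnion B i) (hB.mem_interior i)
    (fun x hx => Metric.mem_closedBall.2 ((hB.diam_le i x hx (xs i)
      (interior_subset (hB.mem_interior i))).trans ((min_le_left _ _).trans (hδ₁le i))))
    (ball_subset_compl_union hB hsep (min_le_right _ _) i)
  set A := 1 + ∑ i, C i with hA
  have hCA : ∀ i, C i ≤ A := fun i => by
    have := Finset.single_le_sum (f := C) (fun i _ => (hC i).le) (Finset.mem_univ i)
    linarith
  have hA0 : 0 < A := by
    have := Finset.sum_nonneg fun i (_ : i ∈ Finset.univ) => (hC i).le
    linarith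
  have hlog : ∀ σ, 0 < σ → σ < min σ₁ (1 / 2) → 1 / 2 ≤ Real.log σ⁻¹ := fun σ hσ hσlt =>
    half_le_log_inv hσ (hσlt.le.trans (min_le_right _ _))
  -- As `A` dominates every `C i`, this time is admissible at all fixed points simultaneously. The
  -- maximum with one gives `n₀ ≥ 1` for every `σ`, and rounding up costs at most `2 * log σ⁻¹`
  -- because `log σ⁻¹ ≥ 1/2`.
  set n₀ : ℝ → ℕ := fun σ => max 1 ⌈A * Real.log σ⁻¹⌉₊ with hn₀
  have hlower : ∀ σ, A * Real.log σ⁻¹ ≤ n₀ σ := fun σ =>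
    (Nat.le_ceil _).trans (Nat.cast_le.2 (le_max_right _ _))
  have hupper : ∀ σ, 0 < σ → σ < min σ₁ (1 / 2) → (n₀ σ : ℝ) ≤ (A + 2) * Real.log σ⁻¹ := by
    intro σ hσ hσlt
    have h1 := hlog σ hσ hσlt
    have h2 : 0 ≤ A * Real.log σ⁻¹ := by positivity
    have h3 := Nat.ceil_lt_add_one h2
    rw [hn₀, Nat.cast_max, Nat.cast_one]
    exact max_le (by linarith) (by linarith)
  refine ⟨n₀, ⟨⟨3 / 2, by norm_num, by norm_num, fun σ hσ hσlt i => ?_⟩, fun η hη => ?_⟩,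
    A, A + 2, hA0, by positivity, fun σ hσ hσlt => ⟨hlower σ, hupper σ hσ hσlt⟩⟩
  · refine uniformPositivityCondition_of_harnack (fun x _ E hE hEB => killedTraceKernel_eq hF hMm
      hindep hS hlaw hσ (Set.subset_iUnion B i) hE hEB x) (le_max_left _ _) (by norm_num) ?_
    refine hharnack i σ hσ (hσlt.trans_le ((min_le_left _ _).trans (hσ₁le i))) (n₀ σ) ?_
    have h1 := hlog σ hσ hσlt
    refine le_trans ?_ (hlower σ)
    gcongr
    exact hCA i
  · obtain ⟨s, hs, hexp⟩ := exists_log_le_exp (C := A + 2) (by positivity) hη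
    have hs' : 0 < min s (min σ₁ (1 / 2)) := by positivity
    refine ⟨min s (min σ₁ (1 / 2)) / 2, by positivity, fun σ hσ hσle => ?_⟩
    have hlt : σ < min s (min σ₁ (1 / 2)) := by linarith
    exact (hupper σ hσ (hlt.trans_le (min_le_right _ _))).trans
      (hexp σ hσ (hlt.trans_le (min_le_left _ _)))
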